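/- Let $X$ be a finite (Hausdorff) CW complex such that every open $p$-cell $\sigma$ that meets the closure of an open $(p+1)$-cell $\tau$ is contained in $\overline{\tau}$; in this case $\sigma$ is called a face of $\tau$, written $\sigma<\tau$. The face $\sigma$ is a *regular face* of $\tau$ if, for some characteristic map $h\colon B\to X$ of $\tau$, the map $h\colon h^{-1}(\sigma)\to\sigma$ is a homeomorphism and $\overline{h^{-1}(\sigma)}$ is a closed $p$-ball. Let $W$ be a discrete gradient vector field on $X$, that is, a sequence of injective partial functions $W_p$ from the $p$-cells to the $(p+1)$-cells of $X$ such that $\sigma$ is a regular face of $W_p(\sigma)$ whenever $W_p(\sigma)$ is defined, $\operatorname{im}W_p\cap\operatorname{dom}W_{p+1}=\emptyset$, and there are no non-stationary closed $W$-paths. Here a $W$-path is a sequence $\sigma_0,\dots,\sigma_r$ ($r\ge 1$) of $p$-cells such that $\sigma_{i+1}=\sigma_i$ if $W(\sigma_i)$ is undefined, and otherwise $\sigma_{i+1}\ne\sigma_i$ and $\sigma_{i+1}<W(\sigma_i)$; it is closed if $\sigma_r=\sigma_0$ and non-stationary if $\sigma_1\neq\sigma_0$. A cell is *redundant* if it lies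 in $\operatorname{dom}W$, *collapsible* if it lies in $\operatorname{im}W$, and *critical* otherwise. Let $m_n$ be the number of critical $n$-cells. Let $X_n'$ be the $n$-skeleton of $X$ with the redundant $n$-cells removed, and $X_n''$ the $n$-skeleton with the redundant and the critical $n$-cells removed. For subcomplexes $F\subseteq E$ of $X$, an *elementary collapse* of $E$ to $F$ means that $E=F\cup e^{n-1}\cup e^{n}$ for open cells $e^{n-1},e^n$ not in $F$, and that there are a ball pair $(Q^n,Q^{n-1})\approx(I^n,I^{n-1})$ and a characteristic map $\phi\colon Q^n\to E$ of $e^n$ such that $\phi|_{Q^{n-1}}$ is a characteristic map of $e^{n-1}$ and $\phi(\overline{\partial Q^n\setminus Q^{n-1}})\subseteq F^{n-1}$, the $(n-1)$-skeleton of $F$. Write $E\searrow F$ if $F$ is obtained from $E$ by a finite sequence of elementary collapses. Then $\emptyset=X_0''\subseteq X_0'\subseteq X_1''\subseteq X_1'\subseteq\cdots$, with $X_n'=X$ for all large $n$, and the following hold. **A.** 1. For every $n\ge 0$, $X_n'$ is obtained from $X_n''$ by attaching $m_n$ $n$-cells along their boundaries. 2. For every $n\ge 0$, $X_{n+1}''\searrow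 X_n'$. **B.** 1. For every $n\ge 1$ and every base point in $X_n'$, the inclusion $X_n'\hookrightarrow X$ induces an isomorphism $\pi_{n-1}(X_n')\to\pi_{n-1}(X)$ (a bijection if $n=1$). 2. If $X$ has no critical cells of dimension greater than $k$ ($k\ge 0$), then $X\searrow X_k'$. 3. $X$ is homotopy equivalent to a finite CW complex with exactly $m_n$ cells of dimension $n$ for every $n$. 4. If $X$ is connected, then $X_1'$ is connected, and so is the union of the closures of the collapsible and critical edges (which may be empty). 5. The subcomplex consisting of the $0$-skeleton and the collapsible edges, which is $X_1''$, is a maximal forest in the sense that it is a forest (a graph whose components are contractible) that contains every vertex of $X$. 6. If there is exactly one critical $0$-cell, then $X_1''$ is a maximal tree of $X$, that is, a contractible graph that contains every vertex of $X$; if there is at least one collapsible edge, then $X_1''$ is the union of the closures of the collapsible edges. -/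

import Mathlib

open Topology Metric Set

universe u

noncomputable section

namespace DiscreteMorse

section Complex

variable {X : Type u} [TopologicalSpace X] [T2Space X] {C : Set X} [CWComplex C]

/-- `φ` is a characteristic map of the open `n`-cell `c`, with the cube `[-1, 1]^n` (the unit ball
of `ℝ^n` in the maximum norm) as the model of the closed `n`-ball: `φ` is continuous on the cube,
maps its interior homeomorphically onto the open cell, and its boundary into the
`(n-1)`-skeleton. -/
structure IsCharMap (n : ℕ) (c : RelCWComplex.cell C n) (φ : (Fin n → ℝ) → X) : Prop where
  continuousOn : ContinuousOn φ (closedBall 0 1)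
  homeo : ∃ e : (ball (0 : Fin n → ℝ) 1) ≃ₜ (RelCWComplex.openCell n c), ∀ x, (e x : X) = φ x
  mapsTo : MapsTo φ (sphere 0 1) (RelCWComplex.skeletonLT C n)

/-- `s < t` for cells of consecutive dimensions (such cells are automatically distinct). -/
def IsFace {p : ℕ} (s : RelCWComplex.cell C p) (t : RelCWComplex.cell C (p + 1)) : Prop :=
  RelCWComplex.openCell p s ⊆ closure (RelCWComplex.openCell (p + 1) t)

variable (C) in
/-- An open `p`-cell that meets the closure of a `(p+1)`-cell is contained in this closure. -/
def FaceCondition : Prop :=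
  ∀ (p : ℕ) (s : RelCWComplex.cell C p) (t : RelCWComplex.cell C (p + 1)),
    (RelCWComplex.openCell p s ∩ closure (RelCWComplex.openCell (p + 1) t)).Nonempty → IsFace s t

/-- `s` is a regular face of `t`: for some characteristic map `h : B → X` of `t`, the map
`h : h⁻¹(s) → s` is a homeomorphism, and the closure of `h⁻¹(s)` is a closed `p`-ball. -/
def IsRegularFace {p : ℕ} (s : RelCWComplex.cell C p) (t : RelCWComplex.cell C (p + 1)) : Prop :=
  IsFace s t ∧ ∃ h : (Fin (p + 1) → ℝ) → X, IsCharMap (p + 1) t h ∧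
    (∃ e : (closedBall (0 : Fin (p + 1) → ℝ) 1 ∩ h ⁻¹' RelCWComplex.openCell p s : Set _) ≃ₜ
        (RelCWComplex.openCell p s), ∀ x, (e x : X) = h x) ∧
    Nonempty (closure (closedBall (0 : Fin (p + 1) → ℝ) 1 ∩ h ⁻¹' RelCWComplex.openCell p s) ≃ₜ
      closedBall (0 : Fin p → ℝ) 1)

/-! ### Collapses -/

/-- The inclusion of `ℝ^n` in `ℝ^(n+1)` as the hyperplane where the last coordinate is `-1`. It
identifies the `n`-cube with the bottom face of the `(n+1)`-cube; the two form the standard ball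
pair. -/
def faceIncl (n : ℕ) (x : Fin n → ℝ) : Fin (n + 1) → ℝ :=
  Fin.snoc (α := fun _ => ℝ) x (-1)

/-- The closure of the boundary of the `(n+1)`-cube minus the bottom face. -/
def openBox (n : ℕ) : Set (Fin (n + 1) → ℝ) :=
  closure (sphere 0 1 \ faceIncl n '' closedBall 0 1)

/-- The subcomplex `E` collapses to the subcomplex `F` by an elementary collapse. -/
def ElementaryCollapse (E F : RelCWComplex.Subcomplex C) : Prop :=
  ∃ (n : ℕ) (s : RelCWComplex.cell C n) (t : RelCWComplex.cell C (n + 1)),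
    s ∉ F.I n ∧ t ∉ F.I (n + 1) ∧
    (E : Set X) = (F : Set X) ∪ RelCWComplex.openCell n s ∪ RelCWComplex.openCell (n + 1) t ∧
    ∃ φ : (Fin (n + 1) → ℝ) → X, IsCharMap (n + 1) t φ ∧ IsCharMap n s (φ ∘ faceIncl n) ∧
      MapsTo φ (openBox n) ((F : Set X) ∩ RelCWComplex.skeleton C n)

/-- `E` collapses to `F`: there is a finite sequence of elementary collapses from `E` to `F`. -/
def Collapses (E F : RelCWComplex.Subcomplex C) : Prop :=
  Relation.ReflTransGen ElementaryCollapse E F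

/-! ### Discrete gradient vector fields -/

variable (C) in
/-- A discrete vector field: partial functions from the `p`-cells to the `(p+1)`-cells. -/
structure VectorField where
  W : ∀ p : ℕ, RelCWComplex.cell C p → Option (RelCWComplex.cell C (p + 1))
  injective : ∀ p s s' t, W p s = some t → W p s' = some t → s = s'
  regular : ∀ p s t, W p s = some t → IsRegularFace s t
  disjoint : ∀ p s t, W p s = some t → W (p + 1) t = none

namespace VectorField

variable (V : VectorField C)

/-- The condition on two successive cells of a `W`-path. -/
def Step (p : ℕ) (s s' : RelCWComplex.cell C p) : Prop :=
  (V.W p s = none → s' = s) ∧ ∀ t, V.W p s = some t → s' ≠ s ∧ IsFace s' t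

/-- `σ 0, …, σ r` is a `W`-path (the values of `σ` beyond `r` play no role). -/
def IsPath (p r : ℕ) (σ : ℕ → RelCWComplex.cell C p) : Prop :=
  ∀ i < r, V.Step p (σ i) (σ (i + 1))

/-- A discrete gradient vector field has no non-stationary closed paths. -/
def IsGradient : Prop :=
  ∀ (p r : ℕ) (σ : ℕ → RelCWComplex.cell C p),
    1 ≤ r → V.IsPath p r σ → σ r = σ 0 → σ 1 = σ 0

/-- A cell is redundant if it lies in the domain of `W`. -/
def IsRedundant (n : ℕ) (c : RelCWComplex.cell C n) : Prop :=
  ∃ t, V.W n c = some t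

/-- A cell is collapsible if it lies in the image of `W`. -/
def IsCollapsible : ∀ n : ℕ, RelCWComplex.cell C n → Prop
  | 0, _ => False
  | n + 1, c => ∃ s, V.W n s = some c

/-- All other cells are critical. -/
def IsCritical (n : ℕ) (c : RelCWComplex.cell C n) : Prop :=
  ¬ V.IsRedundant n c ∧ ¬ V.IsCollapsible n c

/-- The number `m_n` of critical `n`-cells. -/
def numCritical (n : ℕ) : ℕ := Nat.card {c : RelCWComplex.cell C n // V.IsCritical n c}

end VectorField

variable (C) in
/-- The `n`-skeleton with all those `n`-cells removed that do not satisfy `P`. -/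
def partialSkeleton (n : ℕ) (P : ∀ m : ℕ, RelCWComplex.cell C m → Prop) :
    RelCWComplex.Subcomplex C :=
  CWComplex.Subcomplex.mk' C
    (⋃ (m : ℕ) (j : {i : RelCWComplex.cell C m | m ≤ n ∧ (m = n → P m i)}),
      RelCWComplex.openCell m (j : RelCWComplex.cell C m))
    (fun m => {i | m ≤ n ∧ (m = n → P m i)})
    (by
      rintro m ⟨i, hi⟩
      rw [← RelCWComplex.cellFrontier_union_openCell_eq_closedCell]
      refine union_subset (fun x hx => ?_) (fun x hx => mem_iUnion₂.2 ⟨m, ⟨i, hi⟩, hx⟩)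
      have hx' := RelCWComplex.cellFrontier_subset_skeletonLT m i hx
      obtain ⟨l, hl, j, hj⟩ := CWComplex.mem_skeletonLT_iff.1 hx'
      have hl' : l < m := by exact_mod_cast hl
      exact mem_iUnion₂.2 ⟨l, ⟨j, (hl'.trans_le hi.1).le,
        fun h => absurd h (hl'.trans_le hi.1).ne⟩, hj⟩)
    rfl

namespace VectorField

variable (V : VectorField C)

/-- `X'_n`: the `n`-skeleton with the redundant `n`-cells removed. -/
def X' (n : ℕ) : RelCWComplex.Subcomplex C :=
  partialSkeleton C n fun m c => ¬ V.IsRedundant m c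

/-- `X''_n`: the `n`-skeleton with the redundant and the critical `n`-cells removed. -/
def X'' (n : ℕ) : RelCWComplex.Subcomplex C :=
  partialSkeleton C n fun m c => ¬ V.IsRedundant m c ∧ ¬ V.IsCritical m c

end VectorField

/-! ### Trees and forests -/

/-- A graph: no cells of dimension greater than `1`. -/
def IsGraph (E : RelCWComplex.Subcomplex C) : Prop :=
  ∀ n, 1 < n → E.I n = ∅

/-- A forest is a graph all of whose components are contractible. -/
def IsForest (E : RelCWComplex.Subcomplex C) : Prop :=
  IsGraph E ∧ ∀ x ∈ E, ContractibleSpace (connectedComponentIn (E : Set X) x)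

/-- A tree is a contractible graph. -/
def IsTree (E : RelCWComplex.Subcomplex C) : Prop :=
  IsGraph E ∧ ContractibleSpace (E : Set X)

/-- A maximal forest is a forest that contains every vertex of the complex. -/
def IsMaximalForest (E : RelCWComplex.Subcomplex C) : Prop :=
  IsForest E ∧ E.I 0 = univ

/-- A maximal tree is a tree that contains every vertex of the complex. -/
def IsMaximalTree (E : RelCWComplex.Subcomplex C) : Prop :=
  IsTree E ∧ E.I 0 = univ

end Complex

/-! ### Attaching cells and homotopy groups -/

/-- The inclusion of a subset in a larger subset as a continuous map. -/
def incl {X : Type u} [TopologicalSpace X] {A B : Set X} (h : A ⊆ B) : C(A, B) :=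
  ⟨inclusion h, continuous_inclusion h⟩

/-- `B` is obtained from its subspace `A` by attaching `m` cells of dimension `n` along their
boundaries: the inclusion of `A` in `B` is a pushout, in topological spaces, of the inclusion
of the boundaries of `m` disjoint `n`-disks in these disks. -/
def ObtainedByAttaching {X : Type u} [TopologicalSpace X] (A B : Set X) (n m : ℕ) : Prop :=
  ∃ (h : A ⊆ B) (a : HomotopicalAlgebra.AttachCells.{u}
      (TopCat.RelativeCWComplex.basicCell.{u} n) (TopCat.ofHom (incl h))),
    Finite a.ι ∧ Nat.card a.ι = m

/-- The map induced by a continuous map on the `n`-th homotopy groups (sets if `n = 0`). -/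
def piMap (n : ℕ) {X Y : Type u} [TopologicalSpace X] [TopologicalSpace Y] (f : C(X, Y)) (x : X) :
    HomotopyGroup.Pi n X x → HomotopyGroup.Pi n Y (f x) :=
  Quotient.map (fun p => ⟨f.comp p.1, fun y hy => congrArg f (p.2 y hy)⟩)
    (fun _ _ h => ContinuousMap.HomotopicRel.comp_continuousMap h f)

end DiscreteMorse

end

/-! The theorem rests on two facts about the filtration. Passing from `X''_n` to `X'_n` attaches
exactly the critical `n`-cells, because all faces of an `n`-cell have lower dimension and are
already present (`isAttach_X'`). Passing from `X''_(n+1)` down to `X'_n` removes each redundant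
`n`-cell together with its partner. Finiteness and the absence of closed paths make "is a face of
the partner of" well-founded on redundant cells, so some redundant cell is a face of no partner but
its own. It is free, the pair can be removed, and the argument repeats (`exists_source`,
`collapses_stage`).

The geometric difficulty is that a collapse asks for one map that is characteristic for the partner
and restricts to a characteristic map of the face on a standard face of the cube. Regularity yields
only an open embedding `u` of the open `p`-ball in the boundary sphere with `h ∘ u = g`, where `g`
is characteristic for the face; `u` may behave badly near the boundary of the ball. Brown's proof of
the Schoenflies theorem, by infinitely repeated squeezing, shows that the image under `u` of the
ball of radius one half sits in the sphere like a face of the cube. An isotopy of the sphere,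
parametrised by radii below 1, expands this half ball towards the whole ball. Its cone is a
homeomorphism of the open cube that need not extend to the boundary, but its composite with `h` does
extend, because `g` is continuous on the closed ball (`exists_straighten`).

Collapses are strong deformation retractions, since the cube retracts onto the box of its remaining
faces. Attaching maps can be transported along zigzags of strong deformation retractions without
changing the result up to such zigzags (`exists_attachEquiv`). Attaching the critical cells in order
of dimension therefore builds the Morse complex, with cells attached only to lower-dimensional ones
(`exists_cellStructure`).

For homotopy groups, a cube of dimension at most `k` can be pushed off the centres of attached cells
of dimension above `k` and then radially into the old space (`IsAttach.pairConn`). The inclusion of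
`X'_k` in the complex thus compresses `k`-cubes relative to their boundaries, which gives the
isomorphism on the homotopy group one degree lower, and connectedness of `X'_1`. The statements on
forests and trees come from the collapse of `X''_1` to `X'_0`, a finite discrete set with one point
for each critical vertex. -/

set_option linter.unusedSectionVars false

noncomputable section

namespace DiscreteMorse

/-! ### Brown's Schoenflies argument in compact metric spaces -/

section

/-! ### Radial homeomorphisms -/

section Radial

variable {F : Type*} [NormedAddCommGroup F] [NormedSpace ℝ F]

theorem norm_div_smul_le (s : ℝ) (y : F) : ‖(s / ‖y‖) • y‖ ≤ |s| := by
  rcases eq_or_ne y 0 with rfl | hy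
  · simp
  · rw [norm_smul, norm_div, norm_norm, div_mul_cancel₀ _ (norm_ne_zero_iff.2 hy), Real.norm_eq_abs]

theorem norm_div_smul {s : ℝ} (hs : 0 ≤ s) {y : F} (h : y = 0 → s = 0) :
    ‖(s / ‖y‖) • y‖ = s := by
  rcases eq_or_ne y 0 with rfl | hy
  · simp [h rfl]
  · rw [norm_smul, norm_div, norm_norm, div_mul_cancel₀ _ (norm_ne_zero_iff.2 hy),
      Real.norm_of_nonneg hs]

/-- Where `g` vanishes the direction is undefined, but the norm of the value is at most `|s|`, which
tends to 0 there. -/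
theorem continuousAt_div_norm_smul {Z : Type*} [TopologicalSpace Z] {s : Z → ℝ} {g : Z → F} {z : Z}
    (hs : ContinuousAt s z) (hg : ContinuousAt g z) (h : g z = 0 → s z = 0) :
    ContinuousAt (fun z => (s z / ‖g z‖) • g z) z := by
  by_cases hz : g z = 0
  · have : Filter.Tendsto (fun z => |s z|) (𝓝 z) (𝓝 0) := by
      have := hs.abs
      rwa [ContinuousAt, h hz, abs_zero] at this
    rw [ContinuousAt, hz, smul_zero]
    exact squeeze_zero_norm (fun z => norm_div_smul_le _ _) this
  · exact (hs.div hg.norm (norm_ne_zero_iff.2 hz)).smul hg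

theorem continuous_div_norm_smul {Z : Type*} [TopologicalSpace Z] {s : Z → ℝ} {g : Z → F}
    (hs : Continuous s) (hg : Continuous g) (h : ∀ z, g z = 0 → s z = 0) :
    Continuous (fun z => (s z / ‖g z‖) • g z) :=
  continuous_iff_continuousAt.2 fun z =>
    continuousAt_div_norm_smul hs.continuousAt hg.continuousAt (h z)

theorem div_norm_smul_div_norm_smul {s s' : ℝ} {y : F} (hs : 0 ≤ s) (hy : y ≠ 0) (hs0 : s ≠ 0) :
    (s' / ‖(s / ‖y‖) • y‖) • (s / ‖y‖) • y = (s' / ‖y‖) • y := by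
  have hy' := norm_ne_zero_iff.2 hy
  rw [norm_div_smul hs (fun h => absurd h hy), smul_smul]
  congr 1
  field_simp

theorem orderIso_nonneg {σ : ℝ ≃o ℝ} (h0 : σ 0 = 0) {t : ℝ} (ht : 0 ≤ t) : 0 ≤ σ t :=
  h0 ▸ σ.monotone ht

variable (F) in
/-- The homeomorphism of a normed space which acts on each ray by an order isomorphism. -/
def radialHomeo (σ : ℝ ≃o ℝ) (h0 : σ 0 = 0) : F ≃ₜ F where
  toFun y := (σ ‖y‖ / ‖y‖) • y
  invFun y := (σ.symm ‖y‖ / ‖y‖) • y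
  left_inv y := by
    rcases eq_or_ne y 0 with rfl | hy
    · simp
    · have h1 : σ ‖y‖ ≠ 0 := fun h => hy (norm_eq_zero.1 (σ.injective (h.trans h0.symm)))
      dsimp only
      rw [div_norm_smul_div_norm_smul (orderIso_nonneg h0 (norm_nonneg _)) hy h1,
        norm_div_smul (orderIso_nonneg h0 (norm_nonneg _)) (fun h => absurd h hy),
        σ.symm_apply_apply, div_self (norm_ne_zero_iff.2 hy), one_smul]
  right_inv y := by
    have h0' : σ.symm 0 = 0 := by rw [← h0, σ.symm_apply_apply, h0]
    rcases eq_or_ne y 0 with rfl | hy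
    · simp
    · have h1 : σ.symm ‖y‖ ≠ 0 := fun h => hy (norm_eq_zero.1 (σ.symm.injective (h.trans h0'.symm)))
      dsimp only
      rw [div_norm_smul_div_norm_smul (orderIso_nonneg h0' (norm_nonneg _)) hy h1,
        norm_div_smul (orderIso_nonneg h0' (norm_nonneg _)) (fun h => absurd h hy),
        σ.apply_symm_apply, div_self (norm_ne_zero_iff.2 hy), one_smul]
  continuous_toFun := continuous_div_norm_smul (σ.continuous.comp continuous_norm) continuous_id
    (fun z hz => by simp [show z = 0 from hz, h0])
  continuous_invFun := continuous_div_norm_smul (σ.symm.continuous.comp continuous_norm)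
    continuous_id (fun z hz => by
      have h0' : σ.symm 0 = 0 := by rw [← h0, σ.symm_apply_apply, h0]
      simp [show z = 0 from hz, h0'])

theorem norm_radialHomeo (σ : ℝ ≃o ℝ) (h0 : σ 0 = 0) (y : F) : ‖radialHomeo F σ h0 y‖ = σ ‖y‖ :=
  norm_div_smul (orderIso_nonneg h0 (norm_nonneg _)) (fun h => by simp [h, h0])

theorem radialHomeo_eq_self (σ : ℝ ≃o ℝ) (h0 : σ 0 = 0) {y : F} (h : σ ‖y‖ = ‖y‖) :
    radialHomeo F σ h0 y = y := by
  change (σ ‖y‖ / ‖y‖) • y = y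
  rcases eq_or_ne y 0 with rfl | hy
  · simp
  · rw [h, div_self (norm_ne_zero_iff.2 hy), one_smul]

/-- A piecewise linear function. -/
def bend (a d b c t : ℝ) : ℝ :=
  if t ≤ a then t else if t ≤ b then a + (t - a) * ((c - a) / (b - a)) else
    if t ≤ d then d - (d - t) * ((d - c) / (d - b)) else t

/-- Exchanging `b` and `c` reverses each linear piece, so this one identity supplies both inverse
laws in `exists_orderIso`. -/
theorem bend_bend {a b c d : ℝ} (hab : a < b) (hbd : b < d) (hac : a < c) (hcd : c < d) (t : ℝ) :
    bend a d c b (bend a d b c t) = t := by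
  have h1 : 0 < b - a := by linarith
  have h2 : 0 < d - b := by linarith
  have h3 : 0 < c - a := by linarith
  have h4 : 0 < d - c := by linarith
  unfold bend
  by_cases ht1 : t ≤ a
  · simp [ht1]
  by_cases ht2 : t ≤ b
  · have e1 : 0 < (t - a) * ((c - a) / (b - a)) := mul_pos (by linarith) (by positivity)
    have e2 : (t - a) * ((c - a) / (b - a)) ≤ c - a := by
      rw [mul_div_assoc', div_le_iff₀ h1, mul_comm]
      exact mul_le_mul_of_nonneg_left (by linarith) h3.le
    rw [if_neg ht1, if_pos ht2, if_neg (by linarith), if_pos (by linarith)]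
    field_simp
    ring
  by_cases ht3 : t ≤ d
  · have e1 : 0 ≤ (d - t) * ((d - c) / (d - b)) := mul_nonneg (by linarith) (by positivity)
    have e2 : (d - t) * ((d - c) / (d - b)) < d - c := by
      rw [mul_div_assoc', div_lt_iff₀ h2, mul_comm]
      exact mul_lt_mul_of_pos_left (by linarith) h4
    rw [if_neg ht1, if_neg ht2, if_pos ht3, if_neg (by linarith), if_neg (by linarith),
      if_pos (by linarith)]
    field_simp
    ring
  · rw [if_neg ht1, if_neg ht2, if_neg ht3, if_neg ht1, if_neg (by linarith), if_neg ht3]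

theorem bend_mono {a b c d : ℝ} (hab : a < b) (hbd : b < d) (hac : a < c) (hcd : c < d) :
    Monotone (bend a d b c) := by
  have h1 : 0 < b - a := by linarith
  have h2 : 0 < d - b := by linarith
  have k1 : 0 < (c - a) / (b - a) := div_pos (by linarith) h1
  have k2 : 0 < (d - c) / (d - b) := div_pos (by linarith) h2
  have e1 : (b - a) * ((c - a) / (b - a)) = c - a := by field_simp
  have e2 : (d - b) * ((d - c) / (d - b)) = d - c := by field_simp
  intro s t hst
  unfold bend
  generalize (c - a) / (b - a) = k at *
  generalize (d - c) / (d - b) = l at *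
  split_ifs <;> nlinarith

theorem exists_orderIso {a b c d : ℝ} (hab : a < b) (hbd : b < d) (hac : a < c) (hcd : c < d) :
    ∃ σ : ℝ ≃o ℝ, (∀ t ≤ a, σ t = t) ∧ (∀ t, d ≤ t → σ t = t) ∧ σ b = c := by
  let e : ℝ ≃ ℝ := ⟨bend a d b c, bend a d c b, bend_bend hab hbd hac hcd,
    bend_bend hac hcd hab hbd⟩
  refine ⟨e.toOrderIso (bend_mono hab hbd hac hcd) (bend_mono hac hcd hab hbd), ?_, ?_, ?_⟩
  · intro t ht
    change bend a d b c t = t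
    simp [bend, ht]
  · intro t ht
    change bend a d b c t = t
    rcases ht.eq_or_lt with rfl | ht
    · simp [bend, hab.trans hbd |>.not_ge, hbd.not_ge]
    · simp [bend, ((hab.trans hbd).trans ht).not_ge, (hbd.trans ht).not_ge, ht.not_ge]
  · change bend a d b c b = c
    have : b - a ≠ 0 := by linarith
    simp [bend, hab.not_ge]
    field_simp
    ring

end Radial

/-! ### Extension of homeomorphisms by the identity -/

section Extend

variable {A B : Type*} [TopologicalSpace A] [TopologicalSpace B]

open Classical in
/-- The extension by the identity of a self-map of `A` along an injection `A → B`. -/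
def extendMap (u : A → B) (e : A → A) (b : B) : B :=
  if h : ∃ a, u a = b then u (e h.choose) else b

theorem extendMap_apply {u : A → B} (hu : Function.Injective u) (e : A → A) (a : A) :
    extendMap u e (u a) = u (e a) := by
  have h : ∃ a', u a' = u a := ⟨a, rfl⟩
  rw [extendMap, dif_pos h, hu h.choose_spec]

theorem extendMap_of_notMem {u : A → B} (e : A → A) {b : B} (hb : b ∉ range u) :
    extendMap u e b = b :=
  dif_neg hb

/-- Off the range of `u` the extension is the identity on the whole open complement of `u '' Z`.
Closedness of `u '' Z` in `B`, not merely in the range, is what makes this a neighbourhood. -/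
theorem continuous_extendMap {u : A → B} (hu : IsOpenEmbedding u) {e : A → A} (he : Continuous e)
    {Z : Set A} (hZ : IsClosed (u '' Z)) (h : ∀ a ∉ Z, e a = a) : Continuous (extendMap u e) := by
  refine continuous_iff_continuousAt.2 fun b => ?_
  by_cases hb : b ∈ range u
  · obtain ⟨a, rfl⟩ := hb
    rw [← hu.continuousAt_iff]
    have : extendMap u e ∘ u = u ∘ e := funext fun a => extendMap_apply hu.injective e a
    rw [this]
    exact (hu.continuous.comp he).continuousAt
  · have hb' : b ∈ (u '' Z)ᶜ := fun hb' => hb (image_subset_range _ _ hb')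
    refine continuousAt_id.congr ?_
    filter_upwards [hZ.isOpen_compl.mem_nhds hb'] with x hx
    by_cases hx' : x ∈ range u
    · obtain ⟨a, rfl⟩ := hx'
      rw [extendMap_apply hu.injective, h a (fun ha => hx (mem_image_of_mem _ ha)), id]
    · rw [extendMap_of_notMem e hx', id]

theorem extendMap_extendMap {u : A → B} (hu : Function.Injective u) {e e' : A → A}
    (h : ∀ a, e (e' a) = a) (b : B) : extendMap u e (extendMap u e' b) = b := by
  by_cases hb : b ∈ range u
  · obtain ⟨a, rfl⟩ := hb
    rw [extendMap_apply hu, extendMap_apply hu, h]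
  · rw [extendMap_of_notMem e' hb, extendMap_of_notMem e hb]

/-- The extension by the identity of a homeomorphism along an open embedding. -/
def extendHomeo {u : A → B} (hu : IsOpenEmbedding u) (e : A ≃ₜ A) {Z : Set A}
    (hZ : IsClosed (u '' Z)) (h : ∀ a ∉ Z, e a = a) : B ≃ₜ B where
  toFun := extendMap u e
  invFun := extendMap u e.symm
  left_inv := extendMap_extendMap hu.injective e.symm_apply_apply
  right_inv := extendMap_extendMap hu.injective e.apply_symm_apply
  continuous_toFun := continuous_extendMap hu e.continuous hZ h
  continuous_invFun := continuous_extendMap hu e.symm.continuous hZ fun a ha => by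
    rw [Homeomorph.symm_apply_eq, h a ha]

end Extend

/-! ### The Schoenflies theorem -/

section Schoenflies

variable {S : Type*} [MetricSpace S] [CompactSpace S]
  {F F' : Type*} [NormedAddCommGroup F] [NormedSpace ℝ F] [ProperSpace F]
  [NormedAddCommGroup F'] [NormedSpace ℝ F'] [ProperSpace F']

/-- A radial homeomorphism supported in the ball of radius `d` extends by the identity, since the
image of that closed ball is compact, hence closed. -/
theorem exists_homeo_of_radial {u : F → S} (hu : IsOpenEmbedding u) {a b c d : ℝ} (ha : 0 ≤ a)
    (hab : a < b) (hbd : b < d) (hac : a < c) (hcd : c < d) :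
    ∃ (σ : ℝ ≃o ℝ) (e : S ≃ₜ S) (r : F ≃ₜ F), (∀ t ≤ a, σ t = t) ∧ (∀ t, d ≤ t → σ t = t) ∧ σ b = c ∧
      (∀ y, e (u y) = u (r y)) ∧ (∀ y, e.symm (u y) = u (r.symm y)) ∧ (∀ y, ‖r y‖ = σ ‖y‖) ∧
      (∀ y, ‖y‖ ≤ a → r y = y) ∧ (∀ x ∉ range u, e x = x) := by
  obtain ⟨σ, h1, h2, h3⟩ := exists_orderIso hab hbd hac hcd
  have h0 : σ 0 = 0 := h1 0 ha
  have hZ : IsClosed (u '' closedBall 0 d) :=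
    ((isCompact_closedBall 0 d).image hu.continuous).isClosed
  have hr : ∀ y ∉ closedBall (0 : F) d, radialHomeo F σ h0 y = y := fun y hy =>
    radialHomeo_eq_self σ h0 (h2 _ (by simpa using (le_of_lt (by simpa using hy) : d ≤ ‖y‖)))
  refine ⟨σ, extendHomeo hu (radialHomeo F σ h0) hZ hr, radialHomeo F σ h0, h1, h2, h3,
    fun y => extendMap_apply hu.injective _ y, fun y => extendMap_apply hu.injective _ y,
    fun y => norm_radialHomeo σ h0 y, fun y hy => radialHomeo_eq_self σ h0 (h1 _ hy),
    fun x hx => extendMap_of_notMem _ hx⟩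

/-- Every self-homeomorphism can be modified outside a large ball so that the image of the
complement of a larger ball becomes small. -/
theorem exists_homeo_small_compl {u : F → S} (hu : IsOpenEmbedding u) {c : F' → S}
    (hc : IsOpenEmbedding c) (h0 : c 0 = u 0) {q : S} (hq : range c = {q}ᶜ) (ψ : S ≃ₜ S) {R ε : ℝ}
    (hR : 1 ≤ R) (hε : 0 < ε) :
    ∃ ψ' : S ≃ₜ S, (∀ y, ‖y‖ ≤ R → ψ' (u y) = ψ (u y)) ∧
      ∀ x ∉ u '' ball 0 (R + 1), ∀ x' ∉ u '' ball 0 (R + 1), dist (ψ' x) (ψ' x') < ε := by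
  -- The map sought is `ψ ∘ e ∘ s ∘ e⁻¹`. Here `e` expands the `u`-ball of radius `δ'` to radius
  -- `R`, and `s` squeezes the complement of the `c`-ball of radius `r` towards `q`. The radii are
  -- nested so that the `u`-ball of radius `δ'` lies in the `c`-ball of radius `r / 2`, which `s`
  -- fixes, and the `c`-ball of radius `r` lies in the `u`-ball of radius 1.
  obtain ⟨r, hr, hr'⟩ : ∃ r > 0, closedBall (0 : F') r ⊆ c ⁻¹' (u '' ball 0 1) :=
    nhds_basis_closedBall.mem_iff.1 (hc.continuous.continuousAt.preimage_mem_nhds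
      (h0 ▸ (hu.isOpenMap _ isOpen_ball).mem_nhds (mem_image_of_mem _ (mem_ball_self one_pos))))
  obtain ⟨δ, hδ, hδ'⟩ : ∃ δ > 0, closedBall (0 : F) δ ⊆ u ⁻¹' (c '' ball 0 (r / 2)) :=
    nhds_basis_closedBall.mem_iff.1 (hu.continuous.continuousAt.preimage_mem_nhds
      (h0 ▸ (hc.isOpenMap _ isOpen_ball).mem_nhds
        (mem_image_of_mem _ (mem_ball_self (half_pos hr)))))
  obtain ⟨δ', hδ0, hδ1, hδ2⟩ : ∃ δ' : ℝ, 0 < δ' ∧ δ' < 1 ∧ δ' ≤ δ :=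
    ⟨min δ (1 / 2), by positivity, (min_le_right _ _).trans_lt (by norm_num), min_le_left _ _⟩
  obtain ⟨σ, e, ρ, hσ1, hσ2, hσ3, he, he', hρ, -, -⟩ := exists_homeo_of_radial hu
    (a := δ' / 2) (b := δ') (c := R) (d := R + 1) (by linarith) (by linarith) (by linarith)
    (by linarith) (by linarith)
  -- a neighbourhood of `q` with a small image
  obtain ⟨N, hN, hNo, hqN⟩ : ∃ N : Set S, (∀ x ∈ N, dist (ψ (e x)) (ψ (e q)) < ε / 2) ∧ IsOpen N ∧
      q ∈ N :=
    ⟨{x | dist (ψ (e x)) (ψ (e q)) < ε / 2}, fun x hx => hx,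
      isOpen_lt (by fun_prop) continuous_const, by simp [hε]⟩
  obtain ⟨M, hM⟩ : ∃ M : ℝ, c ⁻¹' Nᶜ ⊆ ball 0 M := by
    have : IsCompact (c ⁻¹' Nᶜ) := hc.isInducing.isCompact_preimage' hNo.isClosed_compl.isCompact
      (by rw [hq]; exact compl_subset_compl.2 (singleton_subset_iff.2 hqN))
    exact (this.isBounded.subset_ball 0)
  obtain ⟨σ', s, ρ', hσ1', hσ2', hσ3', hs, -, hρ', hs1, hs2⟩ := exists_homeo_of_radial hc
    (a := r / 2) (b := r) (c := max M r) (d := max M r + 1) (by linarith) (by linarith)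
    (by linarith [le_max_right M r]) (by linarith [le_max_right M r]) (by linarith)
  -- As `e` preserves the `u`-ball of radius `R + 1`, the point `e⁻¹ x` lies outside the `c`-ball of
  -- radius `r`, and `s` pushes it beyond radius `M`, into `N`.
  have hmem : ∀ x ∉ u '' ball 0 (R + 1), s (e.symm x) ∈ N := by
    intro x hx
    have hx1 : e.symm x ∉ c '' ball 0 r := by
      rintro ⟨w, hw, hwx⟩
      obtain ⟨y, hy, hyw⟩ := hr' (ball_subset_closedBall hw)
      refine hx ⟨ρ y, ?_, by rw [← he, hyw, hwx, e.apply_symm_apply]⟩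
      rw [mem_ball_zero_iff] at hy ⊢
      rw [hρ, ← hσ2 (R + 1) le_rfl]
      exact σ.strictMono (by linarith)
    by_cases hx2 : e.symm x ∈ range c
    · obtain ⟨w, hw⟩ := hx2
      have hwr : r ≤ ‖w‖ := by
        by_contra! h
        exact hx1 ⟨w, by simpa using h, hw⟩
      rw [← hw, hs]
      by_contra hN'
      have := hM hN'
      rw [mem_ball_zero_iff, hρ'] at this
      have h3 := σ'.monotone hwr
      rw [hσ3'] at h3
      linarith [le_max_left M r]
    · rw [hs2 _ hx2]
      rw [hq, notMem_compl_iff, mem_singleton_iff] at hx2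
      rwa [hx2]
  refine ⟨((e.symm.trans s).trans e).trans ψ, fun y hy => ?_, fun x hx x' hx' => ?_⟩
  · simp only [Homeomorph.trans_apply]
    have h1 : ‖ρ.symm y‖ ≤ δ' := by
      rw [← σ.le_iff_le, ← hρ, ρ.apply_symm_apply, hσ3]
      exact hy
    obtain ⟨w, hw, hwy⟩ := hδ' (mem_closedBall_zero_iff.2 (h1.trans hδ2))
    rw [he', ← hwy, hs, hs1 w (mem_ball_zero_iff.1 hw).le, hwy, he, ρ.apply_symm_apply]
  · simp only [Homeomorph.trans_apply]
    have h1 := hN _ (hmem x hx)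
    have h2 := hN _ (hmem x' hx')
    calc _ ≤ _ := dist_triangle_right _ _ (ψ (e q))
      _ < ε := by linarith

/-- An open embedding of `F` in a compact space in which the complement of a point is homeomorphic
to a normed space agrees on the unit ball with a homeomorphism from the one-point compactification
of `F`. -/
theorem schoenflies {u : F → S} (hu : IsOpenEmbedding u) {c : F' → S}
    (hc : IsOpenEmbedding c) (h0 : c 0 = u 0) {q : S} (hq : range c = {q}ᶜ) (hr : range u ≠ univ) :
    ∃ Φ : OnePoint F ≃ₜ S, ∀ y : F, ‖y‖ ≤ 1 → Φ y = u y := by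
  have step : ∀ (ψ : S ≃ₜ S) (k : ℕ), ∃ ψ' : S ≃ₜ S,
      (∀ y, ‖y‖ ≤ (k + 1 : ℝ) → ψ' (u y) = ψ (u y)) ∧
      ∀ x ∉ u '' ball 0 (((k + 1 : ℕ) : ℝ) + 1), ∀ x' ∉ u '' ball 0 (((k + 1 : ℕ) : ℝ) + 1),
        dist (ψ' x) (ψ' x') < 1 / ((k : ℝ) + 1) := fun ψ k => by
    have := exists_homeo_small_compl hu hc h0 hq ψ (R := (k + 1 : ℝ)) (ε := 1 / ((k : ℝ) + 1))
      (by simp) (by positivity)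
    push_cast
    exact this
  choose f hf1 hf2 using step
  -- Stage `k` is final on the `u`-ball of radius `k + 1`. Starting from the identity makes the
  -- limit equal to `u` on the unit ball.
  let ψ : ℕ → (S ≃ₜ S) := fun k => Nat.rec (Homeomorph.refl S) (fun k ψ => f ψ k) k
  have hψ0 : ψ 0 = Homeomorph.refl S := rfl
  have hψs : ∀ k, ψ (k + 1) = f (ψ k) k := fun k => rfl
  have agree : ∀ k j : ℕ, k ≤ j → ∀ y, ‖y‖ ≤ (k + 1 : ℝ) → ψ j (u y) = ψ k (u y) := by
    intro k j hkj
    induction j, hkj using Nat.le_induction with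
    | base => intros; rfl
    | succ j hkj ih =>
      intro y hy
      rw [hψs, hf1 _ _ _ (hy.trans (by gcongr)), ih y hy]
  let A : ℕ → Set S := fun k => (u '' ball 0 ((k : ℝ) + 1))ᶜ
  have hA : ∀ k, IsClosed (A k) := fun k => (hu.isOpenMap _ isOpen_ball).isClosed_compl
  have hsmall : ∀ k, ∀ x ∈ ψ (k + 1) '' A (k + 1), ∀ x' ∈ ψ (k + 1) '' A (k + 1),
      dist x x' < 1 / ((k : ℝ) + 1) := by
    rintro k _ ⟨x, hx, rfl⟩ _ ⟨x', hx', rfl⟩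
    exact hf2 (ψ k) k x hx x' hx'
  have himg : ∀ k j : ℕ, k ≤ j → ∀ x ∈ A k, ψ j x ∈ ψ k '' A k := by
    intro k j hkj x hx
    refine ⟨(ψ k).symm (ψ j x), fun hx' => ?_, (ψ k).apply_symm_apply _⟩
    obtain ⟨y, hy, hyx⟩ := hx'
    have h1 := agree k j hkj y (mem_ball_zero_iff.1 hy).le
    rw [hyx, (ψ k).apply_symm_apply, ← hyx] at h1
    have h2 := (ψ j).injective h1
    rw [← h2] at hx
    exact hx (mem_image_of_mem _ hy)
  have hAmono : ∀ k, A (k + 1) ⊆ A k := fun k => compl_subset_compl.2 (image_mono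
    (ball_subset_ball (by push_cast; linarith)))
  -- These sets are nested, compact and of diameter tending to 0. They are non-empty because `u` is
  -- not onto. Their single common point is the image of infinity.
  obtain ⟨p, hp⟩ : (⋂ k, ψ k '' A k).Nonempty := by
    refine IsCompact.nonempty_iInter_of_sequence_nonempty_isCompact_isClosed _ (fun k => ?_)
      (fun k => ?_) ((ψ 0).isClosedMap _ (hA 0)).isCompact (fun k => (ψ k).isClosedMap _ (hA k))
    · rintro _ ⟨x, hx, rfl⟩
      exact himg k (k + 1) k.le_succ x (hAmono k hx)
    · obtain ⟨x, hx⟩ := (ne_univ_iff_exists_notMem _).1 hr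
      exact ⟨ψ k x, x, fun h => hx (image_subset_range _ _ h), rfl⟩
  rw [mem_iInter] at hp
  have huniq : ∀ x, (∀ k, x ∈ ψ k '' A k) → x = p := by
    intro x hx
    by_contra hne
    obtain ⟨k, hk⟩ := exists_nat_one_div_lt (dist_pos.2 hne)
    exact (hsmall k x (hx _) p (hp _)).not_gt hk
  -- The sequence `ψ k (u y)` is constant from some index on; the ceiling of the norm is one such
  -- index.
  let g : F → S := fun y => ψ ⌈‖y‖⌉₊ (u y)
  have hg : ∀ k : ℕ, ∀ y, ‖y‖ ≤ (k + 1 : ℝ) → g y = ψ k (u y) := by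
    intro k y hy
    have h1 : ‖y‖ ≤ (⌈‖y‖⌉₊ : ℝ) + 1 := (Nat.le_ceil _).trans (by linarith)
    have e1 := agree _ _ (le_max_left k ⌈‖y‖⌉₊) y hy
    have e2 := agree _ _ (le_max_right k ⌈‖y‖⌉₊) y h1
    exact e2.symm.trans e1
  have hgA : ∀ k : ℕ, ∀ y, (k + 1 : ℝ) ≤ ‖y‖ → g y ∈ ψ k '' A k := by
    intro k y hy
    refine himg k _ (Nat.cast_le (α := ℝ).1 ?_ : k ≤ ⌈‖y‖⌉₊) (u y) ?_
    · exact (by linarith : (k : ℝ) ≤ ‖y‖).trans (Nat.le_ceil _)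
    · rintro ⟨y', hy', hyy⟩
      rw [hu.injective hyy, mem_ball_zero_iff] at hy'
      exact hy'.not_ge hy
  have hgA' : ∀ k : ℕ, ∀ y, ‖y‖ < (k + 1 : ℝ) → g y ∉ ψ k '' A k := by
    rintro k y hy ⟨x, hx, hxy⟩
    rw [hg k y hy.le] at hxy
    rw [(ψ k).injective hxy] at hx
    exact hx (mem_image_of_mem _ (by simpa using hy))
  have hgc : Continuous g := by
    refine continuous_iff_continuousAt.2 fun y => ?_
    obtain ⟨k, hk⟩ := exists_nat_gt ‖y‖
    refine ((ψ k).continuous.comp hu.continuous).continuousAt.congr ?_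
    filter_upwards [(isOpen_ball (x := (0 : F)) (ε := (k : ℝ))).mem_nhds (by simpa using hk)] with z hz
    rw [hg k z (by linarith [mem_ball_zero_iff.1 hz])]
    rfl
  let Φ : OnePoint F → S := fun z => OnePoint.rec p g z
  have hΦ : Continuous Φ := by
    rw [OnePoint.continuous_iff]
    refine ⟨?_, hgc⟩
    change Filter.Tendsto g (Filter.coclosedCompact F) (𝓝 p)
    rw [Filter.coclosedCompact_eq_cocompact, Metric.tendsto_nhds]
    intro ε hε
    obtain ⟨k, hk⟩ := exists_nat_one_div_lt hε
    have := (isCompact_closedBall (0 : F) (((k + 1 : ℕ) : ℝ) + 1)).compl_mem_cocompact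
    filter_upwards [this] with y hy
    have hy' : ((k + 1 : ℕ) : ℝ) + 1 < ‖y‖ := by simpa using hy
    exact (hsmall k _ (hgA _ y hy'.le) p (hp _)).trans hk
  have hinj : ∀ y y', g y = g y' → y = y' := by
    intro y y' h
    obtain ⟨k, hk⟩ := exists_nat_gt (max ‖y‖ ‖y'‖)
    rw [hg k y (by linarith [le_max_left ‖y‖ ‖y'‖]),
      hg k y' (by linarith [le_max_right ‖y‖ ‖y'‖])] at h
    exact hu.injective ((ψ k).injective h)
  have hne : ∀ y, g y ≠ p := by
    intro y h
    obtain ⟨k, hk⟩ := exists_nat_gt ‖y‖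
    exact hgA' k y (by linarith) (h ▸ hp k)
  have hbij : Function.Bijective Φ := by
    constructor
    · intro z z' h
      induction z using OnePoint.rec with
      | infty =>
        induction z' using OnePoint.rec with
        | infty => rfl
        | coe y' => exact absurd h.symm (hne y')
      | coe y =>
        induction z' using OnePoint.rec with
        | infty => exact absurd h (hne y)
        | coe y' => exact congrArg _ (hinj y y' h)
    · intro x
      by_cases hx : ∀ k, x ∈ ψ k '' A k
      · exact ⟨OnePoint.infty, (huniq x hx).symm⟩
      · push Not at hx
        obtain ⟨k, hk⟩ := hx
        have : (ψ k).symm x ∈ u '' ball 0 ((k : ℝ) + 1) := by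
          by_contra h
          exact hk ⟨_, h, (ψ k).apply_symm_apply x⟩
        obtain ⟨y, hy, hyx⟩ := this
        refine ⟨(y : OnePoint F), ?_⟩
        change g y = x
        rw [hg k y (mem_ball_zero_iff.1 hy).le, hyx, (ψ k).apply_symm_apply]
  refine ⟨Continuous.homeoOfEquivCompactToT2 (f := Equiv.ofBijective Φ hbij) hΦ, fun y hy => ?_⟩
  change g y = u y
  rw [hg 0 y (by simpa using hy), hψ0]
  rfl

end Schoenflies

end

/-! ### The boundary sphere of the cube and cones over isotopies -/

section

/-! ### The boundary of the cube -/

section CubeSphere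

/-- The Euclidean ball and the cube are homeomorphic by a homeomorphism of the ambient spaces. -/
theorem exists_homeo_euclidean_cube (n : ℕ) : ∃ e : EuclideanSpace ℝ (Fin n) ≃ₜ (Fin n → ℝ),
    e '' ball 0 1 = ball 0 1 ∧ e '' closedBall 0 1 = closedBall 0 1 ∧
      e '' sphere 0 1 = sphere 0 1 := by
  let L := EuclideanSpace.equiv (Fin n) ℝ
  have hc : Convex ℝ (L ⁻¹' ball 0 1) :=
    (convex_ball (0 : Fin n → ℝ) 1).linear_preimage L.toLinearMap
  have ho : IsOpen (L ⁻¹' ball 0 1) := isOpen_ball.preimage L.continuous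
  have hb : Bornology.IsBounded (L ⁻¹' ball 0 1) :=
    L.antilipschitz.isBounded_preimage isBounded_ball
  obtain ⟨k, h1, h2, h3⟩ := exists_homeomorph_image_interior_closure_frontier_eq_unitBall hc
    (by rw [ho.interior_eq]; exact ⟨0, by simp⟩) hb
  have hL : ∀ s, L '' (L ⁻¹' s) = s := fun s => image_preimage_eq s L.surjective
  have e1 : interior (L ⁻¹' ball 0 1) = L ⁻¹' ball 0 1 := ho.interior_eq
  have e2 : closure (L ⁻¹' ball 0 1) = L ⁻¹' closedBall 0 1 := by
    rw [← closure_ball (0 : Fin n → ℝ) one_ne_zero]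
    exact (L.toHomeomorph.preimage_closure _).symm
  have e3 : frontier (L ⁻¹' ball 0 1) = L ⁻¹' sphere 0 1 := by
    rw [← frontier_ball (0 : Fin n → ℝ) one_ne_zero]
    exact (L.toHomeomorph.preimage_frontier _).symm
  have key : ∀ s t, k '' (L ⁻¹' s) = t → (k.symm.trans L.toHomeomorph) '' t = s := by
    rintro s _ rfl
    change (fun x => L (k.symm x)) '' _ = s
    rw [← image_image L k.symm, image_image k.symm k]
    simp [hL]
  exact ⟨k.symm.trans L.toHomeomorph, key _ _ (e1 ▸ h1), key _ _ (e2 ▸ h2), key _ _ (e3 ▸ h3)⟩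

variable (p : ℕ)

/-- The boundary of the `(p+1)`-cube. -/
abbrev CubeSphere : Type := sphere (0 : Fin (p + 1) → ℝ) 1

/-- Stereographic projection from the antipode of the point corresponding to `q` on the round sphere
gives a chart centred at `q` that omits one point. -/
theorem CubeSphere.exists_chart (q : CubeSphere p) :
    ∃ (v : EuclideanSpace ℝ (Fin (p + 1))) (c : (Submodule.span ℝ {v})ᗮ → CubeSphere p)
      (q' : CubeSphere p), IsOpenEmbedding c ∧ c 0 = q ∧ range c = {q'}ᶜ := by
  obtain ⟨e, -, -, he⟩ := exists_homeo_euclidean_cube (p + 1)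
  let k : sphere (0 : EuclideanSpace ℝ (Fin (p + 1))) 1 ≃ₜ CubeSphere p :=
    (e.image _).trans (Homeomorph.setCongr he)
  let w := k.symm q
  have hw : ‖-(w : EuclideanSpace ℝ (Fin (p + 1)))‖ = 1 := by simp
  have h0 : (stereographic hw).symm 0 = w := by
    have h2 : (stereographic hw) w = 0 := stereographic_neg_apply w
    rw [← h2]
    refine (stereographic hw).left_inv ?_
    rw [stereographic_source, mem_compl_iff, mem_singleton_iff, Subtype.ext_iff]
    exact fun h => ne_neg_of_mem_unit_sphere ℝ w (Subtype.ext h)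
  refine ⟨-(w : EuclideanSpace ℝ (Fin (p + 1))), k ∘ (stereographic hw).symm,
    k ⟨-(w : EuclideanSpace ℝ (Fin (p + 1))), by simp⟩, k.isOpenEmbedding.comp (isOpenEmbedding_stereographic_symm hw), ?_, ?_⟩
  · rw [Function.comp_apply, h0, k.apply_symm_apply]
  · rw [range_comp, range_stereographic_symm hw (by simp), image_compl_eq k.bijective,
      image_singleton]

theorem norm_snoc (y : Fin p → ℝ) (b : ℝ) :
    ‖(Fin.snoc (α := fun _ => ℝ) y b : Fin (p + 1) → ℝ)‖ = max ‖y‖ |b| := by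
  refine eq_of_forall_ge_iff fun r => ?_
  rcases lt_or_ge r 0 with hr | hr
  · constructor
    · intro h; linarith [norm_nonneg (Fin.snoc (α := fun _ => ℝ) y b : Fin (p + 1) → ℝ)]
    · intro h; linarith [norm_nonneg y, le_max_left ‖y‖ |b|]
  · rw [pi_norm_le_iff_of_nonneg hr, Fin.forall_fin_succ', max_le_iff, pi_norm_le_iff_of_nonneg hr]
    simp

theorem snoc_eq (x : Fin (p + 1) → ℝ) :
    (Fin.snoc (α := fun _ => ℝ) (Fin.init x) (x (Fin.last p)) : Fin (p + 1) → ℝ) = x :=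
  Fin.snoc_init_self x

theorem norm_eq_max (x : Fin (p + 1) → ℝ) : ‖x‖ = max ‖Fin.init x‖ |x (Fin.last p)| := by
  conv_lhs => rw [← snoc_eq p x]
  exact norm_snoc p _ _

theorem continuous_snoc : Continuous fun z : (Fin p → ℝ) × ℝ =>
    (Fin.snoc (α := fun _ => ℝ) z.1 z.2 : Fin (p + 1) → ℝ) := by
  refine continuous_pi fun i => ?_
  refine Fin.lastCases ?_ (fun j => ?_) i
  · simpa using continuous_snd
  · simp only [Fin.snoc_castSucc]
    fun_prop

theorem continuous_init : Continuous fun x : Fin (p + 1) → ℝ => (Fin.init x : Fin p → ℝ) :=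
  continuous_pi fun _ => continuous_apply _

theorem norm_faceIncl (y : Fin p → ℝ) : ‖faceIncl p y‖ = max ‖y‖ 1 := by
  rw [faceIncl, norm_snoc]
  simp

theorem continuous_faceIncl : Continuous (faceIncl p) :=
  (continuous_snoc p).comp (continuous_id.prodMk continuous_const)

/-- The central projection of a face of the cube on the lower half of its boundary. -/
def lowerHalf : (Fin p → ℝ) ≃ₜ {x : CubeSphere p | x.1 (Fin.last p) < 0} where
  toFun y := ⟨⟨(max ‖y‖ 1)⁻¹ • faceIncl p y, by
      have : 0 < max ‖y‖ 1 := lt_max_of_lt_right one_pos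
      rw [mem_sphere_zero_iff_norm, norm_smul, norm_faceIncl, norm_inv, Real.norm_of_nonneg this.le,
        inv_mul_cancel₀ this.ne']⟩, by
      have : 0 < max ‖y‖ 1 := lt_max_of_lt_right one_pos
      simp [faceIncl, this]⟩
  invFun x := (-x.1.1 (Fin.last p))⁻¹ • Fin.init x.1.1
  left_inv y := by
    have : 0 < max ‖y‖ 1 := lt_max_of_lt_right one_pos
    ext i
    simp [faceIncl, Fin.init, this.ne']
  right_inv x := by
    obtain ⟨⟨x, hx⟩, hb⟩ := x
    have hb' : 0 < -x (Fin.last p) := by simpa using hb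
    rw [mem_sphere_zero_iff_norm, norm_eq_max] at hx
    refine Subtype.ext (Subtype.ext ?_)
    have h1 : max ‖(-x (Fin.last p))⁻¹ • (Fin.init x : Fin p → ℝ)‖ 1 = (-x (Fin.last p))⁻¹ := by
      rw [abs_of_neg (by simpa using hb)] at hx
      have h2 := mul_max_of_nonneg ‖(Fin.init x : Fin p → ℝ)‖ (-x (Fin.last p))
        (inv_nonneg.2 hb'.le)
      rw [hx, mul_one, inv_mul_cancel₀ hb'.ne'] at h2
      rw [norm_smul, norm_inv, Real.norm_of_nonneg hb'.le, ← h2]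
    dsimp only
    rw [h1, inv_inv]
    conv_rhs => rw [← snoc_eq p x]
    ext i
    refine Fin.lastCases ?_ (fun j => ?_) i
    · simp [faceIncl]
    · simp only [faceIncl, Pi.smul_apply, Fin.snoc_castSucc, smul_eq_mul]
      rw [mul_inv_cancel_left₀ hb'.ne']
  continuous_toFun := by
    refine Continuous.subtype_mk (Continuous.subtype_mk ?_ _) _
    exact ((continuous_norm.max continuous_const).inv₀
      fun y => (lt_max_of_lt_right one_pos).ne').smul (continuous_faceIncl p)
  continuous_invFun := by
    have hc : Continuous fun x : {x : CubeSphere p | x.1 (Fin.last p) < 0} => x.1.1 :=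
      continuous_subtype_val.comp continuous_subtype_val
    refine Continuous.smul (f := fun x : {x : CubeSphere p | x.1 (Fin.last p) < 0} =>
      (-x.1.1 (Fin.last p))⁻¹) (Continuous.inv₀ ?_ fun x => ?_) ?_
    · exact ((continuous_apply _).comp hc).neg
    · have := x.2
      simp only [mem_ofPred_eq] at this
      linarith
    · exact (continuous_init p).comp hc

theorem isOpenEmbedding_lowerHalf : IsOpenEmbedding fun y => (lowerHalf p y : CubeSphere p) :=
  (IsOpen.isOpenEmbedding_subtypeVal (isOpen_lt
    ((continuous_apply _).comp continuous_subtype_val) continuous_const)).comp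
    (lowerHalf p).isOpenEmbedding

/-- A surjective `u` would make `ℝ^p` compact, which fails for `p > 0`; for `p = 0` the source has
one point and the sphere at least two. -/
theorem CubeSphere.range_ne_univ {u : (Fin p → ℝ) → CubeSphere p} (hu : IsOpenEmbedding u) :
    range u ≠ univ := by
  intro h
  let top : CubeSphere p := ⟨Fin.snoc (α := fun _ => ℝ) 0 1, by simp [norm_snoc]⟩
  let bot : CubeSphere p := ⟨Fin.snoc (α := fun _ => ℝ) 0 (-1), by simp [norm_snoc]⟩
  rcases Nat.eq_zero_or_pos p with rfl | hp
  · obtain ⟨y, hy⟩ := h.symm ▸ mem_univ top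
    obtain ⟨z, hz⟩ := h.symm ▸ mem_univ bot
    have : top = bot := by rw [← hy, ← hz, Subsingleton.elim y z]
    have := congrFun (congrArg Subtype.val this) (Fin.last 0)
    simp [top, bot] at this
    norm_num at this
  · have : Nonempty (Fin p) := ⟨⟨0, hp⟩⟩
    have hc : IsCompact (univ : Set (Fin p → ℝ)) := by
      rw [hu.isInducing.isCompact_iff, image_univ, h]
      exact isCompact_univ
    exact noncompact_univ _ hc

/-- The complement of the image of the unit ball under an open embedding of `ℝ^p` in the
boundary of the `(p+1)`-cube looks like the complement of a face. -/
theorem CubeSphere.schoenflies {u : (Fin p → ℝ) → CubeSphere p} (hu : IsOpenEmbedding u) :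
    ∃ Θ : CubeSphere p ≃ₜ CubeSphere p,
      ∀ (x : CubeSphere p) (y : Fin p → ℝ), ‖y‖ ≤ 1 → x.1 = faceIncl p y → Θ x = u y := by
  have key : ∀ {u : (Fin p → ℝ) → CubeSphere p}, IsOpenEmbedding u →
      ∃ Φ : OnePoint (Fin p → ℝ) ≃ₜ CubeSphere p, ∀ y : Fin p → ℝ, ‖y‖ ≤ 1 → Φ y = u y := by
    intro u hu
    obtain ⟨v, c, q, hc, h0, hq⟩ := exists_chart p (u 0)
    exact DiscreteMorse.schoenflies hu hc h0 hq (range_ne_univ p hu)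
  obtain ⟨Φ, hΦ⟩ := key hu
  -- The standard face satisfies the same hypotheses as `u`, so both balls are standard in the same
  -- one-point compactification and `Φ ∘ Φ'⁻¹` carries one to the other.
  obtain ⟨Φ', hΦ'⟩ := key (isOpenEmbedding_lowerHalf p)
  refine ⟨Φ'.symm.trans Φ, fun x y hy hx => ?_⟩
  have : Φ' y = x := by
    rw [hΦ' y hy]
    ext1
    simp [lowerHalf, hx, hy]
  rw [Homeomorph.trans_apply, ← this, Φ'.symm_apply_apply, hΦ y hy]

end CubeSphere

/-! ### Cones over isotopies -/

section Cone

variable {E : Type*} [NormedAddCommGroup E] [NormedSpace ℝ E]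

/-- The cone over a homeomorphism of the product of the sphere and an interval. -/
def coneMap (Ψ : Ico (0 : ℝ) 1 × sphere (0 : E) 1 → Ico (0 : ℝ) 1 × sphere (0 : E) 1)
    (z : ball (0 : E) 1) : ball (0 : E) 1 :=
  open Classical in
  if h : (z : E) = 0 then z else
    ⟨‖(z : E)‖ • (Ψ (⟨‖(z : E)‖, norm_nonneg _, mem_ball_zero_iff.1 z.2⟩,
      ⟨‖(z : E)‖⁻¹ • z, by simp [norm_smul, h]⟩)).2.1, by
        rw [mem_ball_zero_iff, norm_smul, norm_eq_of_mem_sphere, mul_one, norm_norm]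
        exact mem_ball_zero_iff.1 z.2⟩

theorem coneMap_smul (Ψ : Ico (0 : ℝ) 1 × sphere (0 : E) 1 → Ico (0 : ℝ) 1 × sphere (0 : E) 1)
    (ρ : Ico (0 : ℝ) 1) (hρ : (ρ : ℝ) ≠ 0) (x : sphere (0 : E) 1) (h : ρ.1 • x.1 ∈ ball (0 : E) 1) :
    (coneMap Ψ ⟨ρ.1 • x.1, h⟩ : E) = ρ.1 • (Ψ (ρ, x)).2.1 := by
  have hx : ‖x.1‖ = 1 := norm_eq_of_mem_sphere x
  have hx0 : x.1 ≠ 0 := fun h => by simp [h] at hx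
  have hn : ‖ρ.1 • x.1‖ = ρ.1 := by rw [norm_smul, hx, mul_one, Real.norm_of_nonneg ρ.2.1]
  rw [coneMap, dif_neg (smul_ne_zero hρ hx0)]
  dsimp only
  have key : ∀ (r : ℝ) (hr : r ∈ Ico (0 : ℝ) 1) (y : E) (hy : y ∈ sphere (0 : E) 1),
      r = ρ.1 → y = x.1 → r • (Ψ (⟨r, hr⟩, ⟨y, hy⟩)).2.1 = ρ.1 • (Ψ (ρ, x)).2.1 := by
    rintro _ hr _ hy rfl rfl
    rfl
  exact key _ _ _ _ hn (by rw [hn, inv_smul_smul₀ hρ])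

theorem norm_coneMap (Ψ : Ico (0 : ℝ) 1 × sphere (0 : E) 1 → Ico (0 : ℝ) 1 × sphere (0 : E) 1)
    (z : ball (0 : E) 1) : ‖(coneMap Ψ z : E)‖ = ‖(z : E)‖ := by
  unfold coneMap
  split_ifs
  · rfl
  · simp [norm_smul]

theorem coneMap_coneMap {Ψ Ψ' : Ico (0 : ℝ) 1 × sphere (0 : E) 1 → Ico (0 : ℝ) 1 × sphere (0 : E) 1}
    (h : ∀ x, Ψ (Ψ' x) = x) (h' : ∀ x, (Ψ' x).1 = x.1) (z : ball (0 : E) 1) :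
    coneMap Ψ (coneMap Ψ' z) = z := by
  rcases eq_or_ne (z : E) 0 with hz | hz
  · have : coneMap Ψ' z = z := by rw [coneMap, dif_pos hz]
    rw [this, coneMap, dif_pos hz]
  · have hz' : ‖(z : E)‖ ≠ 0 := norm_ne_zero_iff.2 hz
    let ρ : Ico (0 : ℝ) 1 := ⟨‖(z : E)‖, norm_nonneg _, mem_ball_zero_iff.1 z.2⟩
    let x : sphere (0 : E) 1 := ⟨‖(z : E)‖⁻¹ • z, by simp [norm_smul, hz]⟩
    have e1 : (coneMap Ψ' z : E) = ρ.1 • (Ψ' (ρ, x)).2.1 := by rw [coneMap, dif_neg hz]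
    have h2 : coneMap Ψ' z = ⟨ρ.1 • (Ψ' (ρ, x)).2.1, e1 ▸ (coneMap Ψ' z).2⟩ := Subtype.ext e1
    have e3 : (ρ, (Ψ' (ρ, x)).2) = Ψ' (ρ, x) := Prod.ext (h' (ρ, x)).symm rfl
    ext1
    rw [h2, coneMap_smul Ψ ρ hz', e3, h]
    exact smul_inv_smul₀ hz' _

/-- At the origin continuity follows from preservation of the norm alone; elsewhere polar
coordinates are continuous. No behaviour of `Ψ` as the radius tends to 1 enters, which is essential
for the isotopy below. -/
theorem continuous_coneMap
    {Ψ : Ico (0 : ℝ) 1 × sphere (0 : E) 1 → Ico (0 : ℝ) 1 × sphere (0 : E) 1}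
    (h : Continuous Ψ) : Continuous (coneMap Ψ) := by
  refine continuous_iff_continuousAt.2 fun z => ?_
  rcases eq_or_ne (z : E) 0 with hz | hz
  · have h0 : coneMap Ψ z = z := by rw [coneMap, dif_pos hz]
    rw [ContinuousAt, h0, tendsto_subtype_rng, hz, tendsto_zero_iff_norm_tendsto_zero]
    simp only [norm_coneMap]
    have : ContinuousAt (fun z : ball (0 : E) 1 => ‖(z : E)‖) z := by fun_prop
    simpa [ContinuousAt, hz] using this
  · let V : Set (ball (0 : E) 1) := {z | (z : E) ≠ 0}
    have hV : IsOpen V := isOpen_ne_fun continuous_subtype_val continuous_const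
    suffices ContinuousOn (coneMap Ψ) V from this.continuousAt (hV.mem_nhds hz)
    rw [continuousOn_iff_continuous_domRestrict]
    have : V.domRestrict (coneMap Ψ) = fun z : V =>
        ⟨‖(z : E)‖ • (Ψ (⟨‖(z : E)‖, norm_nonneg _, mem_ball_zero_iff.1 z.1.2⟩,
          ⟨‖(z : E)‖⁻¹ • z, by simp [norm_smul, show (z : E) ≠ 0 from z.2]⟩)).2.1, by
        rw [mem_ball_zero_iff, norm_smul, norm_eq_of_mem_sphere, mul_one, norm_norm]
        exact mem_ball_zero_iff.1 z.1.2⟩ := by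
      funext z
      rw [domRestrict_apply, coneMap, dif_neg z.2]
    rw [this]
    refine Continuous.subtype_mk (Continuous.smul (by fun_prop) ?_) _
    refine continuous_subtype_val.comp (continuous_snd.comp (h.comp ?_))
    refine Continuous.prodMk (Continuous.subtype_mk (by fun_prop) _) (Continuous.subtype_mk ?_ _)
    exact (Continuous.inv₀ (by fun_prop) fun z => norm_ne_zero_iff.2 z.2).smul (by fun_prop)

/-- The cone over an isotopy, as a homeomorphism of the open ball. -/
def coneHomeo (Ψ : Ico (0 : ℝ) 1 × sphere (0 : E) 1 ≃ₜ Ico (0 : ℝ) 1 × sphere (0 : E) 1)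
    (h : ∀ x, (Ψ x).1 = x.1) : ball (0 : E) 1 ≃ₜ ball (0 : E) 1 where
  toFun := coneMap Ψ
  invFun := coneMap Ψ.symm
  left_inv := coneMap_coneMap Ψ.symm_apply_apply h
  right_inv := coneMap_coneMap Ψ.apply_symm_apply fun x => by
    rw [← h (Ψ.symm x), Ψ.apply_symm_apply]
  continuous_toFun := continuous_coneMap Ψ.continuous
  continuous_invFun := continuous_coneMap Ψ.symm.continuous

end Cone

end

/-! ### Straightening a map of the cube along a face -/

section

/-! ### An isotopy expanding the ball of radius one half -/

section Slide

/-- For fixed `ρ < 1`, a piecewise linear bijection, equal to the identity for `t` close to `1`; for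
`ρ = 1` it is `min (2 t) 1` on the unit interval. -/
def slide (ρ t : ℝ) : ℝ :=
  max t (min (2 * t) ((1 + ρ) / 2 - (1 - ρ) / 2 * ((1 + ρ) / 2 - t)))

/-- The inverse of `slide ρ`. -/
def slideInv (ρ t : ℝ) : ℝ :=
  min t (max (t / 2) ((1 + ρ) / 2 - ((1 + ρ) / 2 - t) / ((1 - ρ) / 2)))

theorem le_slide (ρ t : ℝ) : t ≤ slide ρ t := le_max_left _ _

theorem slide_nonneg {ρ t : ℝ} (ht : 0 ≤ t) : 0 ≤ slide ρ t := ht.trans (le_slide ρ t)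

theorem slideInv_nonneg {ρ t : ℝ} (ht : 0 ≤ t) : 0 ≤ slideInv ρ t :=
  le_min ht (le_max_of_le_left (by linarith))

theorem slideInv_le (ρ t : ℝ) : slideInv ρ t ≤ t := min_le_left _ _

theorem slide_le_one {ρ t : ℝ} (h0 : 0 ≤ ρ) (h1 : ρ ≤ 1) (ht : t ≤ 1) : slide ρ t ≤ 1 :=
  max_le ht ((min_le_right _ _).trans (by nlinarith [mul_nonneg h0 (sub_nonneg.2 h1)]))

theorem slide_lt_one {ρ t : ℝ} (h0 : 0 ≤ ρ) (h1 : ρ < 1) (ht : t < 1) : slide ρ t < 1 :=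
  max_lt ht ((min_le_right _ _).trans_lt (by nlinarith [mul_nonneg h0 (sub_nonneg.2 h1.le)]))

theorem slide_zero {ρ : ℝ} (h0 : 0 ≤ ρ) : slide ρ 0 = 0 := by
  have : 0 ≤ (1 + ρ) / 2 - (1 - ρ) / 2 * ((1 + ρ) / 2 - 0) := by nlinarith
  rw [slide, mul_zero, min_eq_left this, max_self]

theorem slideInv_zero {ρ : ℝ} : slideInv ρ 0 = 0 := by
  rw [slideInv, zero_div, min_eq_left (le_max_left _ _)]

/-- This bounds the support: for each `ρ < 1` the induced map of the ball is the identity near the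
boundary and so extends by the identity to the sphere. -/
theorem slide_of_le {ρ t : ℝ} (h0 : 0 ≤ ρ) (ht : (1 + ρ) / 2 ≤ t) : slide ρ t = t := by
  refine max_eq_left ((min_le_right _ _).trans ?_)
  nlinarith

/-- The limit stretches the half ball over the whole ball and flattens the remaining shell onto the
boundary sphere; injectivity is lost only here. -/
theorem slide_one {t : ℝ} (h0 : 0 ≤ t) (h1 : t ≤ 1) : slide 1 t = min (2 * t) 1 := by
  rw [slide]
  norm_num
  exact ⟨by linarith, h1⟩

/-- For `ρ < 1` all three affine functions in `slide` are increasing, the third having slope `(1 -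
ρ) / 2`. Inverting each of them and exchanging `max` with `min` inverts the whole. -/
theorem slide_slideInv {ρ t : ℝ} (h1 : ρ < 1) (_ht : 0 ≤ t) :
    slide ρ (slideInv ρ t) = t := by
  have ha : 0 < (1 - ρ) / 2 := by linarith
  have hb : (1 - ρ) / 2 * (((1 + ρ) / 2 - t) / ((1 - ρ) / 2)) = (1 + ρ) / 2 - t :=
    mul_div_cancel₀ _ ha.ne'
  unfold slide slideInv
  generalize ((1 + ρ) / 2 - t) / ((1 - ρ) / 2) = b at *
  rcases min_cases t (max (t / 2) ((1 + ρ) / 2 - b)) with ⟨h, h'⟩ | ⟨h, h'⟩ <;> rw [h]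
  · rcases max_cases (t / 2) ((1 + ρ) / 2 - b) with ⟨g, g'⟩ | ⟨g, g'⟩ <;> rw [g] at h'
    · exact max_eq_left (min_le_of_left_le (by linarith))
    · exact max_eq_left (min_le_of_right_le (by nlinarith))
  · rcases max_cases (t / 2) ((1 + ρ) / 2 - b) with ⟨g, g'⟩ | ⟨g, g'⟩ <;> rw [g] at h' ⊢
    · rw [min_eq_left (by nlinarith), max_eq_right (by linarith)]
      ring
    · rw [min_eq_right (by nlinarith), max_eq_right (by nlinarith)]
      linarith

theorem slideInv_slide {ρ t : ℝ} (h1 : ρ < 1) (_ht : 0 ≤ t) :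
    slideInv ρ (slide ρ t) = t := by
  have ha : 0 < (1 - ρ) / 2 := by linarith
  have hb : ∀ s, ((1 + ρ) / 2 - s) / ((1 - ρ) / 2) * ((1 - ρ) / 2) = (1 + ρ) / 2 - s :=
    fun s => div_mul_cancel₀ _ ha.ne'
  unfold slideInv
  specialize hb (slide ρ t)
  generalize ((1 + ρ) / 2 - slide ρ t) / ((1 - ρ) / 2) = b at *
  unfold slide at *
  rcases max_cases t (min (2 * t) ((1 + ρ) / 2 - (1 - ρ) / 2 * ((1 + ρ) / 2 - t)))
    with ⟨h, h'⟩ | ⟨h, h'⟩ <;> rw [h] at hb ⊢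
  · rw [min_eq_left]
    rcases min_cases (2 * t) ((1 + ρ) / 2 - (1 - ρ) / 2 * ((1 + ρ) / 2 - t))
      with ⟨g, g'⟩ | ⟨g, g'⟩ <;> rw [g] at h'
    · exact le_max_of_le_left (by linarith)
    · refine le_max_of_le_right ?_
      by_contra! hc
      nlinarith
  · rcases min_cases (2 * t) ((1 + ρ) / 2 - (1 - ρ) / 2 * ((1 + ρ) / 2 - t))
      with ⟨g, g'⟩ | ⟨g, g'⟩ <;> rw [g] at hb h' ⊢
    · have : (1 + ρ) / 2 - b ≤ t := by
        by_contra! hc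
        nlinarith
      rw [max_eq_left (by linarith), min_eq_right (by linarith)]
      ring
    · have : (1 + ρ) / 2 - b = t := by
        refine mul_right_cancel₀ ha.ne' ?_
        linarith
      rw [max_eq_right (by linarith), min_eq_right (by linarith), this]

theorem continuous_slide {Z : Type*} [TopologicalSpace Z] {f g : Z → ℝ} (hf : Continuous f)
    (hg : Continuous g) : Continuous fun z => slide (f z) (g z) := by
  unfold slide
  fun_prop

variable {F : Type*} [NormedAddCommGroup F] [NormedSpace ℝ F]

/-- The isotopy of the open ball defined by `slide`. -/
def slideHomeo : Ico (0 : ℝ) 1 × ball (0 : F) 1 ≃ₜ Ico (0 : ℝ) 1 × ball (0 : F) 1 where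
  toFun z := (z.1, ⟨(slide z.1 ‖z.2.1‖ / ‖z.2.1‖) • z.2.1, by
    rw [mem_ball_zero_iff, norm_div_smul (slide_nonneg (norm_nonneg _))
      fun h => by rw [h, norm_zero, slide_zero z.1.2.1]]
    exact slide_lt_one z.1.2.1 z.1.2.2 (mem_ball_zero_iff.1 z.2.2)⟩)
  invFun z := (z.1, ⟨(slideInv z.1 ‖z.2.1‖ / ‖z.2.1‖) • z.2.1, by
    rw [mem_ball_zero_iff, norm_div_smul (slideInv_nonneg (norm_nonneg _))
      fun h => by rw [h, norm_zero, slideInv_zero]]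
    exact (slideInv_le _ _).trans_lt (mem_ball_zero_iff.1 z.2.2)⟩)
  left_inv := by
    rintro ⟨ρ, y⟩
    refine Prod.ext rfl (Subtype.ext ?_)
    dsimp only
    have hs : (y : F) = 0 → slide ρ ‖y.1‖ = 0 := fun h => by rw [h, norm_zero, slide_zero ρ.2.1]
    rcases eq_or_ne (y : F) 0 with h | h
    · rw [h]; simp
    · have h' := norm_ne_zero_iff.2 h
      rw [div_norm_smul_div_norm_smul (slide_nonneg (norm_nonneg _)) h
        ((norm_pos_iff.2 h).trans_le (le_slide _ _)).ne',
        norm_div_smul (slide_nonneg (norm_nonneg _)) hs,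
        slideInv_slide ρ.2.2 (norm_nonneg _), div_self h', one_smul]
  right_inv := by
    rintro ⟨ρ, y⟩
    refine Prod.ext rfl (Subtype.ext ?_)
    dsimp only
    have hs : (y : F) = 0 → slideInv ρ ‖y.1‖ = 0 := fun h => by rw [h, norm_zero, slideInv_zero]
    rcases eq_or_ne (y : F) 0 with h | h
    · rw [h]; simp
    · have h' := norm_ne_zero_iff.2 h
      have h0 : slideInv ρ ‖y.1‖ ≠ 0 := fun h0 => h' (by
        rw [← slide_slideInv ρ.2.2 (norm_nonneg y.1), h0, slide_zero ρ.2.1])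
      rw [div_norm_smul_div_norm_smul (slideInv_nonneg (norm_nonneg _)) h h0,
        norm_div_smul (slideInv_nonneg (norm_nonneg _)) hs,
        slide_slideInv ρ.2.2 (norm_nonneg _), div_self h', one_smul]
  continuous_toFun := by
    refine continuous_fst.prodMk (Continuous.subtype_mk (continuous_div_norm_smul
      (continuous_slide (by fun_prop) (by fun_prop)) (by fun_prop) fun z hz => ?_) _)
    rw [hz, norm_zero, slide_zero z.1.2.1]
  continuous_invFun := by
    refine continuous_fst.prodMk (Continuous.subtype_mk (continuous_div_norm_smul
      (s := fun z : Ico (0 : ℝ) 1 × ball (0 : F) 1 => slideInv z.1 ‖z.2.1‖)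
      ?_ (by fun_prop) fun z hz => ?_) _)
    · unfold slideInv
      refine Continuous.min (by fun_prop) (Continuous.max (by fun_prop) (Continuous.sub
        (by fun_prop) (Continuous.div (by fun_prop) (by fun_prop) fun z => ?_)))
      have := z.1.2.2
      linarith
    · rw [hz, norm_zero, slideInv_zero]

end Slide

/-! ### Straightening a face -/

section Straighten

variable {X : Type*} [TopologicalSpace X] [T2Space X] {p : ℕ}
  {h : (Fin (p + 1) → ℝ) → X} {g : (Fin p → ℝ) → X}
  {u : ball (0 : Fin p → ℝ) 1 → CubeSphere p}

open Filter

/-- An isotopy of the boundary of the cube. -/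
theorem exists_isotopy (hu : IsOpenEmbedding u) :
    ∃ Ψ : Ico (0 : ℝ) 1 × CubeSphere p ≃ₜ Ico (0 : ℝ) 1 × CubeSphere p,
      (∀ z, (Ψ z).1 = z.1) ∧ (∀ ρ y, (Ψ (ρ, u y)).2 = u (slideHomeo (ρ, y)).2) ∧
      ∀ ρ, ∀ x ∉ range u, (Ψ (ρ, x)).2 = x := by
  have hu' : IsOpenEmbedding (Prod.map (id : Ico (0 : ℝ) 1 → Ico (0 : ℝ) 1) u) :=
    IsOpenEmbedding.id.prodMap hu
  let Z : Set (Ico (0 : ℝ) 1 × ball (0 : Fin p → ℝ) 1) := {z | ‖z.2.1‖ ≤ (1 + z.1.1) / 2}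
  -- Over each `ρ` the set is the image of a closed ball of radius `(1 + ρ) / 2`. Rescaling these
  -- balls to the unit ball presents the set as the projection of a closed set along a compact
  -- factor.
  have hZ : IsClosed (Prod.map (id : Ico (0 : ℝ) 1 → Ico (0 : ℝ) 1) u '' Z) := by
    let sc : Ico (0 : ℝ) 1 × closedBall (0 : Fin p → ℝ) 1 → ball (0 : Fin p → ℝ) 1 := fun z =>
      ⟨((1 + z.1.1) / 2) • z.2.1, by
        have h1 := z.1.2.1
        have h2 := z.1.2.2
        have h3 := mem_closedBall_zero_iff.1 z.2.2
        rw [mem_ball_zero_iff, norm_smul, Real.norm_of_nonneg (by linarith)]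
        nlinarith [norm_nonneg z.2.1]⟩
    have hsc : Continuous sc := Continuous.subtype_mk (by fun_prop) _
    let K : Set ((Ico (0 : ℝ) 1 × CubeSphere p) × closedBall (0 : Fin p → ℝ) 1) :=
      {w | w.1.2 = u (sc (w.1.1, w.2))}
    have hK : IsClosed K := isClosed_eq (by fun_prop)
      (hu.continuous.comp (hsc.comp (by fun_prop)))
    convert isClosedMap_fst_of_compactSpace K hK using 1
    ext ⟨ρ, x⟩
    constructor
    · rintro ⟨⟨ρ', y⟩, hy, hyx⟩
      obtain ⟨rfl, rfl⟩ := Prod.mk.inj hyx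
      have h0 : 0 < (1 + ρ'.1) / 2 := by linarith [ρ'.2.1]
      refine ⟨((ρ', u y), ⟨((1 + ρ'.1) / 2)⁻¹ • y.1, ?_⟩), ?_, rfl⟩
      · rw [mem_closedBall_zero_iff, norm_smul, norm_inv, Real.norm_of_nonneg h0.le,
          inv_mul_le_iff₀ h0, mul_one]
        exact hy
      · change u y = u (sc _)
        congr 1
        exact Subtype.ext (smul_inv_smul₀ h0.ne' _).symm
    · rintro ⟨⟨⟨ρ', x'⟩, w⟩, hw, hwx⟩
      obtain ⟨rfl, rfl⟩ := Prod.mk.inj hwx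
      refine ⟨(ρ', sc (ρ', w)), ?_, Prod.ext rfl (Eq.symm hw)⟩
      have h1 := ρ'.2.1
      change ‖((1 + ρ'.1) / 2) • w.1‖ ≤ (1 + ρ'.1) / 2
      rw [norm_smul, Real.norm_of_nonneg (by linarith)]
      nlinarith [mem_closedBall_zero_iff.1 w.2]
  have hid : ∀ z ∉ Z, slideHomeo z = z := by
    rintro ⟨ρ, y⟩ hz
    have hz' : (1 + ρ.1) / 2 < ‖y.1‖ := not_le.1 hz
    have h0 : ‖y.1‖ ≠ 0 := (lt_trans (by linarith [ρ.2.1]) hz').ne'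
    refine Prod.ext rfl (Subtype.ext ?_)
    change (slide ρ ‖y.1‖ / ‖y.1‖) • y.1 = y.1
    rw [slide_of_le ρ.2.1 hz'.le, div_self h0, one_smul]
  have e1 : ∀ ρ y, extendHomeo hu' slideHomeo hZ hid (ρ, u y) =
      (ρ, u (slideHomeo (ρ, y)).2) := fun ρ y =>
    extendMap_apply hu'.injective slideHomeo (ρ, y)
  have e2 : ∀ ρ, ∀ x ∉ range u, extendHomeo hu' slideHomeo hZ hid (ρ, x) = (ρ, x) :=
    fun ρ x hx => extendMap_of_notMem _ fun ⟨z, hz⟩ => hx ⟨z.2, congrArg Prod.snd hz⟩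
  refine ⟨extendHomeo hu' slideHomeo hZ hid, ?_, fun ρ y => by rw [e1], fun ρ x hx => by
    rw [e2 ρ x hx]⟩
  rintro ⟨ρ, x⟩
  by_cases hx : x ∈ range u
  · obtain ⟨y, rfl⟩ := hx
    rw [e1]
  · rw [e2 ρ x hx]

/-- The radial map which the isotopy approaches. -/
def slideRad (ρ : ℝ) (y : Fin p → ℝ) : Fin p → ℝ := (slide ρ ‖y‖ / ‖y‖) • y

theorem norm_slideRad {ρ : ℝ} (h0 : 0 ≤ ρ) (y : Fin p → ℝ) : ‖slideRad ρ y‖ = slide ρ ‖y‖ :=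
  norm_div_smul (slide_nonneg (norm_nonneg _)) fun h => by rw [h, norm_zero, slide_zero h0]

theorem tendsto_slideRad {Z : Type*} {l : Filter Z} {ρ : Z → ℝ} {y : Z → Fin p → ℝ} {ρ' : ℝ}
    {y' : Fin p → ℝ} (hρ : Tendsto ρ l (𝓝 ρ')) (hy : Tendsto y l (𝓝 y')) (h0 : 0 ≤ ρ') :
    Tendsto (fun z => slideRad (ρ z) (y z)) l (𝓝 (slideRad ρ' y')) := by
  have := continuousAt_div_norm_smul (s := fun z : ℝ × (Fin p → ℝ) => slide z.1 ‖z.2‖)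
    (g := fun z : ℝ × (Fin p → ℝ) => z.2) (z := (ρ', y'))
    (continuous_slide (by fun_prop) (by fun_prop)).continuousAt (by fun_prop)
    (fun hz => by simp only at hz; simp only [hz, norm_zero, slide_zero h0])
  change Tendsto ((fun z : ℝ × (Fin p → ℝ) => (slide z.1 ‖z.2‖ / ‖z.2‖) • z.2) ∘
    fun z => (ρ z, y z)) l (𝓝 ((slide ρ' ‖y'‖ / ‖y'‖) • y'))
  exact Tendsto.comp this (hρ.prodMk_nhds hy)

open Classical in
/-- The limit of the isotopy on the boundary of the cube. -/
def slideLimit (u : ball (0 : Fin p → ℝ) 1 → CubeSphere p) (h : (Fin (p + 1) → ℝ) → X)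
    (g : (Fin p → ℝ) → X) (x : CubeSphere p) : X :=
  if hx : ∃ y, u y = x then g (slideRad 1 hx.choose) else h x

theorem slideLimit_apply (hu : Function.Injective u) (y : ball (0 : Fin p → ℝ) 1) :
    slideLimit u h g (u y) = g (slideRad 1 y) := by
  have hx : ∃ y', u y' = u y := ⟨y, rfl⟩
  rw [slideLimit, dif_pos hx, hu hx.choose_spec]

theorem slideLimit_of_notMem {x : CubeSphere p} (hx : x ∉ range u) :
    slideLimit u h g x = h x := dif_neg hx

/-- Coordinates on the open ball which are linear on a smaller ball. -/
def ballChart (p : ℕ) : (Fin p → ℝ) ≃ₜ ball (0 : Fin p → ℝ) 1 where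
  toFun := fun y => ⟨(max 2 (1 + ‖y‖))⁻¹ • y, by
    have h1 : 0 < max 2 (1 + ‖y‖) := lt_max_of_lt_left two_pos
    rw [mem_ball_zero_iff, norm_smul, norm_inv, Real.norm_of_nonneg h1.le, inv_mul_lt_iff₀ h1,
      mul_one]
    exact lt_max_of_lt_right (by linarith)⟩
  invFun := fun y => (min (1 / 2) (1 - ‖y.1‖))⁻¹ • y.1
  left_inv := fun y => by
    have h1 : 0 < max 2 (1 + ‖y‖) := lt_max_of_lt_left two_pos
    have h2 : min (1 / 2) (1 - ‖(max 2 (1 + ‖y‖))⁻¹ • y‖) = (max 2 (1 + ‖y‖))⁻¹ := by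
      rw [norm_smul, norm_inv, Real.norm_of_nonneg h1.le]
      have hy := norm_nonneg y
      rcases max_cases 2 (1 + ‖y‖) with ⟨h, h'⟩ | ⟨h, h'⟩ <;> rw [h]
      · rw [min_eq_left (by linarith)]; norm_num
      · have e : 1 - (1 + ‖y‖)⁻¹ * ‖y‖ = (1 + ‖y‖)⁻¹ := by field_simp; ring
        rw [e, min_eq_right]
        rw [one_div]
        exact inv_anti₀ two_pos h'.le
    dsimp only
    rw [h2, inv_inv, smul_inv_smul₀ h1.ne']
  right_inv := fun y => by
    have h1 := mem_ball_zero_iff.1 y.2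
    have h0 : 0 < min (1 / 2) (1 - ‖y.1‖) := lt_min (by norm_num) (by linarith)
    have h2 : max 2 (1 + ‖(min (1 / 2) (1 - ‖y.1‖))⁻¹ • y.1‖) =
        (min (1 / 2) (1 - ‖y.1‖))⁻¹ := by
      rw [norm_smul, norm_inv, Real.norm_of_nonneg h0.le]
      have hy := norm_nonneg y.1
      rcases min_cases (1 / 2) (1 - ‖y.1‖) with ⟨h, h'⟩ | ⟨h, h'⟩ <;> rw [h]
      · rw [max_eq_left] <;> norm_num
        linarith
      · have e : 1 + (1 - ‖y.1‖)⁻¹ * ‖y.1‖ = (1 - ‖y.1‖)⁻¹ := by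
          have : 1 - ‖y.1‖ ≠ 0 := by linarith
          field_simp
          ring
        rw [e, max_eq_right]
        rw [le_inv_comm₀ two_pos (by linarith)]
        linarith
    refine Subtype.ext ?_
    dsimp only
    rw [h2, inv_inv, smul_inv_smul₀ h0.ne']
  continuous_toFun := Continuous.subtype_mk
    (((continuous_const.max (continuous_const.add continuous_norm)).inv₀
      fun _ => (lt_max_of_lt_left two_pos).ne').smul continuous_id) _
  continuous_invFun := ((continuous_const.min (continuous_const.sub
    (continuous_norm.comp continuous_subtype_val))).inv₀ fun y =>
      (lt_min (by norm_num) (sub_pos.2 (mem_ball_zero_iff.1 y.2))).ne').smul continuous_subtype_val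

theorem ballChart_apply (y : Fin p → ℝ) :
    (ballChart p y : Fin p → ℝ) = (max 2 (1 + ‖y‖))⁻¹ • y := rfl

theorem ballChart_symm_apply (y : ball (0 : Fin p → ℝ) 1) :
    (ballChart p).symm y = (min (1 / 2) (1 - ‖y.1‖))⁻¹ • y.1 := rfl

/-- Let `h` be continuous on the cube and `g` on one of its faces, such that `g = h ∘ u` on the
interior of the face for an open embedding `u` in the boundary of the cube. Then there is a map with
the same properties as `h` on the interior which agrees with `g` on the face. -/
theorem exists_straighten (hh : ContinuousOn h (closedBall 0 1))
    (hg : ContinuousOn g (closedBall 0 1)) (hu : IsOpenEmbedding u)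
    (hgu : ∀ y : ball (0 : Fin p → ℝ) 1, h (u y) = g y) :
    ∃ φ : (Fin (p + 1) → ℝ) → X, ContinuousOn φ (closedBall 0 1) ∧
      (∃ e : ball (0 : Fin (p + 1) → ℝ) 1 ≃ₜ ball (0 : Fin (p + 1) → ℝ) 1,
        ∀ z : ball (0 : Fin (p + 1) → ℝ) 1, φ z = h (e z)) ∧
      (∀ y ∈ closedBall (0 : Fin p → ℝ) 1, φ (faceIncl p y) = g y) ∧
      ∀ z ∈ sphere (0 : Fin (p + 1) → ℝ) 1, z ∉ faceIncl p '' closedBall 0 1 →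
        φ z ∈ g '' sphere 0 1 ∪ h '' (sphere 0 1 \ range fun y => (u y).1) := by
  classical
  obtain ⟨Ψ, hΨ1, hΨ2, hΨ3⟩ := exists_isotopy hu
  have hγ : ∀ y, ‖y‖ ≤ 1 → (ballChart p y : Fin p → ℝ) = (1 / 2 : ℝ) • y := fun y hy => by
    rw [ballChart_apply, max_eq_left (by linarith)]
    norm_num
  -- `ballChart` halves the unit ball, so `Θ` carries the bottom face to the image under `u` of the
  -- half ball, exactly the part that the limiting isotopy expands to the whole ball.
  obtain ⟨Θ, hΘ⟩ := CubeSphere.schoenflies p (hu.comp (ballChart p).isOpenEmbedding)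
  let Ψ' := ((Homeomorph.refl (Ico (0 : ℝ) 1)).prodCongr Θ).trans Ψ
  have hΨ' : ∀ z, (Ψ' z).1 = z.1 := fun z => hΨ1 _
  let E := coneHomeo Ψ' hΨ'
  let ψ : CubeSphere p → X := fun x => slideLimit u h g (Θ x)
  let φ : (Fin (p + 1) → ℝ) → X := fun z =>
    if hz : z ∈ ball (0 : Fin (p + 1) → ℝ) 1 then h (E ⟨z, hz⟩) else
      if hz' : z ∈ sphere (0 : Fin (p + 1) → ℝ) 1 then ψ ⟨z, hz'⟩ else h 0
  have hφ1 : ∀ z : ball (0 : Fin (p + 1) → ℝ) 1, φ z = h (E z) := fun z => by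
    simp only [φ]; rw [dif_pos z.2]
  have hφ2 : ∀ z : sphere (0 : Fin (p + 1) → ℝ) 1, φ z = ψ z := fun z => by
    simp only [φ]
    rw [dif_neg (fun hz => by rw [mem_ball_zero_iff, norm_eq_of_mem_sphere] at hz; linarith),
      dif_pos z.2]
  have hsub : ∀ z ∈ ball (0 : Fin (p + 1) → ℝ) 1, z ∈ closedBall (0 : Fin (p + 1) → ℝ) 1 :=
    fun z hz => ball_subset_closedBall hz
  refine ⟨φ, ?_, ⟨E, hφ1⟩, ?_, ?_⟩
  · intro z₀ hz₀
    rcases (mem_closedBall_zero_iff.1 hz₀).lt_or_eq with hlt | heq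
    · -- the interior
      have hz₀' : z₀ ∈ ball (0 : Fin (p + 1) → ℝ) 1 := mem_ball_zero_iff.2 hlt
      refine ContinuousAt.continuousWithinAt ?_
      suffices ContinuousOn φ (ball 0 1) from this.continuousAt (isOpen_ball.mem_nhds hz₀')
      rw [continuousOn_iff_continuous_domRestrict]
      have : (ball (0 : Fin (p + 1) → ℝ) 1).domRestrict φ = fun z => h (E z) := funext hφ1
      rw [this]
      exact (hh.mono ball_subset_closedBall).comp_continuous
        (continuous_subtype_val.comp E.continuous) fun z => (E z).2
    · -- the boundary
      have hS₀ : z₀ ∈ sphere (0 : Fin (p + 1) → ℝ) 1 := mem_sphere_zero_iff_norm.2 heq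
      -- Since `u` need not extend to the closed ball, parameters and directions are not controlled
      -- by convergence in the sphere. Along an ultrafilter, compactness provides limits for both,
      -- and only their images under `g` and `h` have to be compared.
      rw [ContinuousWithinAt, tendsto_iff_ultrafilter]
      intro 𝒰 h𝒰
      have hz𝒰 : Tendsto id (𝒰 : Filter (Fin (p + 1) → ℝ)) (𝓝 z₀) := h𝒰.trans inf_le_left
      have hcb : ∀ᶠ z in (𝒰 : Filter (Fin (p + 1) → ℝ)), z ∈ closedBall (0 : Fin (p + 1) → ℝ) 1 :=
        h𝒰.trans inf_le_right (Filter.mem_principal_self _)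
      have hnorm : Tendsto (fun z => ‖z‖) (𝒰 : Filter (Fin (p + 1) → ℝ)) (𝓝 1) := by
        simpa [heq] using hz𝒰.norm
      have hne : ∀ᶠ z in (𝒰 : Filter (Fin (p + 1) → ℝ)), z ≠ 0 := by
        filter_upwards [hnorm.eventually (lt_mem_nhds one_half_lt_one)] with z hz hz'
        rw [hz', norm_zero] at hz
        linarith
      -- the directions
      let x₀ : CubeSphere p := Θ ⟨z₀, hS₀⟩
      let dir : (Fin (p + 1) → ℝ) → CubeSphere p := fun z =>
        if hz : z = 0 then ⟨z₀, hS₀⟩ else ⟨‖z‖⁻¹ • z, by simp [norm_smul, hz]⟩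
      have hdir : Tendsto dir (𝒰 : Filter (Fin (p + 1) → ℝ)) (𝓝 ⟨z₀, hS₀⟩) := by
        rw [tendsto_subtype_rng]
        have h1 : Tendsto (fun z : Fin (p + 1) → ℝ => ‖z‖⁻¹ • z)
            (𝒰 : Filter (Fin (p + 1) → ℝ)) (𝓝 z₀) := by
          simpa using (hnorm.inv₀ one_ne_zero).smul hz𝒰
        refine h1.congr' ?_
        filter_upwards [hne] with z hz
        simp only [dir]
        rw [dif_neg hz]
      let x : (Fin (p + 1) → ℝ) → CubeSphere p := fun z => Θ (dir z)
      have hx : Tendsto x (𝒰 : Filter (Fin (p + 1) → ℝ)) (𝓝 x₀) :=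
        (Θ.continuous.tendsto _).comp hdir
      have hhS : Continuous fun x : CubeSphere p => h x :=
        hh.comp_continuous continuous_subtype_val fun x => sphere_subset_closedBall x.2
      have hsm : ∀ {y : (Fin (p + 1) → ℝ) → CubeSphere p} {l : CubeSphere p},
          Tendsto y (𝒰 : Filter (Fin (p + 1) → ℝ)) (𝓝 l) →
          Tendsto (fun z => h (‖z‖ • (y z).1)) (𝒰 : Filter (Fin (p + 1) → ℝ)) (𝓝 (h l)) := by
        intro y l hy
        have h1 : Tendsto (fun z => ‖z‖ • (y z).1) (𝒰 : Filter (Fin (p + 1) → ℝ)) (𝓝 l.1) := by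
          simpa using hnorm.smul ((continuous_subtype_val.tendsto l).comp hy)
        refine (hh l (sphere_subset_closedBall l.2)).tendsto.comp
          (tendsto_nhdsWithin_iff.2 ⟨h1, ?_⟩)
        filter_upwards [hcb] with z hz
        rw [mem_closedBall_zero_iff, norm_smul, norm_eq_of_mem_sphere, mul_one, norm_norm]
        exact mem_closedBall_zero_iff.1 hz
      -- the value of `φ` in polar coordinates
      have hφlt : ∀ z, z ≠ 0 → ∀ hlt : ‖z‖ < 1,
          φ z = h (‖z‖ • (Ψ (⟨‖z‖, norm_nonneg _, hlt⟩, x z)).2.1) := by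
        intro z hz hlt
        have hz' : z ∈ ball (0 : Fin (p + 1) → ℝ) 1 := mem_ball_zero_iff.2 hlt
        rw [hφ1 ⟨z, hz'⟩]
        congr 1
        change (coneMap Ψ' ⟨z, hz'⟩).1 = _
        rw [coneMap, dif_neg hz]
        simp only [x, dir]
        rw [dif_neg hz]
        rfl
      have hφeq : ∀ z, z ≠ 0 → ‖z‖ = 1 → φ z = slideLimit u h g (x z) := by
        intro z hz hz1
        rw [hφ2 ⟨z, mem_sphere_zero_iff_norm.2 hz1⟩]
        simp only [ψ, x, dir]
        rw [dif_neg hz]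
        congr 3
        rw [hz1, inv_one, one_smul]
      have hφ₀ : φ z₀ = slideLimit u h g x₀ := hφ2 ⟨z₀, hS₀⟩
      rcases 𝒰.em (fun z => x z ∈ range u) with hU | hK
      · -- directions in the image of `u`
        let y : (Fin (p + 1) → ℝ) → (Fin p → ℝ) := fun z =>
          if hz : x z ∈ range u then (hz.choose : Fin p → ℝ) else 0
        have hyB : ∀ z, x z ∈ range u → ∃ hy : y z ∈ ball (0 : Fin p → ℝ) 1,
            u ⟨y z, hy⟩ = x z := by
          intro z hz
          simp only [y, dif_pos hz]
          exact ⟨hz.choose.2, hz.choose_spec⟩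
        obtain ⟨y₁, hy₁, hyt⟩ : ∃ y₁ ∈ closedBall (0 : Fin p → ℝ) 1,
            Tendsto y (𝒰 : Filter (Fin (p + 1) → ℝ)) (𝓝 y₁) := by
          have := (isCompact_closedBall (0 : Fin p → ℝ) 1).ultrafilter_le_nhds (𝒰.map y) (by
            rw [Filter.le_principal_iff]
            change ∀ᶠ z in (𝒰 : Filter (Fin (p + 1) → ℝ)), y z ∈ closedBall 0 1
            filter_upwards [hU] with z hz
            exact ball_subset_closedBall (hyB z hz).1)
          exact this
        have hy't : Tendsto (fun z => slideRad ‖z‖ (y z)) (𝒰 : Filter (Fin (p + 1) → ℝ))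
            (𝓝 (slideRad 1 y₁)) := tendsto_slideRad hnorm hyt zero_le_one
        have hgt : ∀ {w : (Fin (p + 1) → ℝ) → (Fin p → ℝ)} {w₁ : Fin p → ℝ},
            Tendsto w (𝒰 : Filter (Fin (p + 1) → ℝ)) (𝓝 w₁) →
            (∀ᶠ z in (𝒰 : Filter (Fin (p + 1) → ℝ)), ‖w z‖ ≤ 1) →
            Tendsto (fun z => g (w z)) (𝒰 : Filter (Fin (p + 1) → ℝ)) (𝓝 (g w₁)) := by
          intro w w₁ hw hw'
          have hw₁ : ‖w₁‖ ≤ 1 := le_of_tendsto hw.norm hw'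
          refine (hg w₁ (mem_closedBall_zero_iff.2 hw₁)).tendsto.comp
            (tendsto_nhdsWithin_iff.2 ⟨hw, ?_⟩)
          filter_upwards [hw'] with z hz
          exact mem_closedBall_zero_iff.2 hz
        have hy1 : ∀ᶠ z in (𝒰 : Filter (Fin (p + 1) → ℝ)), ‖y z‖ ≤ 1 := by
          filter_upwards [hU] with z hz
          exact (mem_ball_zero_iff.1 (hyB z hz).1).le
        have hy'1 : ∀ᶠ z in (𝒰 : Filter (Fin (p + 1) → ℝ)), ‖slideRad ‖z‖ (y z)‖ ≤ 1 := by
          filter_upwards [hy1, hcb] with z hz hz'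
          rw [norm_slideRad (norm_nonneg _)]
          exact slide_le_one (norm_nonneg _) (mem_closedBall_zero_iff.1 hz') hz
        have hg1 := hgt hyt hy1
        have hg2 := hgt hy't hy'1
        -- the value at `z₀`
        have hval : φ z₀ = g (slideRad 1 y₁) := by
          rw [hφ₀]
          have hux : Tendsto (fun z => h (x z)) (𝒰 : Filter (Fin (p + 1) → ℝ)) (𝓝 (h x₀)) :=
            (hhS.tendsto x₀).comp hx
          -- The relation `h ∘ u = g` passes to the limit even where `u` has none.
          have hgx : h x₀ = g y₁ := by
            refine tendsto_nhds_unique hux (hg1.congr' ?_)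
            filter_upwards [hU] with z hz
            obtain ⟨hy, hyx⟩ := hyB z hz
            rw [← hyx, hgu]
          rcases (mem_closedBall_zero_iff.1 hy₁).lt_or_eq with hy₁' | hy₁'
          · have hb : y₁ ∈ ball (0 : Fin p → ℝ) 1 := mem_ball_zero_iff.2 hy₁'
            let yb : (Fin (p + 1) → ℝ) → ball (0 : Fin p → ℝ) 1 := fun z =>
              if hz : y z ∈ ball (0 : Fin p → ℝ) 1 then ⟨y z, hz⟩ else ⟨y₁, hb⟩
            have hyb : Tendsto yb (𝒰 : Filter (Fin (p + 1) → ℝ)) (𝓝 ⟨y₁, hb⟩) := by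
              rw [tendsto_subtype_rng]
              refine hyt.congr' ?_
              filter_upwards [hU] with z hz
              simp only [yb]
              rw [dif_pos (hyB z hz).1]
            have : x₀ = u ⟨y₁, hb⟩ := by
              refine tendsto_nhds_unique hx (((hu.continuous.tendsto _).comp hyb).congr' ?_)
              filter_upwards [hU] with z hz
              simp only [yb, Function.comp_apply]
              rw [dif_pos (hyB z hz).1, (hyB z hz).2]
            rw [this, slideLimit_apply hu.injective]
          -- A limit parameter on the boundary sphere forces `x₀` out of the open image, because `u`
          -- is an embedding. The two clauses of the limit map then agree by the previous relation,
          -- as `slide 1` fixes radius 1.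
          · have hnot : x₀ ∉ range u := by
              rintro ⟨y₀, hy₀⟩
              let yb : (Fin (p + 1) → ℝ) → ball (0 : Fin p → ℝ) 1 := fun z =>
                if hz : y z ∈ ball (0 : Fin p → ℝ) 1 then ⟨y z, hz⟩ else y₀
              have hyb : Tendsto yb (𝒰 : Filter (Fin (p + 1) → ℝ)) (𝓝 y₀) := by
                rw [hu.isInducing.tendsto_nhds_iff, hy₀]
                refine hx.congr' ?_
                filter_upwards [hU] with z hz
                simp only [yb, Function.comp_apply]
                rw [dif_pos (hyB z hz).1, (hyB z hz).2]
              have h1 : y₁ = y₀ := by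
                refine tendsto_nhds_unique (hyt.congr' ?_)
                  ((continuous_subtype_val.tendsto _).comp hyb)
                filter_upwards [hU] with z hz
                simp only [yb, Function.comp_apply]
                rw [dif_pos (hyB z hz).1]
              have h2 := mem_ball_zero_iff.1 y₀.2
              rw [← h1, hy₁'] at h2
              exact lt_irrefl _ h2
            rw [slideLimit_of_notMem hnot, hgx]
            congr 1
            rw [slideRad, hy₁', slide_one zero_le_one le_rfl]
            norm_num
        rw [hval]
        rcases 𝒰.em (fun z => ‖z‖ < 1) with hlt | hge
        · -- compactness of the sphere
          let w : (Fin (p + 1) → ℝ) → CubeSphere p := fun z =>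
            if hz : ‖z‖ < 1 then (Ψ (⟨‖z‖, norm_nonneg _, hz⟩, x z)).2 else x₀
          obtain ⟨l, -, hl⟩ := isCompact_univ.ultrafilter_le_nhds (𝒰.map w) (by simp)
          have hl' : Tendsto w (𝒰 : Filter (Fin (p + 1) → ℝ)) (𝓝 l) := hl
          -- The limit direction `l` itself may depend on the ultrafilter; its image under `h` does
          -- not.
          have e1 : h l = g (slideRad 1 y₁) := by
            refine tendsto_nhds_unique ((hhS.tendsto l).comp hl') (hg2.congr' ?_)
            filter_upwards [hU, hlt] with z hz hz'
            obtain ⟨hy, hyx⟩ := hyB z hz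
            simp only [Function.comp_apply, w]
            rw [dif_pos hz', ← hyx, hΨ2, hgu]
            rfl
          rw [← e1]
          refine (hsm hl').congr' ?_
          filter_upwards [hlt, hne] with z hz hz'
          rw [hφlt z hz' hz]
          simp only [w]
          rw [dif_pos hz]
        · refine hg2.congr' ?_
          filter_upwards [hU, hge, hcb, hne] with z hz hz' hz'' hz0
          have h1 : ‖z‖ = 1 := le_antisymm (mem_closedBall_zero_iff.1 hz'') (not_lt.1 hz')
          obtain ⟨hy, hyx⟩ := hyB z hz
          rw [hφeq z hz0 h1, ← hyx, slideLimit_apply hu.injective, h1]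
      · -- directions outside the image of `u`
        have hx₀ : x₀ ∉ range u :=
          (hu.isOpen_range.isClosed_compl).mem_of_tendsto hx hK
        rw [hφ₀, slideLimit_of_notMem hx₀]
        refine (hsm hx).congr' ?_
        filter_upwards [hK, hcb, hne] with z hz hz' hz0
        rcases (mem_closedBall_zero_iff.1 hz').lt_or_eq with hlt | heq
        · rw [hφlt z hz0 hlt, hΨ3 _ _ hz]
        · rw [hφeq z hz0 heq, slideLimit_of_notMem hz, heq, one_smul]
  · intro y hy
    rw [mem_closedBall_zero_iff] at hy
    have hS : faceIncl p y ∈ sphere (0 : Fin (p + 1) → ℝ) 1 := by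
      rw [mem_sphere_zero_iff_norm, norm_faceIncl, max_eq_right hy]
    rw [hφ2 ⟨_, hS⟩]
    simp only [ψ]
    rw [hΘ ⟨_, hS⟩ y hy rfl, Function.comp_apply, slideLimit_apply hu.injective, hγ y hy, slideRad]
    congr 1
    rw [norm_smul, slide_one (by positivity) (by norm_num; linarith)]
    rcases eq_or_ne y 0 with rfl | hy0
    · simp
    · rw [smul_smul, min_eq_left (by norm_num; linarith)]
      have := norm_ne_zero_iff.2 hy0
      have e : 2 * (‖(1 / 2 : ℝ)‖ * ‖y‖) / (‖(1 / 2 : ℝ)‖ * ‖y‖) * (1 / 2) = 1 := by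
        norm_num
        field_simp
      rw [e, one_smul]
  · intro z hz hzf
    rw [hφ2 ⟨z, hz⟩]
    simp only [ψ]
    by_cases hx : Θ ⟨z, hz⟩ ∈ range u
    · left
      obtain ⟨y, hy⟩ := hx
      rw [← hy, slideLimit_apply hu.injective]
      refine mem_image_of_mem _ ?_
      rw [mem_sphere_zero_iff_norm, norm_slideRad zero_le_one,
        slide_one (norm_nonneg _) (mem_ball_zero_iff.1 y.2).le, min_eq_right]
      -- If the parameter had norm below one half, its double would lie in the unit ball, and
      -- injectivity of `Θ` would place `z` on the bottom face.
      by_contra! hlt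
      let v := (ballChart p).symm y
      have hv : (min (1 / 2) (1 - ‖y.1‖))⁻¹ • y.1 = v := (ballChart_symm_apply y).symm
      rw [min_eq_left (by linarith)] at hv
      have hv1 : ‖v‖ ≤ 1 := by
        rw [← hv, norm_smul]
        norm_num
        linarith
      have hS : faceIncl p v ∈ sphere (0 : Fin (p + 1) → ℝ) 1 := by
        rw [mem_sphere_zero_iff_norm, norm_faceIncl, max_eq_right hv1]
      have e := hΘ ⟨_, hS⟩ v hv1 rfl
      rw [Function.comp_apply, Homeomorph.apply_symm_apply, hy] at e
      have e' := congrArg Subtype.val (Θ.injective e)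
      exact hzf ⟨v, mem_closedBall_zero_iff.2 hv1, e'⟩
    · right
      rw [slideLimit_of_notMem hx]
      refine mem_image_of_mem _ ⟨(Θ ⟨z, hz⟩).2, ?_⟩
      rintro ⟨y, hy⟩
      exact hx ⟨y, Subtype.ext hy⟩

end Straighten

end

/-! ### Elementary collapses produced by a gradient vector field -/

section

variable {X : Type u} [TopologicalSpace X] [T2Space X] {C : Set X} [CWComplex C]

/-! ### Characteristic maps -/

section CharMap

theorem symm_map_mem_ball (n : ℕ) (c : RelCWComplex.cell C n) {x : X}
    (hx : x ∈ RelCWComplex.openCell n c) :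
    (RelCWComplex.map n c).symm x ∈ ball (0 : Fin n → ℝ) 1 := by
  obtain ⟨y, hy, rfl⟩ := hx
  rwa [(RelCWComplex.map n c).left_inv (by rwa [RelCWComplex.source_eq])]

theorem openCell_eq_target (n : ℕ) (c : RelCWComplex.cell C n) :
    RelCWComplex.openCell n c = (RelCWComplex.map n c).target := by
  rw [← (RelCWComplex.map n c).image_source_eq_target, RelCWComplex.source_eq]
  rfl

theorem continuous_symm_map (n : ℕ) (c : RelCWComplex.cell C n) :
    Continuous fun x : RelCWComplex.openCell n c => (RelCWComplex.map n c).symm x :=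
  (RelCWComplex.continuousOn_symm n c).comp_continuous continuous_subtype_val fun x =>
    openCell_eq_target n c ▸ x.2

theorem continuous_map_ball (n : ℕ) (c : RelCWComplex.cell C n) :
    Continuous fun y : ball (0 : Fin n → ℝ) 1 => RelCWComplex.map n c y :=
  ((RelCWComplex.continuousOn n c).mono ball_subset_closedBall).comp_continuous
    continuous_subtype_val fun y => y.2

theorem map_symm_apply_ball (n : ℕ) (c : RelCWComplex.cell C n) {y : Fin n → ℝ}
    (hy : y ∈ ball (0 : Fin n → ℝ) 1) :
    (RelCWComplex.map n c).symm (RelCWComplex.map n c y) = y :=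
  (RelCWComplex.map n c).left_inv (by rwa [RelCWComplex.source_eq])

theorem map_apply_symm (n : ℕ) (c : RelCWComplex.cell C n) {x : X}
    (hx : x ∈ RelCWComplex.openCell n c) :
    RelCWComplex.map n c ((RelCWComplex.map n c).symm x) = x :=
  (RelCWComplex.map n c).right_inv (openCell_eq_target n c ▸ hx)

/-- The characteristic map of a cell as a homeomorphism of the open ball and the open cell. -/
def cellHomeo (n : ℕ) (c : RelCWComplex.cell C n) :
    ball (0 : Fin n → ℝ) 1 ≃ₜ RelCWComplex.openCell n c where
  toFun y := ⟨RelCWComplex.map n c y, mem_image_of_mem _ y.2⟩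
  invFun x := ⟨(RelCWComplex.map n c).symm x, symm_map_mem_ball n c x.2⟩
  left_inv y := Subtype.ext (map_symm_apply_ball n c y.2)
  right_inv x := Subtype.ext (map_apply_symm n c x.2)
  continuous_toFun := Continuous.subtype_mk (continuous_map_ball n c) _
  continuous_invFun := Continuous.subtype_mk (continuous_symm_map n c) _

theorem isCharMap_map (n : ℕ) (c : RelCWComplex.cell C n) :
    IsCharMap n c (RelCWComplex.map n c) where
  continuousOn := RelCWComplex.continuousOn n c
  homeo := ⟨cellHomeo n c, fun _ => rfl⟩
  mapsTo _ hx := RelCWComplex.cellFrontier_subset_skeletonLT n c (mem_image_of_mem _ hx)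

variable {n : ℕ} {c : RelCWComplex.cell C n} {φ ψ : (Fin n → ℝ) → X}

theorem IsCharMap.congr (h : IsCharMap n c φ) (hψ : EqOn ψ φ (closedBall 0 1)) :
    IsCharMap n c ψ where
  continuousOn := h.continuousOn.congr hψ
  homeo := h.homeo.imp fun _ he x => (he x).trans (hψ (ball_subset_closedBall x.2)).symm
  mapsTo x hx := by
    rw [hψ (sphere_subset_closedBall hx)]
    exact h.mapsTo hx

theorem IsCharMap.image_ball (h : IsCharMap n c φ) :
    φ '' ball 0 1 = RelCWComplex.openCell n c := by
  obtain ⟨e, he⟩ := h.homeo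
  ext x
  constructor
  · rintro ⟨y, hy, rfl⟩
    rw [← he ⟨y, hy⟩]
    exact (e _).2
  · intro hx
    exact ⟨e.symm ⟨x, hx⟩, (e.symm _).2, by rw [← he, e.apply_symm_apply]⟩

theorem IsCharMap.mapsTo_closure (h : IsCharMap n c φ) :
    MapsTo φ (closedBall 0 1) (closure (RelCWComplex.openCell n c)) := by
  have := MapsTo.closure_of_continuousOn (s := ball 0 1) (f := φ)
    (fun x hx => h.image_ball ▸ mem_image_of_mem φ hx)
    (by rw [closure_ball _ one_ne_zero]; exact h.continuousOn)
  rwa [closure_ball _ one_ne_zero] at this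

theorem IsCharMap.injOn_ball (h : IsCharMap n c φ) : InjOn φ (ball 0 1) := by
  obtain ⟨e, he⟩ := h.homeo
  intro x hx y hy hxy
  have := e.injective (Subtype.ext ((he ⟨x, hx⟩).trans (hxy.trans (he ⟨y, hy⟩).symm)))
  exact congrArg Subtype.val this

end CharMap

/-! ### Cells and subcomplexes -/

section Cells

theorem exists_openCell_of_mem_skeletonLT {n : ℕ} {x : X}
    (hx : x ∈ RelCWComplex.skeletonLT C n) :
    ∃ l < n, ∃ j : RelCWComplex.cell C l, x ∈ RelCWComplex.openCell l j := by
  obtain ⟨l, hl, j, hj⟩ := CWComplex.mem_skeletonLT_iff.1 hx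
  exact ⟨l, by exact_mod_cast hl, j, hj⟩

theorem exists_openCell_of_mem_frontier {n : ℕ} {c : RelCWComplex.cell C n} {x : X}
    (hx : x ∈ RelCWComplex.cellFrontier n c) :
    ∃ l < n, ∃ j : RelCWComplex.cell C l, x ∈ RelCWComplex.openCell l j :=
  exists_openCell_of_mem_skeletonLT (RelCWComplex.cellFrontier_subset_skeletonLT n c hx)

theorem cell_eq_of_mem {n m : ℕ} {i : RelCWComplex.cell C n} {j : RelCWComplex.cell C m} {x : X}
    (hi : x ∈ RelCWComplex.openCell n i) (hj : x ∈ RelCWComplex.openCell m j) :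
    (⟨n, i⟩ : Σ n, RelCWComplex.cell C n) = ⟨m, j⟩ := by
  by_contra h
  exact (RelCWComplex.disjoint_openCell_of_ne h).notMem_of_mem_left hi hj

theorem mem_subcomplex_iff {E : RelCWComplex.Subcomplex C} {x : X} :
    x ∈ E ↔ ∃ m, ∃ i ∈ E.I m, x ∈ RelCWComplex.openCell m i := by
  change x ∈ (E : Set X) ↔ _
  rw [← CWComplex.Subcomplex.union]
  simp

theorem subcomplex_le {E F : RelCWComplex.Subcomplex C} (h : ∀ m, E.I m ⊆ F.I m) : E ≤ F := by
  intro x hx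
  obtain ⟨m, i, hi, hx⟩ := mem_subcomplex_iff.1 hx
  exact mem_subcomplex_iff.2 ⟨m, i, h m hi, hx⟩

theorem subcomplex_ext {E F : RelCWComplex.Subcomplex C} (h : ∀ m, E.I m = F.I m) : E = F :=
  le_antisymm (subcomplex_le fun m => (h m).subset) (subcomplex_le fun m => (h m).superset)

theorem mem_I_of_mem {E : RelCWComplex.Subcomplex C} {n : ℕ} {i : RelCWComplex.cell C n} {x : X}
    (hx : x ∈ E) (hi : x ∈ RelCWComplex.openCell n i) : i ∈ E.I n := by
  by_contra h
  exact (RelCWComplex.Subcomplex.disjoint_openCell_subcomplex_of_not_mem E h).notMem_of_mem_left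
    hi hx

variable (C) in
/-- The subcomplex with given cells. -/
def subcomplexOfCells (I : ∀ m, Set (RelCWComplex.cell C m))
    (h : ∀ m, ∀ i ∈ I m, ∀ x ∈ RelCWComplex.cellFrontier m i,
      ∃ l, ∃ j ∈ I l, x ∈ RelCWComplex.openCell l j) : RelCWComplex.Subcomplex C :=
  CWComplex.Subcomplex.mk' C (⋃ (m : ℕ) (j : I m), RelCWComplex.openCell m j.1) I
    (by
      rintro m ⟨i, hi⟩
      rw [← RelCWComplex.cellFrontier_union_openCell_eq_closedCell]
      refine union_subset (fun x hx => ?_) (fun x hx => mem_iUnion₂.2 ⟨m, ⟨i, hi⟩, hx⟩)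
      obtain ⟨l, j, hj, hx'⟩ := h m i hi x hx
      exact mem_iUnion₂.2 ⟨l, ⟨j, hj⟩, hx'⟩)
    rfl

/-- An open cell is open in the skeleton of its dimension. -/
theorem exists_isClosed_skeletonLT_diff (n : ℕ) (c : RelCWComplex.cell C n) :
    ∃ K : Set X, IsClosed K ∧ ∀ x ∈ RelCWComplex.skeletonLT C ((n + 1 : ℕ) : ℕ∞),
      (x ∈ K ↔ x ∉ RelCWComplex.openCell n c) := by
  refine ⟨subcomplexOfCells C (fun m => {i | m ≤ n ∧ (⟨m, i⟩ : Σ m, RelCWComplex.cell C m) ≠ ⟨n, c⟩})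
    ?_, RelCWComplex.Subcomplex.closed _, fun x hx => ?_⟩
  · rintro m i ⟨hm, -⟩ x hx
    obtain ⟨l, hl, j, hj⟩ := exists_openCell_of_mem_frontier hx
    refine ⟨l, j, ⟨by omega, fun h => ?_⟩, hj⟩
    have := congrArg Sigma.fst h
    simp only at this
    omega
  · rw [SetLike.mem_coe, mem_subcomplex_iff]
    constructor
    · rintro ⟨m, i, ⟨-, hi⟩, hx'⟩ hxc
      exact hi (cell_eq_of_mem hx' hxc)
    · intro hxc
      obtain ⟨l, hl, j, hj⟩ := exists_openCell_of_mem_skeletonLT hx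
      refine ⟨l, j, ⟨by omega, fun h => hxc ?_⟩, hj⟩
      obtain ⟨rfl, h⟩ := Sigma.mk.inj h
      rwa [← eq_of_heq h]

end Cells

/-! ### Regular faces -/

section RegularFace

variable {p : ℕ} {s : RelCWComplex.cell C p} {t : RelCWComplex.cell C (p + 1)}

/-- The part of the boundary sphere over `s` is an open ball on which `h` is a homeomorphism, so
`exists_straighten` applies with the given characteristic map of `s` as `g`. The last clause holds
because the rest of the boundary goes to the frontier of `s` or to points outside `s`; it makes `s`
a free face once no other partner contains it. -/
theorem IsRegularFace.exists_charMap (hst : IsRegularFace s t) :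
    ∃ φ : (Fin (p + 1) → ℝ) → X, IsCharMap (p + 1) t φ ∧ IsCharMap p s (φ ∘ faceIncl p) ∧
      ∀ z ∈ sphere (0 : Fin (p + 1) → ℝ) 1, z ∉ faceIncl p '' closedBall 0 1 →
        φ z ∉ RelCWComplex.openCell p s := by
  obtain ⟨-, h, hh, ⟨e, he⟩, -⟩ := hst
  -- Interior points go to the open cell `t`, which is disjoint from `s` for reasons of dimension.
  have hsph : ∀ x : (closedBall (0 : Fin (p + 1) → ℝ) 1 ∩ h ⁻¹' RelCWComplex.openCell p s : Set _),
      x.1 ∈ sphere (0 : Fin (p + 1) → ℝ) 1 := by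
    rintro ⟨x, hx, hx'⟩
    rw [mem_sphere_zero_iff_norm]
    refine (mem_closedBall_zero_iff.1 hx).eq_of_not_lt fun hlt => ?_
    have h1 : h x ∈ RelCWComplex.openCell (p + 1) t :=
      hh.image_ball ▸ mem_image_of_mem h (mem_ball_zero_iff.2 hlt)
    have := congrArg Sigma.fst (cell_eq_of_mem hx' h1)
    simp at this
  let ι : (closedBall (0 : Fin (p + 1) → ℝ) 1 ∩ h ⁻¹' RelCWComplex.openCell p s : Set _) →
    CubeSphere p := fun x => ⟨x, hsph x⟩
  have hrange : range ι = {x | h x.1 ∈ RelCWComplex.openCell p s} := by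
    ext x
    constructor
    · rintro ⟨x, rfl⟩
      exact x.2.2
    · intro hx
      exact ⟨⟨x, sphere_subset_closedBall x.2, hx⟩, rfl⟩
  have hcont : Continuous fun x : CubeSphere p => h x :=
    hh.continuousOn.comp_continuous continuous_subtype_val fun x => sphere_subset_closedBall x.2
  -- The boundary sphere maps to the `p`-skeleton, in which the open cell `s` is open.
  have hι : IsOpenEmbedding ι := by
    refine ⟨IsEmbedding.of_comp (Continuous.subtype_mk continuous_subtype_val _)
      continuous_subtype_val (IsEmbedding.subtypeVal), ?_⟩
    rw [hrange]
    obtain ⟨K, hK, hK'⟩ := exists_isClosed_skeletonLT_diff p s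
    have : {x : CubeSphere p | h x.1 ∈ RelCWComplex.openCell p s} =
        ((fun x : CubeSphere p => h x) ⁻¹' K)ᶜ := by
      ext x
      exact (not_iff_comm.1 (hK' _ (hh.mapsTo x.2)).symm).symm
    rw [this]
    exact (hK.preimage hcont).isOpen_compl
  let u : ball (0 : Fin p → ℝ) 1 → CubeSphere p := fun y => ι (e.symm (cellHomeo p s y))
  have hu : IsOpenEmbedding u :=
    hι.comp (e.symm.isOpenEmbedding.comp (cellHomeo p s).isOpenEmbedding)
  have hrangeu : range u = range ι := by
    change range (ι ∘ (e.symm ∘ cellHomeo p s)) = _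
    rw [range_comp, (e.symm.surjective.comp (cellHomeo p s).surjective).range_eq, image_univ]
  have hgu : ∀ y : ball (0 : Fin p → ℝ) 1, h (u y) = RelCWComplex.map p s y := fun y => by
    change h (e.symm (cellHomeo p s y)).1 = _
    rw [← he, e.apply_symm_apply]
    rfl
  obtain ⟨φ, h1, ⟨e', h2⟩, h3, h4⟩ := exists_straighten hh.continuousOn
    (RelCWComplex.continuousOn p s) hu hgu
  have h4' : ∀ z ∈ sphere (0 : Fin (p + 1) → ℝ) 1, z ∉ faceIncl p '' closedBall 0 1 →
      φ z ∈ RelCWComplex.skeletonLT C ((p + 1 : ℕ) : ℕ∞) ∧ φ z ∉ RelCWComplex.openCell p s := by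
    intro z hz hz'
    rcases h4 z hz hz' with hg | ⟨x, ⟨hx, hx'⟩, hxz⟩
    · have : φ z ∈ RelCWComplex.skeletonLT C (p : ℕ∞) :=
        RelCWComplex.cellFrontier_subset_skeletonLT p s hg
      refine ⟨RelCWComplex.skeletonLT_mono (by simp) this, fun hc => ?_⟩
      obtain ⟨l, hl, j, hj⟩ := exists_openCell_of_mem_skeletonLT this
      have := congrArg Sigma.fst (cell_eq_of_mem hj hc)
      simp only at this
      omega
    · rw [← hxz]
      refine ⟨hh.mapsTo hx, fun hc => hx' ?_⟩
      have : (⟨x, hx⟩ : CubeSphere p) ∈ range u := by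
        rw [hrangeu, hrange]
        exact hc
      obtain ⟨y, hy⟩ := this
      exact ⟨y, congrArg Subtype.val hy⟩
  refine ⟨φ, ⟨h1, ?_, fun z hz => ?_⟩, (isCharMap_map p s).congr h3, fun z hz hz' =>
    (h4' z hz hz').2⟩
  · obtain ⟨k, hk⟩ := hh.homeo
    exact ⟨e'.trans k, fun z => by rw [Homeomorph.trans_apply, hk, h2]⟩
  · by_cases hz' : z ∈ faceIncl p '' closedBall 0 1
    · obtain ⟨y, hy, rfl⟩ := hz'
      rw [h3 y hy]
      exact_mod_cast RelCWComplex.closedCell_subset_skeletonLT p s (mem_image_of_mem _ hy)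
    · exact (h4' z hz hz').1

end RegularFace

/-! ### Collapsing along a gradient vector field -/

namespace VectorField

variable {V : VectorField C}

/-- `s'` follows `s` in a non-stationary path. -/
def Next (V : VectorField C) (n : ℕ) (s s' : RelCWComplex.cell C n) : Prop :=
  ∃ t, V.W n s = some t ∧ s' ≠ s ∧ IsFace s' t

theorem Next.step {n : ℕ} {s s' : RelCWComplex.cell C n} (h : V.Next n s s') : V.Step n s s' := by
  obtain ⟨t, ht, h⟩ := h
  refine ⟨fun h0 => by simp [h0] at ht, fun t' ht' => ?_⟩
  rw [ht, Option.some_inj] at ht'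
  rwa [← ht']

theorem exists_path_of_transGen {n : ℕ} {s s' : RelCWComplex.cell C n}
    (h : Relation.TransGen (V.Next n) s s') :
    ∃ r, 1 ≤ r ∧ ∃ σ : ℕ → RelCWComplex.cell C n, σ 0 = s ∧ σ r = s' ∧
      ∀ i < r, V.Next n (σ i) (σ (i + 1)) := by
  induction h with
  | @single b h =>
    refine ⟨1, le_rfl, fun i => if i = 0 then s else b, by simp, by simp, fun i hi => ?_⟩
    obtain rfl : i = 0 := by omega
    simpa using h
  | @tail b c _ h ih =>
    obtain ⟨r, hr, σ, h0, h1, h2⟩ := ih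
    refine ⟨r + 1, by omega, fun i => if i ≤ r then σ i else c, by simpa using h0, by simp,
      fun i hi => ?_⟩
    rcases (Nat.lt_succ_iff.1 hi).lt_or_eq with hi | rfl
    · simpa [hi.le, Nat.succ_le_of_lt hi] using h2 i hi
    · simpa [h1] using h

theorem IsGradient.not_transGen (hV : V.IsGradient) {n : ℕ} (s : RelCWComplex.cell C n) :
    ¬ Relation.TransGen (V.Next n) s s := by
  intro h
  obtain ⟨r, hr, σ, h0, h1, h2⟩ := exists_path_of_transGen h
  have := hV n r σ hr (fun i hi => (h2 i hi).step) (h1.trans h0.symm)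
  obtain ⟨t, -, hne, -⟩ := h2 0 (by omega)
  exact hne this

/-- On a finite set an irreflexive transitive relation is well-founded. A minimal cell is a face of
no other cell's partner in `T`, so it is the one to collapse next. -/
theorem IsGradient.exists_source [CWComplex.Finite C] (hV : V.IsGradient) {n : ℕ}
    {T : Set (RelCWComplex.cell C n)} (hT : T.Nonempty) :
    ∃ s ∈ T, ∀ s' ∈ T, ¬ V.Next n s' s := by
  have : Finite (RelCWComplex.cell C n) := CWComplex.FiniteType.finite_cell n
  have : Std.Irrefl (Relation.TransGen (V.Next n)) := ⟨hV.not_transGen⟩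
  have wf : WellFounded (Relation.TransGen (V.Next n)) :=
    Finite.wellFounded_of_trans_of_irrefl _
  obtain ⟨s, hs, hmin⟩ := wf.has_min T hT
  exact ⟨s, hs, fun s' hs' h => hmin s' hs' (.single h)⟩

theorem IsCollapsible.not_isRedundant {n : ℕ} {c : RelCWComplex.cell C n}
    (h : V.IsCollapsible n c) : ¬ V.IsRedundant n c := by
  cases n with
  | zero => exact h.elim
  | succ n =>
    obtain ⟨s, hs⟩ := h
    rintro ⟨t, ht⟩
    simp [V.disjoint n s c hs] at ht

theorem not_isRedundant_and_not_isCritical {n : ℕ} {c : RelCWComplex.cell C n} :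
    (¬ V.IsRedundant n c ∧ ¬ V.IsCritical n c) ↔ V.IsCollapsible n c := by
  constructor
  · rintro ⟨h1, h2⟩
    by_contra h
    exact h2 ⟨h1, h⟩
  · intro h
    exact ⟨h.not_isRedundant, fun h' => h'.2 h⟩

theorem mem_X'_I {n m : ℕ} {i : RelCWComplex.cell C m} :
    i ∈ (V.X' n).I m ↔ m ≤ n ∧ (m = n → ¬ V.IsRedundant m i) := Iff.rfl

theorem mem_X''_I {n m : ℕ} {i : RelCWComplex.cell C m} :
    i ∈ (V.X'' n).I m ↔ m ≤ n ∧ (m = n → V.IsCollapsible m i) := by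
  rw [← not_isRedundant_and_not_isCritical]
  exact Iff.rfl

variable (V) in
/-- The cells of `X'_n` together with the cells of `T` and the matching `(n+1)`-cells. -/
def stageCells (n : ℕ) (T : Set (RelCWComplex.cell C n)) (m : ℕ) : Set (RelCWComplex.cell C m) :=
  {i | i ∈ (V.X' n).I m ∨ (∃ s ∈ T, (⟨m, i⟩ : Σ m, RelCWComplex.cell C m) = ⟨n, s⟩) ∨
    ∃ s ∈ T, ∃ t, V.W n s = some t ∧ (⟨m, i⟩ : Σ m, RelCWComplex.cell C m) = ⟨n + 1, t⟩}

theorem stageCells_empty (n m : ℕ) : V.stageCells n ∅ m = (V.X' n).I m := by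
  ext i
  simp [stageCells]

theorem stageCells_isRedundant (n m : ℕ) :
    V.stageCells n {s | V.IsRedundant n s} m = (V.X'' (n + 1)).I m := by
  ext i
  rw [mem_X''_I]
  constructor
  · rintro (h | ⟨s, hs, h⟩ | ⟨s, hs, t, ht, h⟩)
    · exact ⟨by have := h.1; omega, fun h' => by have := h.1; omega⟩
    · obtain ⟨rfl, -⟩ := Sigma.mk.inj h
      exact ⟨by omega, fun h' => by omega⟩
    · obtain ⟨rfl, h⟩ := Sigma.mk.inj h
      rw [eq_of_heq h]
      exact ⟨le_rfl, fun _ => ⟨s, ht⟩⟩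
  · rintro ⟨h, h'⟩
    rcases h.lt_or_eq with hlt | rfl
    · rcases (Nat.lt_succ_iff.1 hlt).lt_or_eq with hlt | rfl
      · exact Or.inl ⟨hlt.le, fun h => absurd h hlt.ne⟩
      · by_cases hr : V.IsRedundant m i
        · exact Or.inr (Or.inl ⟨i, hr, rfl⟩)
        · exact Or.inl ⟨le_rfl, fun _ => hr⟩
    · obtain ⟨s, hs⟩ := h' rfl
      exact Or.inr (Or.inr ⟨s, ⟨i, hs⟩, i, hs, rfl⟩)

/-- The faces of the cells in the image of `T` lie in `T` or in `X'_n`. -/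
theorem mem_stageCells_of_face (hC : FaceCondition C) {n : ℕ} {T : Set (RelCWComplex.cell C n)}
    (hT : ∀ s ∈ T, ∀ s', V.Next n s s' → V.IsRedundant n s' → s' ∈ T)
    {s : RelCWComplex.cell C n} (hs : s ∈ T) {t : RelCWComplex.cell C (n + 1)}
    (hst : V.W n s = some t) {x : X} (hx : x ∈ closure (RelCWComplex.openCell (n + 1) t)) {l : ℕ}
    (hl : l < n + 1) {j : RelCWComplex.cell C l} (hj : x ∈ RelCWComplex.openCell l j) :
    j ∈ (V.X' n).I l ∨ ∃ s' ∈ T, (⟨l, j⟩ : Σ m, RelCWComplex.cell C m) = ⟨n, s'⟩ := by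
  rcases (Nat.lt_succ_iff.1 hl).lt_or_eq with hl | rfl
  · exact Or.inl ⟨hl.le, fun h => absurd h hl.ne⟩
  · by_cases hr : V.IsRedundant l j
    · refine Or.inr ⟨j, ?_, rfl⟩
      rcases eq_or_ne j s with rfl | hne
      · exact hs
      · exact hT s hs j ⟨t, hst, hne, hC l j t ⟨x, hj, hx⟩⟩ hr
    · exact Or.inl ⟨le_rfl, fun _ => hr⟩

/-- Closure of `T` under redundant successors is what keeps the frontiers of the partners inside the
stage: a redundant face of a partner is either its own match or a successor of it. -/
theorem exists_subcomplex_stage (hC : FaceCondition C) {n : ℕ} {T : Set (RelCWComplex.cell C n)}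
    (hT : ∀ s ∈ T, ∀ s', V.Next n s s' → V.IsRedundant n s' → s' ∈ T) :
    ∃ E : RelCWComplex.Subcomplex C, ∀ m, E.I m = V.stageCells n T m := by
  refine ⟨subcomplexOfCells C (V.stageCells n T) ?_, fun m => rfl⟩
  intro m i hi x hx
  obtain ⟨l, hl, j, hj⟩ := exists_openCell_of_mem_frontier hx
  refine ⟨l, j, ?_, hj⟩
  rcases hi with h | ⟨s, hs, h⟩ | ⟨s, hs, t, ht, h⟩
  · have := h.1
    exact Or.inl ⟨by omega, fun h => by omega⟩
  · obtain ⟨rfl, h⟩ := Sigma.mk.inj h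
    exact Or.inl ⟨by omega, fun h => by omega⟩
  · obtain ⟨rfl, h⟩ := Sigma.mk.inj h
    obtain rfl := eq_of_heq h
    rcases mem_stageCells_of_face hC hT hs ht (by
      rw [RelCWComplex.closure_openCell_eq_closedCell]
      exact RelCWComplex.cellFrontier_subset_closedCell _ _ hx) hl hj with h | h
    · exact Or.inl h
    · exact Or.inr (Or.inl h)

/-- The straightened characteristic map of the partner is the collapsing map. Freeness of `s` is
encoded in `F`: the smaller stage being a subcomplex means that no remaining cell needs `s`. -/
theorem elementaryCollapse_stage (hC : FaceCondition C) {n : ℕ}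
    {T : Set (RelCWComplex.cell C n)} (hTr : ∀ s ∈ T, V.IsRedundant n s)
    (hT : ∀ s ∈ T, ∀ s', V.Next n s s' → V.IsRedundant n s' → s' ∈ T)
    {s : RelCWComplex.cell C n} (hs : s ∈ T) {E F : RelCWComplex.Subcomplex C}
    (hE : ∀ m, E.I m = V.stageCells n T m) (hF : ∀ m, F.I m = V.stageCells n (T \ {s}) m) :
    ElementaryCollapse E F := by
  obtain ⟨t, ht⟩ := hTr s hs
  obtain ⟨φ, h1, h2, h3⟩ := (V.regular n s t ht).exists_charMap
  refine ⟨n, s, t, ?_, ?_, ?_, φ, h1, h2, ?_⟩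
  · rw [hF]
    rintro (h | ⟨s', hs', h⟩ | ⟨s', hs', t', ht', h⟩)
    · exact h.2 rfl ⟨t, ht⟩
    · obtain ⟨-, h⟩ := Sigma.mk.inj h
      exact hs'.2 (eq_of_heq h).symm
    · have := congrArg Sigma.fst h
      simp at this
  · rw [hF]
    rintro (h | ⟨s', hs', h⟩ | ⟨s', hs', t', ht', h⟩)
    · have := h.1
      omega
    · have := congrArg Sigma.fst h
      simp at this
    · obtain ⟨-, h⟩ := Sigma.mk.inj h
      rw [← eq_of_heq h] at ht'
      exact hs'.2 (V.injective n s' s t ht' ht)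
  · ext x
    simp only [mem_union, SetLike.mem_coe, mem_subcomplex_iff, hE, hF]
    constructor
    · rintro ⟨m, i, h | ⟨s', hs', h⟩ | ⟨s', hs', t', ht', h⟩, hx⟩
      · exact Or.inl (Or.inl ⟨m, i, Or.inl h, hx⟩)
      · obtain ⟨rfl, h⟩ := Sigma.mk.inj h
        obtain rfl := eq_of_heq h
        rcases eq_or_ne i s with rfl | hne
        · exact Or.inl (Or.inr hx)
        · exact Or.inl (Or.inl ⟨m, i, Or.inr (Or.inl ⟨i, ⟨hs', hne⟩, rfl⟩), hx⟩)
      · obtain ⟨rfl, h⟩ := Sigma.mk.inj h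
        obtain rfl := eq_of_heq h
        rcases eq_or_ne s' s with rfl | hne
        · rw [ht, Option.some_inj] at ht'
          exact Or.inr (ht' ▸ hx)
        · exact Or.inl (Or.inl ⟨_, i, Or.inr (Or.inr ⟨s', ⟨hs', hne⟩, i, ht', rfl⟩), hx⟩)
    · rintro ((⟨m, i, h | ⟨s', hs', h⟩ | ⟨s', hs', t', ht', h⟩, hx⟩ | hx) | hx)
      · exact ⟨m, i, Or.inl h, hx⟩
      · exact ⟨m, i, Or.inr (Or.inl ⟨s', hs'.1, h⟩), hx⟩
      · exact ⟨m, i, Or.inr (Or.inr ⟨s', hs'.1, t', ht', h⟩), hx⟩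
      · exact ⟨n, s, Or.inr (Or.inl ⟨s, hs, rfl⟩), hx⟩
      · exact ⟨n + 1, t, Or.inr (Or.inr ⟨s, hs, t, ht, rfl⟩), hx⟩
  -- The target is closed, so it suffices to treat the boundary without the bottom face, where the
  -- map avoids `s`; continuity covers the rim of the box.
  · have hsub : closure (sphere (0 : Fin (n + 1) → ℝ) 1 \ faceIncl n '' closedBall 0 1) ⊆
        closedBall 0 1 :=
      closure_minimal (sdiff_subset.trans sphere_subset_closedBall) isClosed_closedBall
    have hcl : IsClosed ((F : Set X) ∩ RelCWComplex.skeleton C n) :=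
      F.closed.inter (RelCWComplex.Subcomplex.closed _)
    rw [← hcl.closure_eq]
    refine MapsTo.closure_of_continuousOn ?_ (h1.continuousOn.mono hsub)
    rintro z ⟨hz, hz'⟩
    have hsk : φ z ∈ RelCWComplex.skeletonLT C ((n + 1 : ℕ) : ℕ∞) := h1.mapsTo hz
    refine ⟨?_, by exact_mod_cast hsk⟩
    obtain ⟨l, hl, j, hj⟩ := exists_openCell_of_mem_skeletonLT hsk
    rw [SetLike.mem_coe, mem_subcomplex_iff]
    refine ⟨l, j, ?_, hj⟩
    rw [hF]
    rcases mem_stageCells_of_face hC hT hs ht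
      (h1.mapsTo_closure (sphere_subset_closedBall hz)) hl hj with h | ⟨s', hs', h⟩
    · exact Or.inl h
    · refine Or.inr (Or.inl ⟨s', ⟨hs', fun hss => h3 z hz hz' ?_⟩, h⟩)
      rw [mem_singleton_iff] at hss
      subst hss
      obtain ⟨rfl, h⟩ := Sigma.mk.inj h
      rwa [← eq_of_heq h]

/-- Induction on the number of remaining pairs: deleting a source from `T` preserves closure under
successors. -/
theorem IsGradient.collapses_stage [CWComplex.Finite C] (hV : V.IsGradient) (hC : FaceCondition C)
    (n k : ℕ) : ∀ (T : Set (RelCWComplex.cell C n)), T.ncard = k →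
      (∀ s ∈ T, V.IsRedundant n s) →
      (∀ s ∈ T, ∀ s', V.Next n s s' → V.IsRedundant n s' → s' ∈ T) →
      ∀ E : RelCWComplex.Subcomplex C, (∀ m, E.I m = V.stageCells n T m) →
        Collapses E (V.X' n) := by
  have : Finite (RelCWComplex.cell C n) := CWComplex.FiniteType.finite_cell n
  induction k with
  | zero =>
    intro T hk _ _ E hE
    rw [ncard_eq_zero] at hk
    have : E = V.X' n := subcomplex_ext fun m => by rw [hE, hk, stageCells_empty]
    rw [this]
    exact Relation.ReflTransGen.refl
  | succ k ih =>
    intro T hk hTr hT E hE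
    obtain ⟨s, hs, hmin⟩ := hV.exists_source (nonempty_of_ncard_ne_zero (by omega : T.ncard ≠ 0))
    have hT' : ∀ s' ∈ T \ {s}, ∀ s'', V.Next n s' s'' → V.IsRedundant n s'' → s'' ∈ T \ {s} :=
      fun s' hs' s'' h hr => ⟨hT s' hs'.1 s'' h hr, fun he => hmin s' hs'.1 (he ▸ h)⟩
    obtain ⟨F, hF⟩ := exists_subcomplex_stage hC hT'
    refine Relation.ReflTransGen.head (elementaryCollapse_stage hC hTr hT hs hE hF)
      (ih (T \ {s}) ?_ (fun s' hs' => hTr s' hs'.1) hT' F hF)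
    rw [ncard_sdiff_singleton_of_mem hs, hk, Nat.add_sub_cancel]

theorem IsGradient.collapses_X'' [CWComplex.Finite C] (hV : V.IsGradient) (hC : FaceCondition C)
    (n : ℕ) : Collapses (V.X'' (n + 1)) (V.X' n) :=
  hV.collapses_stage hC n _ {s | V.IsRedundant n s} rfl (fun _ h => h) (fun _ _ _ _ h => h) _
    fun m => (stageCells_isRedundant n m).symm

/-! ### The filtration -/

theorem X''_zero : (V.X'' 0 : Set X) = ∅ := by
  refine eq_empty_of_forall_notMem fun x hx => ?_
  obtain ⟨m, i, hi, -⟩ := mem_subcomplex_iff.1 hx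
  obtain ⟨hm, h⟩ := mem_X''_I.1 hi
  obtain rfl : m = 0 := by omega
  exact h rfl

theorem X''_le_X' (n : ℕ) : V.X'' n ≤ V.X' n :=
  subcomplex_le fun _ _ hi => ⟨hi.1, fun h => (hi.2 h).1⟩

theorem X'_le_X'' (n : ℕ) : V.X' n ≤ V.X'' (n + 1) :=
  subcomplex_le fun m i hi => ⟨hi.1.trans n.le_succ, fun h => by have := hi.1; omega⟩

theorem exists_X'_eq [CWComplex.Finite C] : ∃ N, ∀ n, N ≤ n → (V.X' n : Set X) = C := by
  have : ∀ᶠ n in Filter.atTop, IsEmpty (RelCWComplex.cell C n) :=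
    RelCWComplex.FiniteDimensional.eventually_isEmpty_cell
  obtain ⟨N, hN⟩ := Filter.eventually_atTop.1 this
  refine ⟨N, fun n hn => subset_antisymm (RelCWComplex.Subcomplex.subset_complex _) fun x hx => ?_⟩
  rw [← CWComplex.iUnion_openCell_eq_complex (C := C)] at hx
  simp only [mem_iUnion] at hx
  obtain ⟨m, i, hx⟩ := hx
  have hm : m < N := by
    by_contra! h
    exact (hN m h).false i
  exact mem_subcomplex_iff.2 ⟨m, i, ⟨by omega, fun h => by omega⟩, hx⟩

theorem skeleton_top : (RelCWComplex.skeleton C ⊤ : Set X) = C := by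
  refine subset_antisymm (RelCWComplex.Subcomplex.subset_complex _) fun x hx => ?_
  rw [← CWComplex.iUnion_openCell_eq_complex (C := C)] at hx
  simp only [mem_iUnion] at hx
  obtain ⟨m, i, hx⟩ := hx
  exact CWComplex.mem_skeleton_iff.2 ⟨m, le_top, i, hx⟩

/-- Without critical cells above `k` the attaching steps there are trivial, `X'_(m+1) = X''_(m+1)`,
so the collapses can be concatenated. -/
theorem IsGradient.collapses_X' [CWComplex.Finite C] (hV : V.IsGradient) (hC : FaceCondition C)
    {k : ℕ} (hk : ∀ n, k < n → ∀ c, ¬ V.IsCritical n c) :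
    Collapses (RelCWComplex.skeleton C ⊤) (V.X' k) := by
  have key : ∀ m, k ≤ m → Collapses (V.X' m) (V.X' k) := by
    intro m hm
    induction m, hm using Nat.le_induction with
    | base => exact Relation.ReflTransGen.refl
    | succ m hm ih =>
      have : V.X' (m + 1) = V.X'' (m + 1) := subcomplex_ext fun l => by
        ext i
        refine ⟨fun hi => ⟨hi.1, fun h => ⟨hi.2 h, ?_⟩⟩, fun hi => ⟨hi.1, fun h => (hi.2 h).1⟩⟩
        exact hk l (by omega) i
      rw [this]
      exact (hV.collapses_X'' hC m).trans ih
  obtain ⟨N, hN⟩ := V.exists_X'_eq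
  have : RelCWComplex.skeleton C ⊤ = V.X' (max k N) := by
    rw [RelCWComplex.Subcomplex.eq_iff, skeleton_top, hN _ (le_max_right _ _)]
  rw [this]
  exact key _ (le_max_left _ _)

end VectorField

end

/-! ### Homotopy theory of attaching maps -/

section

/-! ### Strong deformation retracts -/

section StrongDeformationRetract

universe v w

variable {A : Type u} {B : Type v} {D : Type w} [TopologicalSpace A] [TopologicalSpace B]
  [TopologicalSpace D]

/-- `i` embeds `A` in `B` as a strong deformation retract. -/
def IsSDR (i : C(A, B)) : Prop :=
  ∃ (r : C(B, A)) (H : C(B × unitInterval, B)), (∀ a, r (i a) = a) ∧ (∀ b, H (b, 0) = b) ∧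
    (∀ b, H (b, 1) = i (r b)) ∧ ∀ a t, H (i a, t) = i a

/-- The subset `T` of `D` is a strong deformation retract of `D`. -/
def IsSDRSet (T : Set D) : Prop :=
  ∃ H : C(D × unitInterval, D), (∀ d, H (d, 0) = d) ∧ (∀ d, H (d, 1) ∈ T) ∧
    ∀ d ∈ T, ∀ t, H (d, t) = d

theorem IsSDR.homotopyEquiv {i : C(A, B)} (h : IsSDR i) :
    Nonempty (ContinuousMap.HomotopyEquiv A B) := by
  obtain ⟨r, H, h1, h2, h3, -⟩ := h
  refine ⟨⟨i, r, ?_, ?_⟩⟩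
  · have : r.comp i = ContinuousMap.id A := ContinuousMap.ext h1
    rw [this]
  · refine ContinuousMap.Homotopic.symm ⟨⟨⟨fun p => H (p.2, p.1), by fun_prop⟩, fun b => ?_,
      fun b => ?_⟩⟩
    · exact h2 b
    · exact h3 b

theorem IsSDR.of_homeomorph (e : A ≃ₜ B) : IsSDR (e : C(A, B)) :=
  ⟨(e.symm : C(B, A)), ⟨Prod.fst, continuous_fst⟩, e.symm_apply_apply, fun _ => rfl,
    fun b => (e.apply_symm_apply b).symm, fun _ _ => rfl⟩

theorem IsSDRSet.preimage_homeomorph {T : Set D} (h : IsSDRSet T) (e : A ≃ₜ D) :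
    IsSDRSet (e ⁻¹' T) := by
  obtain ⟨H, h1, h2, h3⟩ := h
  refine ⟨⟨fun p => e.symm (H (e p.1, p.2)), by fun_prop⟩, fun d => ?_, fun d => ?_,
    fun d hd t => ?_⟩
  · simp [h1]
  · simp [h2]
  · have := h3 (e d) hd t
    simp [this]

theorem IsSDRSet.preimage_snd {T : Set D} (h : IsSDRSet T) :
    IsSDRSet (Prod.snd ⁻¹' T : Set (A × D)) := by
  obtain ⟨H, h1, h2, h3⟩ := h
  refine ⟨⟨fun p => (p.1.1, H (p.1.2, p.2)), by fun_prop⟩, fun d => ?_, fun d => ?_,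
    fun d hd t => ?_⟩
  · simp [h1]
  · simp [h2]
  · have := h3 d.2 hd t
    simp [this]

theorem IsSDRSet.of_convex {W : Type*} [NormedAddCommGroup W] [NormedSpace ℝ W] {K T : Set W}
    (hK : Convex ℝ K) {r : W → W} (hr : ContinuousOn r K) (hrK : MapsTo r K K)
    (hrT : MapsTo r K T) (hfix : ∀ x ∈ K, x ∈ T → r x = x) :
    IsSDRSet (Subtype.val ⁻¹' T : Set K) := by
  have hc : Continuous fun p : K × unitInterval =>
      (1 - (p.2 : ℝ)) • (p.1 : W) + (p.2 : ℝ) • r p.1 := by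
    have : Continuous fun p : K × unitInterval => r p.1 :=
      hr.comp_continuous (by fun_prop) fun p => p.1.2
    exact ((continuous_const.sub (by fun_prop)).smul (by fun_prop)).add
      (Continuous.smul (by fun_prop) this)
  refine ⟨⟨fun p => ⟨_, hK p.1.2 (hrK p.1.2) (sub_nonneg.2 p.2.2.2) p.2.2.1 (by ring)⟩,
    hc.subtype_mk _⟩, fun d => ?_, fun d => ?_, fun d hd t => ?_⟩
  · apply Subtype.ext
    simp
  · have := hrT d.2
    simpa using this
  · apply Subtype.ext
    simp only [ContinuousMap.coe_mk, hfix d d.2 hd]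
    rw [← add_smul]
    simp

end StrongDeformationRetract

/-! ### Attaching spaces -/

section Attach

universe v w

variable {A : Type u} {D : Type v} {E : Type w} [TopologicalSpace A] [TopologicalSpace D]
  [TopologicalSpace E]

/-- `E` is obtained from `A` by attaching `D` along the map `f` from the subset `S` of `D`. -/
structure IsAttach (S : Set D) (f : C(S, A)) (a : C(A, E)) (Φ : C(D, E)) : Prop where
  isQuotientMap : IsQuotientMap (Sum.elim a Φ)
  apply_coe : ∀ s : S, Φ s = a (f s)
  injective : Function.Injective a
  injOn : InjOn Φ Sᶜ
  notMem_range : ∀ d ∉ S, Φ d ∉ range a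

namespace IsAttach

variable {S : Set D} {f : C(S, A)} {a : C(A, E)} {Φ : C(D, E)}

theorem exists_rep (h : IsAttach S f a Φ) (x : E) : (∃ y, a y = x) ∨ ∃ d ∉ S, Φ d = x := by
  obtain ⟨y | d, hy⟩ := h.isQuotientMap.surjective x
  · exact Or.inl ⟨y, hy⟩
  · by_cases hd : d ∈ S
    · exact Or.inl ⟨f ⟨d, hd⟩, (h.apply_coe ⟨d, hd⟩).symm.trans hy⟩
    · exact Or.inr ⟨d, hd, hy⟩

theorem apply_of_mem (h : IsAttach S f a Φ) {d : D} (hd : d ∈ S) : Φ d = a (f ⟨d, hd⟩) :=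
  h.apply_coe ⟨d, hd⟩

/-- This is the pushout property: the concrete injectivity conditions say that the quotient makes no
identifications beyond those forced by `f`. -/
theorem exists_desc {Z : Type*} [TopologicalSpace Z] (h : IsAttach S f a Φ) (g : C(A, Z))
    (k : C(D, Z)) (hgk : ∀ s : S, k s = g (f s)) :
    ∃ m : C(E, Z), (∀ x, m (a x) = g x) ∧ ∀ d, m (Φ d) = k d := by
  have key : ∀ x y : A ⊕ D, Sum.elim a Φ x = Sum.elim a Φ y → Sum.elim g k x = Sum.elim g k y := by
    have aux : ∀ (x : A) (d : D), a x = Φ d → g x = k d := fun x d hxd => by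
      by_cases hd : d ∈ S
      · rw [h.apply_of_mem hd] at hxd
        rw [h.injective hxd]
        exact (hgk ⟨d, hd⟩).symm
      · exact absurd ⟨x, hxd⟩ (h.notMem_range d hd)
    rintro (x | x) (y | y) hxy
    · exact congrArg g (h.injective hxy)
    · exact aux x y hxy
    · exact (aux y x hxy.symm).symm
    · by_cases hx : x ∈ S
      · have := h.apply_of_mem hx
        change Φ x = Φ y at hxy
        rw [this] at hxy
        exact (hgk ⟨x, hx⟩).trans (aux _ y hxy)
      · by_cases hy : y ∈ S
        · have := h.apply_of_mem hy
          change Φ x = Φ y at hxy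
          rw [this] at hxy
          exact ((hgk ⟨y, hy⟩).trans (aux _ x hxy.symm)).symm
        · exact congrArg k (h.injOn hx hy hxy)
  have hq : IsQuotientMap (⟨Sum.elim a Φ, by fun_prop⟩ : C(A ⊕ D, E)) := h.isQuotientMap
  refine ⟨hq.lift ⟨Sum.elim g k, by fun_prop⟩ fun x y hxy => key x y hxy, fun x => ?_,
    fun d => ?_⟩
  · exact congrArg (fun F : C(A ⊕ D, Z) => F (Sum.inl x))
      (hq.lift_comp ⟨Sum.elim g k, by fun_prop⟩ fun x y hxy => key x y hxy)
  · exact congrArg (fun F : C(A ⊕ D, Z) => F (Sum.inr d))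
      (hq.lift_comp ⟨Sum.elim g k, by fun_prop⟩ fun x y hxy => key x y hxy)

/-- Currying reduces this to the previous lemma with a mapping space as target; local compactness of
`I` allows uncurrying. It is how homotopies are defined on attached spaces. -/
theorem exists_desc_prod {Z I : Type*} [TopologicalSpace Z] [TopologicalSpace I]
    [LocallyCompactSpace I] (h : IsAttach S f a Φ)
    (g : C(A × I, Z)) (k : C(D × I, Z)) (hgk : ∀ (s : S) t, k (s, t) = g (f s, t)) :
    ∃ m : C(E × I, Z), (∀ x t, m (a x, t) = g (x, t)) ∧ ∀ d t, m (Φ d, t) = k (d, t) := by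
  obtain ⟨m, hm, hm'⟩ := h.exists_desc g.curry k.curry fun s => ContinuousMap.ext fun t => hgk s t
  refine ⟨⟨fun p => m p.1 p.2, by fun_prop⟩, fun x t => ?_, fun d t => ?_⟩
  · exact congrArg (fun F : C(I, Z) => F t) (hm x)
  · exact congrArg (fun F : C(I, Z) => F t) (hm' d)

theorem of_isClosedEmbedding [CompactSpace D] [T2Space E] (ha : IsClosedEmbedding a)
    (hf : ∀ s : S, Φ s = a (f s)) (hΦ : InjOn Φ Sᶜ) (hΦ' : ∀ d ∉ S, Φ d ∉ range a)
    (hE : ∀ x, x ∈ range a ∨ x ∈ range Φ) : IsAttach S f a Φ where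
  isQuotientMap := by
    refine IsClosedMap.isQuotientMap ?_ (by fun_prop) ?_
    · exact (IsClosedMap.sumElim ha.isClosedMap Φ.continuous.isClosedMap)
    · intro x
      rcases hE x with ⟨y, hy⟩ | ⟨d, hd⟩
      · exact ⟨Sum.inl y, hy⟩
      · exact ⟨Sum.inr d, hd⟩
  apply_coe := hf
  injective := ha.injective
  injOn := hΦ
  notMem_range := hΦ'

/-- The subset `S` of `D` being a strong deformation retract of `D`, so is `A` of `E`. -/
theorem isSDR (h : IsAttach S f a Φ) (hS : IsSDRSet S) : IsSDR a := by
  obtain ⟨H, h1, h2, h3⟩ := hS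
  obtain ⟨r, hr, hr'⟩ := h.exists_desc (ContinuousMap.id A)
    ⟨fun d => f ⟨H (d, 1), h2 d⟩, by fun_prop⟩ fun s =>
      congrArg f (Subtype.ext (h3 s s.2 1))
  obtain ⟨G, hG, hG'⟩ := h.exists_desc_prod (I := unitInterval) (Z := E)
    ⟨fun p => a p.1, by fun_prop⟩ (Φ.comp H) fun s t =>
      (congrArg Φ (h3 s s.2 t)).trans (h.apply_coe s)
  refine ⟨r, G, hr, fun b => ?_, fun b => ?_, hG⟩
  · rcases h.exists_rep b with ⟨y, rfl⟩ | ⟨d, -, rfl⟩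
    · exact hG y 0
    · rw [hG' d 0]
      exact congrArg Φ (h1 d)
  · rcases h.exists_rep b with ⟨y, rfl⟩ | ⟨d, -, rfl⟩
    · rw [hG y 1, hr]
      rfl
    · rw [hG' d 1, hr']
      exact h.apply_of_mem (h2 d)

/-- Attaching the same space to a strong deformation retract. -/
theorem exists_isSDR {M : Type*} {E' : Type*} [TopologicalSpace M] [TopologicalSpace E']
    {i : C(A, M)} {a' : C(M, E')} {Φ' : C(D, E')} (h : IsAttach S f a Φ)
    (h' : IsAttach S (i.comp f) a' Φ') (hi : IsSDR i) : ∃ j : C(E, E'), IsSDR j := by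
  obtain ⟨r, H, h1, h2, h3, h4⟩ := hi
  obtain ⟨j, hj, hj'⟩ := h.exists_desc (a'.comp i) Φ' h'.apply_coe
  obtain ⟨r', hr, hr'⟩ := h'.exists_desc (a.comp r) Φ fun s =>
    (h.apply_coe s).trans (congrArg a (h1 (f s)).symm)
  obtain ⟨G, hG, hG'⟩ := h'.exists_desc_prod (I := unitInterval) (Z := E') (a'.comp H)
    ⟨fun p => Φ' p.1, by fun_prop⟩ fun s t =>
      (h'.apply_coe s).trans (congrArg a' (h4 (f s) t).symm)
  refine ⟨j, r', G, fun x => ?_, fun x => ?_, fun x => ?_, fun x t => ?_⟩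
  · rcases h.exists_rep x with ⟨y, rfl⟩ | ⟨d, -, rfl⟩
    · rw [hj]
      exact (hr (i y)).trans (congrArg a (h1 y))
    · rw [hj', hr']
  · rcases h'.exists_rep x with ⟨y, rfl⟩ | ⟨d, -, rfl⟩
    · exact (hG y 0).trans (congrArg a' (h2 y))
    · exact hG' d 0
  · rcases h'.exists_rep x with ⟨y, rfl⟩ | ⟨d, -, rfl⟩
    · rw [hG, hr]
      exact (congrArg a' (h3 y)).trans (hj (r y)).symm
    · rw [hG', hr', hj']
      rfl
  · rcases h.exists_rep x with ⟨y, rfl⟩ | ⟨d, -, rfl⟩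
    · rw [hj]
      exact (hG (i y) t).trans (congrArg a' (h4 y t))
    · rw [hj', hG']
      rfl

/-- One end of the space obtained by attaching `D × [0, 1]` along a homotopy. -/
theorem exists_isSDR_of_homotopy {N : Type*} [TopologicalSpace N] (hS : IsClosed S)
    {e : unitInterval} (hT : IsSDRSet {p : D × unitInterval | p.1 ∈ S ∨ p.2 = e})
    {F : C(S × unitInterval, A)} (hF : ∀ s, F (s, e) = f s) {b : C(A, N)}
    {Ψ : C(D × unitInterval, N)} (h : IsAttach S f a Φ)
    (h' : IsAttach (Prod.fst ⁻¹' S : Set (D × unitInterval))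
      ⟨fun p => F (⟨p.1.1, p.2⟩, p.1.2), by fun_prop⟩ b Ψ) : ∃ j : C(E, N), IsSDR j := by
  classical
  obtain ⟨H, h1, h2, h3⟩ := hT
  obtain ⟨j, hj, hj'⟩ := h.exists_desc b ⟨fun d => Ψ (d, e), by fun_prop⟩ fun s => by
    have := h'.apply_of_mem (d := ((s : D), e)) s.2
    exact this.trans (congrArg b (hF s))
  -- Only the values on `S × I ∪ D × {e}` matter. There `q` lifts `Ψ` through `j`, and retracting
  -- the cylinder onto that set before applying `q` gives the retraction of `N` to `E`.
  let q : D × unitInterval → E := fun p =>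
    if hp : p.1 ∈ S then a (F (⟨p.1, hp⟩, p.2)) else Φ p.1
  have q1 : ∀ p, (hp : p.1 ∈ S) → q p = a (F (⟨p.1, hp⟩, p.2)) := fun p hp => dif_pos hp
  have q2 : ∀ p, p.2 = e → q p = Φ p.1 := fun p hp => by
    by_cases hpS : p.1 ∈ S
    · rw [q1 p hpS, hp, hF]
      exact (h.apply_of_mem hpS).symm
    · exact dif_neg hpS
  have hq : ContinuousOn q {p | p.1 ∈ S ∨ p.2 = e} := by
    have e1 : {p : D × unitInterval | p.1 ∈ S ∨ p.2 = e} = Prod.fst ⁻¹' S ∪ Prod.snd ⁻¹' {e} := rfl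
    rw [e1]
    refine ContinuousOn.union_of_isClosed ?_ ?_ (hS.preimage continuous_fst)
      (isClosed_singleton.preimage continuous_snd)
    · rw [continuousOn_iff_continuous_domRestrict]
      have : Continuous fun p : (Prod.fst ⁻¹' S : Set (D × unitInterval)) =>
        a (F (⟨p.1.1, p.2⟩, p.1.2)) := by fun_prop
      exact this.congr fun p => (q1 p.1 p.2).symm
    · exact (Φ.continuous.comp continuous_fst).continuousOn.congr fun p hp => q2 p hp
  have hjq : ∀ p : D × unitInterval, p.1 ∈ S ∨ p.2 = e → j (q p) = Ψ p := by
    rintro p (hp | hp)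
    · rw [q1 p hp, hj]
      exact (h'.apply_of_mem (d := p) hp).symm
    · rw [q2 p hp, hj', ← hp]
      rfl
  obtain ⟨r, hr, hr'⟩ := h'.exists_desc a ⟨fun p => q (H (p, 1)),
    hq.comp_continuous (by fun_prop) h2⟩ fun s => by
      change q (H (s, 1)) = _
      rw [h3 s (Or.inl s.2), q1 _ s.2]
      rfl
  obtain ⟨G, hG, hG'⟩ := h'.exists_desc_prod (I := unitInterval) (Z := N)
    ⟨fun p => b p.1, by fun_prop⟩ (Ψ.comp H) fun s t =>
      (congrArg Ψ (h3 s (Or.inl s.2) t)).trans (h'.apply_coe s)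
  refine ⟨j, r, G, fun x => ?_, fun x => ?_, fun x => ?_, fun x t => ?_⟩
  · rcases h.exists_rep x with ⟨y, rfl⟩ | ⟨d, -, rfl⟩
    · rw [hj, hr]
    · rw [hj']
      change r (Ψ (d, e)) = _
      rw [hr']
      change q (H ((d, e), 1)) = _
      rw [h3 _ (Or.inr rfl), q2 _ rfl]
  · rcases h'.exists_rep x with ⟨y, rfl⟩ | ⟨d, -, rfl⟩
    · exact hG y 0
    · exact (hG' d 0).trans (congrArg Ψ (h1 d))
  · rcases h'.exists_rep x with ⟨y, rfl⟩ | ⟨d, -, rfl⟩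
    · rw [hG, hr, hj]
      rfl
    · rw [hG', hr']
      exact (hjq _ (h2 d)).symm
  · rcases h.exists_rep x with ⟨y, rfl⟩ | ⟨d, -, rfl⟩
    · rw [hj, hG]
      rfl
    · have hΦd : j (Φ d) = Ψ (d, e) := hj' d
      rw [hΦd]
      exact (hG' (d, e) t).trans (congrArg Ψ (h3 _ (Or.inr rfl) t))

/-- Two spaces obtained by attaching along the same map are homeomorphic. -/
theorem exists_homeomorph {E' : Type*} [TopologicalSpace E'] {a' : C(A, E')} {Φ' : C(D, E')}
    (h : IsAttach S f a Φ) (h' : IsAttach S f a' Φ') : Nonempty (E ≃ₜ E') := by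
  obtain ⟨j, hj, hj'⟩ := h.exists_desc a' Φ' h'.apply_coe
  obtain ⟨k, hk, hk'⟩ := h'.exists_desc a Φ h.apply_coe
  refine ⟨⟨⟨j, k, fun x => ?_, fun x => ?_⟩, j.continuous, k.continuous⟩⟩
  · rcases h.exists_rep x with ⟨y, rfl⟩ | ⟨d, -, rfl⟩
    · rw [hj, hk]
    · rw [hj', hk']
  · rcases h'.exists_rep x with ⟨y, rfl⟩ | ⟨d, -, rfl⟩
    · rw [hk, hj]
    · rw [hk', hj']

open Classical in
/-- The normal form of a point in the disjoint union, from which a space is glued. -/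
def normalForm (S : Set D) (f : C(S, A)) : A ⊕ D → A ⊕ D
  | Sum.inl x => Sum.inl x
  | Sum.inr d => if hd : d ∈ S then Sum.inl (f ⟨d, hd⟩) else Sum.inr d

theorem exists_isAttach (S : Set D) (f : C(S, A)) :
    ∃ (E : Type (max u v)) (_ : TopologicalSpace E) (a : C(A, E)) (Φ : C(D, E)),
      IsAttach S f a Φ := by
  let R : Setoid (A ⊕ D) := Setoid.ker (normalForm S f)
  have hR : ∀ x y : A ⊕ D, (Quotient.mk R x = Quotient.mk R y) ↔
      normalForm S f x = normalForm S f y := fun x y => Quotient.eq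
  have hc : Continuous (Quotient.mk R) := continuous_quotient_mk'
  have hn : ∀ d ∉ S, normalForm S f (Sum.inr d) = Sum.inr d := fun d hd => dif_neg hd
  refine ⟨Quotient R, inferInstance, ⟨fun x => Quotient.mk R (Sum.inl x), by fun_prop⟩,
    ⟨fun x => Quotient.mk R (Sum.inr x), by fun_prop⟩, ?_, fun s => ?_, fun x y hxy => ?_,
    fun x hx y hy hxy => ?_, ?_⟩
  · have : Sum.elim (fun x => Quotient.mk R (Sum.inl x)) (fun x => Quotient.mk R (Sum.inr x)) =
        Quotient.mk R := by
      ext (x | x) <;> rfl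
    simp only [ContinuousMap.coe_mk, this]
    exact isQuotientMap_quot_mk
  · exact (hR _ _).2 (dif_pos s.2)
  · exact Sum.inl_injective ((hR _ _).1 hxy)
  · have := (hR _ _).1 hxy
    rw [hn x hx, hn y hy] at this
    exact Sum.inr_injective this
  · rintro d hd ⟨x, hx⟩
    have := (hR _ _).1 hx
    rw [hn d hd] at this
    exact Sum.inl_ne_inr this

end IsAttach

end Attach

/-! ### Deformation equivalence -/

section DeformEquiv

/-- The equivalence relation generated by strong deformation retracts. -/
def DeformEquiv : TopCat.{u} → TopCat.{u} → Prop :=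
  Relation.EqvGen fun A B => ∃ i : C(A, B), IsSDR i

theorem IsSDR.deformEquiv {A B : Type u} [TopologicalSpace A] [TopologicalSpace B] {i : C(A, B)}
    (h : IsSDR i) : DeformEquiv (TopCat.of A) (TopCat.of B) :=
  Relation.EqvGen.rel _ _ ⟨i, h⟩

theorem DeformEquiv.homotopyEquiv {A B : TopCat.{u}} (h : DeformEquiv A B) :
    Nonempty (ContinuousMap.HomotopyEquiv A B) := by
  induction h with
  | rel A B h => exact h.choose_spec.homotopyEquiv
  | refl A => exact ⟨ContinuousMap.HomotopyEquiv.refl A⟩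
  | symm A B _ ih => exact ih.map ContinuousMap.HomotopyEquiv.symm
  | trans A B C _ _ ih ih' => exact ⟨ih.some.trans ih'.some⟩

theorem DeformEquiv.of_homeomorph {A B : Type u} [TopologicalSpace A] [TopologicalSpace B]
    (e : A ≃ₜ B) : DeformEquiv (TopCat.of A) (TopCat.of B) :=
  (IsSDR.of_homeomorph e).deformEquiv

variable {D : Type u} [TopologicalSpace D] {S : Set D}

/-- Attaching along `f` and along `f'` yields deformation equivalent spaces. -/
def AttachEquiv {A B : TopCat.{u}} (f : C(S, A)) (f' : C(S, B)) : Prop :=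
  ∀ (E E' : TopCat.{u}) (a : C(A, E)) (Φ : C(D, E)) (a' : C(B, E')) (Φ' : C(D, E')),
    IsAttach S f a Φ → IsAttach S f' a' Φ' → DeformEquiv E E'

theorem AttachEquiv.symm {A B : TopCat.{u}} {f : C(S, A)} {f' : C(S, B)} (h : AttachEquiv f f') :
    AttachEquiv f' f := fun E E' a Φ a' Φ' hE hE' => (h E' E a' Φ' a Φ hE' hE).symm

theorem AttachEquiv.trans {A B M : TopCat.{u}} {f : C(S, A)} {f' : C(S, B)} {f'' : C(S, M)}
    (h : AttachEquiv f f') (h' : AttachEquiv f' f'') : AttachEquiv f f'' := by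
  intro E E' a Φ a' Φ' hE hE'
  obtain ⟨N, _, b, Ψ, hN⟩ := IsAttach.exists_isAttach S f'
  exact (h E (TopCat.of N) a Φ b Ψ hE hN).trans _ _ _ (h' (TopCat.of N) E' b Ψ a' Φ' hN hE')

theorem AttachEquiv.refl {A : TopCat.{u}} (f : C(S, A)) : AttachEquiv f f :=
  fun _ _ _ _ _ _ hE hE' => DeformEquiv.of_homeomorph (hE.exists_homeomorph hE').some

theorem attachEquiv_comp {A B : TopCat.{u}} (f : C(S, A)) {i : C(A, B)} (hi : IsSDR i) :
    AttachEquiv f (i.comp f) := by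
  intro E E' a Φ a' Φ' hE hE'
  obtain ⟨j, hj⟩ := hE.exists_isSDR hE' hi
  exact hj.deformEquiv

/-- The condition on a pair of spaces that makes the homotopy type of the result of attaching the
first of them along the second depend on the homotopy class of the attaching map only. -/
def IsCofibrantPair (S : Set D) : Prop :=
  IsClosed S ∧ ∀ e : unitInterval, e = 0 ∨ e = 1 →
    IsSDRSet {p : D × unitInterval | p.1 ∈ S ∨ p.2 = e}

/-- Both results are strong deformation retracts of the space obtained by attaching `D × I` along
the homotopy, one for each end of the interval. -/
theorem attachEquiv_of_homotopy (hS : IsCofibrantPair S) {A : TopCat.{u}} {f f' : C(S, A)}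
    (F : C(S × unitInterval, A)) (h0 : ∀ s, F (s, 0) = f s) (h1 : ∀ s, F (s, 1) = f' s) :
    AttachEquiv f f' := by
  intro E E' a Φ a' Φ' hE hE'
  let F' : C((Prod.fst ⁻¹' S : Set (D × unitInterval)), A) :=
    ⟨fun p => F (⟨p.1.1, p.2⟩, p.1.2), by fun_prop⟩
  obtain ⟨N, _, b, Ψ, hN⟩ := IsAttach.exists_isAttach _ F'
  obtain ⟨j, hj⟩ := hE.exists_isSDR_of_homotopy hS.1 (hS.2 0 (Or.inl rfl)) h0 hN
  obtain ⟨j', hj'⟩ := hE'.exists_isSDR_of_homotopy hS.1 (hS.2 1 (Or.inr rfl)) h1 hN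
  exact hj.deformEquiv.trans _ (TopCat.of N) _ hj'.deformEquiv.symm

/-- Along an inclusion `i` an attaching map is composed with `i`; against it, with the retraction
`r`, using that `i ∘ r` is homotopic to the identity. Proving both directions together lets the
induction pass through reversed steps of a zigzag. -/
theorem DeformEquiv.exists_attachEquiv (hS : IsCofibrantPair S) {A B : TopCat.{u}}
    (h : DeformEquiv A B) : (∀ f : C(S, A), ∃ f' : C(S, B), AttachEquiv f f') ∧
      ∀ f' : C(S, B), ∃ f : C(S, A), AttachEquiv f f' := by
  induction h with
  | rel A B h =>
    obtain ⟨i, hi⟩ := h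
    refine ⟨fun f => ⟨i.comp f, attachEquiv_comp f hi⟩, fun f' => ?_⟩
    obtain ⟨r, H, h1, h2, h3, h4⟩ := id hi
    exact ⟨r.comp f', (attachEquiv_comp (r.comp f') hi).trans
      (attachEquiv_of_homotopy hS ⟨fun p => H (f' p.1, p.2), by fun_prop⟩ (fun s => h2 (f' s))
        (fun s => h3 (f' s))).symm⟩
  | refl A => exact ⟨fun f => ⟨f, AttachEquiv.refl f⟩, fun f => ⟨f, AttachEquiv.refl f⟩⟩
  | symm A B _ ih => exact ⟨fun f => (ih.2 f).imp fun _ h => h.symm,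
      fun f => (ih.1 f).imp fun _ h => h.symm⟩
  | trans A B M _ _ ih ih' =>
    refine ⟨fun f => ?_, fun f => ?_⟩
    · obtain ⟨f', hf'⟩ := ih.1 f
      obtain ⟨f'', hf''⟩ := ih'.1 f'
      exact ⟨f'', hf'.trans hf''⟩
    · obtain ⟨f', hf'⟩ := ih'.2 f
      obtain ⟨f'', hf''⟩ := ih.2 f'
      exact ⟨f'', hf''.trans hf'⟩

end DeformEquiv

/-! ### Balls, spheres and boxes -/

section Ball

variable {W : Type*} [NormedAddCommGroup W] [NormedSpace ℝ W]

/-- The retraction is the projection from the point `(0, 2)` above the cylinder. The maximum in its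
formula decides whether the ray meets the side or the bottom first. -/
theorem isSDRSet_cylinder : IsSDRSet (Subtype.val ⁻¹' {p : W × ℝ | ‖p.1‖ = 1 ∨ p.2 = 0} :
    Set (closedBall (0 : W) 1 ×ˢ Icc (0 : ℝ) 1)) := by
  have hM : ∀ p ∈ closedBall (0 : W) 1 ×ˢ Icc (0 : ℝ) 1,
      0 < max ‖p.1‖ ((2 - p.2) / 2) := fun p hp => by
    have := hp.2.2
    exact lt_max_of_lt_right (by linarith)
  have hcM : Continuous fun p : W × ℝ => max ‖p.1‖ ((2 - p.2) / 2) := by fun_prop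
  refine IsSDRSet.of_convex ((convex_closedBall _ _).prod (convex_Icc _ _))
    (r := fun p => ((max ‖p.1‖ ((2 - p.2) / 2))⁻¹ • p.1,
      2 - (2 - p.2) / max ‖p.1‖ ((2 - p.2) / 2))) ?_ ?_ ?_ ?_
  · have h1 := hcM.continuousOn.inv₀ fun p hp => (hM p hp).ne'
    refine (h1.smul continuousOn_fst).prodMk (continuousOn_const.sub ?_)
    exact ContinuousOn.div (by fun_prop) hcM.continuousOn fun p hp => (hM p hp).ne'
  · rintro ⟨x, t⟩ hp
    have h0 := hM _ hp
    obtain ⟨hx, ht0, ht1⟩ := hp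
    simp only [mem_closedBall_zero_iff] at hx ht0 ht1
    simp only at h0
    refine ⟨?_, ?_, ?_⟩
    · rw [mem_closedBall_zero_iff, norm_smul, norm_inv, Real.norm_of_nonneg h0.le,
        inv_mul_le_iff₀ h0, mul_one]
      exact le_max_left _ _
    · have : (2 - t) / max ‖x‖ ((2 - t) / 2) ≤ 2 := by
        rw [div_le_iff₀ h0]
        linarith [le_max_right ‖x‖ ((2 - t) / 2)]
      simpa using this
    · have : 1 ≤ (2 - t) / max ‖x‖ ((2 - t) / 2) := by
        rw [le_div_iff₀ h0, one_mul, max_le_iff]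
        constructor <;> linarith
      simp only
      linarith
  · rintro ⟨x, t⟩ hp
    have h0 := hM _ hp
    rcases max_choice ‖x‖ ((2 - t) / 2) with h | h
    · left
      simp only [h] at h0 ⊢
      rw [norm_smul, norm_inv, norm_norm, inv_mul_cancel₀ h0.ne']
    · right
      simp only [h] at h0 ⊢
      have h2 : (2 - t) / ((2 - t) / 2) = 2 := by
        rw [div_eq_iff h0.ne']
        ring
      rw [h2, sub_self]
  · rintro ⟨x, t⟩ ⟨hx, ht0, ht1⟩ hp
    simp only [mem_closedBall_zero_iff] at hx ht0 ht1
    have hm : max ‖x‖ ((2 - t) / 2) = 1 := by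
      rcases hp with hp | hp
      · simp only at hp
        rw [hp]
        exact max_eq_left (by linarith)
      · simp only at hp
        rw [hp]
        norm_num [hx]
    simp only [hm]
    simp

/-- A disjoint union of balls and the union of their boundaries. -/
theorem isCofibrantPair_ball {ι : Type u} [TopologicalSpace ι] :
    IsCofibrantPair {p : ι × closedBall (0 : W) 1 | ‖(p.2 : W)‖ = 1} := by
  refine ⟨isClosed_eq (by fun_prop) continuous_const, ?_⟩
  have key : IsSDRSet {p : (ι × closedBall (0 : W) 1) × unitInterval |
      ‖(p.1.2 : W)‖ = 1 ∨ p.2 = 0} := by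
    let e : (ι × closedBall (0 : W) 1) × unitInterval ≃ₜ
        ι × ↥(closedBall (0 : W) 1 ×ˢ Icc (0 : ℝ) 1) :=
      { toFun := fun p => (p.1.1, ⟨(p.1.2, p.2), p.1.2.2, p.2.2⟩)
        invFun := fun p => ((p.1, ⟨p.2.1.1, p.2.2.1⟩), ⟨p.2.1.2, p.2.2.2⟩)
        left_inv := fun _ => rfl
        right_inv := fun _ => rfl
        continuous_toFun := by fun_prop
        continuous_invFun := by fun_prop }
    convert (isSDRSet_cylinder (W := W)).preimage_snd.preimage_homeomorph e using 1
    ext p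
    exact or_congr Iff.rfl Subtype.ext_iff
  rintro t (rfl | rfl)
  · exact key
  · let e : (ι × closedBall (0 : W) 1) × unitInterval ≃ₜ (ι × closedBall (0 : W) 1) × unitInterval :=
      (Homeomorph.refl _).prodCongr unitInterval.symmHomeomorph
    convert key.preimage_homeomorph e using 1
    ext p
    refine or_congr Iff.rfl ?_
    change p.2 = 1 ↔ unitInterval.symm p.2 = 0
    exact unitInterval.symm_eq_zero.symm

theorem mem_openBox_of {n : ℕ} {z : Fin (n + 1) → ℝ} (hz : ‖z‖ ≤ 1)
    (h : ‖Fin.init z‖ = 1 ∨ z (Fin.last n) = 1) : z ∈ openBox n := by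
  rw [norm_eq_max, max_le_iff] at hz
  have key : ∀ t : ℝ, -1 < t → t ≤ 1 → (‖Fin.init z‖ = 1 ∨ t = 1) →
      (Fin.snoc (α := fun _ => ℝ) (Fin.init z) t : Fin (n + 1) → ℝ) ∈
        sphere 0 1 \ faceIncl n '' closedBall 0 1 := fun t ht ht' h => by
    refine ⟨?_, ?_⟩
    · rw [mem_sphere_zero_iff_norm, norm_snoc]
      rcases h with h | h
      · rw [h]
        exact max_eq_left (abs_le.2 ⟨ht.le, ht'⟩)
      · rw [h, abs_one]
        exact max_eq_right hz.1
    · rintro ⟨y, -, hy⟩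
      have := congrFun hy (Fin.last n)
      simp only [faceIncl, Fin.snoc_last] at this
      linarith
  have hl := abs_le.1 hz.2
  rcases h with h | h
  · rw [← snoc_eq n z]
    -- The rim of the bottom face belongs to the box only as a limit of points of the sides.
    have hmem : z (Fin.last n) ∈ closure (Ioc (-1 : ℝ) 1) := by
      rw [closure_Ioc (by norm_num)]
      exact hl
    exact map_mem_closure ((continuous_snoc n).comp
      ((continuous_const (y := (Fin.init z : Fin n → ℝ))).prodMk continuous_id)) hmem fun t ht =>
        key t ht.1 ht.2 (Or.inl h)
  · rw [← snoc_eq n z, h]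
    exact subset_closure (key 1 (by norm_num) le_rfl (Or.inr rfl))

theorem mem_openBox_imp {n : ℕ} {z : Fin (n + 1) → ℝ} (hz : z ∈ openBox n) :
    ‖z‖ = 1 ∧ (‖Fin.init z‖ = 1 ∨ z (Fin.last n) = 1) := by
  have hcl : IsClosed {z : Fin (n + 1) → ℝ | ‖z‖ = 1 ∧
      (‖Fin.init z‖ = 1 ∨ z (Fin.last n) = 1)} :=
    (isClosed_eq continuous_norm continuous_const).inter
      ((isClosed_eq (continuous_init n).norm continuous_const).union
        (isClosed_eq (continuous_apply _) continuous_const))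
  refine closure_minimal (fun y hy => ?_) hcl hz
  have h1 := mem_sphere_zero_iff_norm.1 hy.1
  refine ⟨h1, ?_⟩
  rw [norm_eq_max] at h1
  by_contra! h
  have h2 : ‖Fin.init y‖ < 1 := lt_of_le_of_ne (h1 ▸ le_max_left _ _) h.1
  rw [max_eq_iff] at h1
  have h3 : |y (Fin.last n)| = 1 := by
    rcases h1 with h1 | h1
    · exact absurd h1.1 h.1
    · exact h1.1
  rcases eq_or_eq_neg_of_abs_eq h3 with h3 | h3
  · exact h.2 h3
  · refine hy.2 ⟨Fin.init y, mem_closedBall_zero_iff.2 h2.le, ?_⟩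
    conv_rhs => rw [← snoc_eq n y, h3]
    rfl

/-- The retraction is the projection from the point with last coordinate `-3` below the centre of
the bottom face. Dividing by `M` scales each ray until it meets a side or the top. -/
theorem isSDRSet_openBox (n : ℕ) :
    IsSDRSet (Subtype.val ⁻¹' openBox n : Set (closedBall (0 : Fin (n + 1) → ℝ) 1)) := by
  let M : (Fin (n + 1) → ℝ) → ℝ := fun z => max ‖Fin.init z‖ ((z (Fin.last n) + 3) / 4)
  have hcM : Continuous M := (continuous_init n).norm.max (by fun_prop)
  have hz : ∀ z ∈ closedBall (0 : Fin (n + 1) → ℝ) 1, ‖Fin.init z‖ ≤ 1 ∧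
      -1 ≤ z (Fin.last n) ∧ z (Fin.last n) ≤ 1 := fun z hz => by
    rw [mem_closedBall_zero_iff, norm_eq_max, max_le_iff] at hz
    exact ⟨hz.1, abs_le.1 hz.2⟩
  have hM : ∀ z ∈ closedBall (0 : Fin (n + 1) → ℝ) 1, 0 < M z := fun z h =>
    lt_max_of_lt_right (by linarith [(hz z h).2.1])
  let r : (Fin (n + 1) → ℝ) → Fin (n + 1) → ℝ := fun z =>
    Fin.snoc (α := fun _ => ℝ) ((M z)⁻¹ • Fin.init z) (-3 + (z (Fin.last n) + 3) / M z)
  have hrK : MapsTo r (closedBall 0 1) (closedBall 0 1) := fun z h => by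
    obtain ⟨h1, h2, h3⟩ := hz z h
    have h0 := hM z h
    rw [mem_closedBall_zero_iff, norm_snoc, max_le_iff]
    constructor
    · rw [norm_smul, norm_inv, Real.norm_of_nonneg h0.le, inv_mul_le_iff₀ h0, mul_one]
      exact le_max_left _ _
    · rw [abs_le]
      have h4 : 2 ≤ (z (Fin.last n) + 3) / M z := by
        rw [le_div_iff₀ h0]
        have : M z ≤ (z (Fin.last n) + 3) / 2 := max_le (by linarith) (by linarith)
        linarith
      have h5 : (z (Fin.last n) + 3) / M z ≤ 4 := by
        rw [div_le_iff₀ h0]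
        have : (z (Fin.last n) + 3) / 4 ≤ M z := le_max_right _ _
        linarith
      constructor <;> linarith
  refine IsSDRSet.of_convex (convex_closedBall _ _) (r := r) ?_ hrK ?_ ?_
  · refine (continuous_snoc n).comp_continuousOn (ContinuousOn.prodMk
      (ContinuousOn.smul (hcM.continuousOn.inv₀ fun z h => (hM z h).ne')
        (continuous_init n).continuousOn) (continuousOn_const.add
          (ContinuousOn.div (by fun_prop) hcM.continuousOn fun z h => (hM z h).ne')))
  · intro z h
    have h0 := hM z h
    refine mem_openBox_of (mem_closedBall_zero_iff.1 (hrK h)) ?_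
    simp only [r, Fin.init_snoc, Fin.snoc_last]
    rcases max_choice ‖Fin.init z‖ ((z (Fin.last n) + 3) / 4) with h1 | h1
    · left
      change M z = _ at h1
      rw [norm_smul, norm_inv, Real.norm_of_nonneg h0.le, ← h1, inv_mul_cancel₀ h0.ne']
    · right
      change M z = _ at h1
      have h2 : z (Fin.last n) + 3 = 4 * M z := by rw [h1]; ring
      rw [h2, mul_div_assoc, div_self h0.ne']
      norm_num
  · intro z h h1
    obtain ⟨h2, h3, h4⟩ := hz z h
    have hm : M z = 1 := by
      rcases (mem_openBox_imp h1).2 with h1 | h1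
      · change max _ _ = _
        rw [h1]
        exact max_eq_left (by linarith)
      · change max _ _ = _
        rw [h1]
        norm_num [h2]
    simp only [r, hm]
    conv_rhs => rw [← snoc_eq n z]
    simp

end Ball

end

/-! ### Collapses as deformations and critical cells as attachments -/

section

variable {X : Type u} [TopologicalSpace X] [T2Space X] {C : Set X} [CWComplex C]

/-! ### Collapses are deformation equivalences -/

section Collapse

variable {E F : RelCWComplex.Subcomplex C}

theorem isClosedEmbedding_incl {A B : Set X} (h : A ⊆ B) (hA : IsClosed A) :
    IsClosedEmbedding (incl h) :=
  IsClosedEmbedding.inclusion h (hA.preimage continuous_subtype_val)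

theorem mem_range_incl {A B : Set X} {h : A ⊆ B} {x : B} : x ∈ range (incl h) ↔ (x : X) ∈ A := by
  constructor
  · rintro ⟨y, rfl⟩
    exact y.2
  · exact fun hx => ⟨⟨x, hx⟩, rfl⟩

theorem ElementaryCollapse.subset (h : ElementaryCollapse E F) : (F : Set X) ⊆ E := by
  obtain ⟨n, s, t, -, -, hE, -⟩ := h
  rw [hE]
  exact subset_union_left.trans subset_union_left

theorem norm_eq_one_cases {n : ℕ} {z : Fin (n + 1) → ℝ} (hz : ‖z‖ ≤ 1) (h : z ∉ openBox n) :
    z ∈ ball (0 : Fin (n + 1) → ℝ) 1 ∨ ∃ y ∈ ball (0 : Fin n → ℝ) 1, faceIncl n y = z := by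
  rcases hz.lt_or_eq with hz' | hz'
  · exact Or.inl (mem_ball_zero_iff.2 hz')
  right
  have h1 : ¬ (‖Fin.init z‖ = 1 ∨ z (Fin.last n) = 1) := fun h1 => h (mem_openBox_of hz h1)
  push Not at h1
  rw [norm_eq_max] at hz'
  have h2 : ‖Fin.init z‖ < 1 := lt_of_le_of_ne (hz' ▸ le_max_left _ _) h1.1
  have h3 : |z (Fin.last n)| = 1 := by
    rcases (max_eq_iff.1 hz') with h3 | h3
    · exact absurd h3.1 h1.1
    · exact h3.1
  rcases eq_or_eq_neg_of_abs_eq h3 with h3 | h3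
  · exact absurd h3 h1.2
  · refine ⟨Fin.init z, mem_ball_zero_iff.2 h2, ?_⟩
    conv_rhs => rw [← snoc_eq n z, h3]
    rfl

/-- `E` is `F` with a cube attached along the box: off the box the collapsing map is injective, with
the interior going to `t` and the open bottom face to `s`. The box is a strong deformation retract
of the cube. -/
theorem ElementaryCollapse.isSDR (h : ElementaryCollapse E F) : IsSDR (incl h.subset) := by
  obtain ⟨n, s, t, hs, ht, hE, φ, h1, h2, h3⟩ := id h
  have hsd : ∀ x ∈ RelCWComplex.openCell n s, x ∉ F := fun x hx hxF => hs (mem_I_of_mem hxF hx)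
  have htd : ∀ x ∈ RelCWComplex.openCell (n + 1) t, x ∉ F :=
    fun x hx hxF => ht (mem_I_of_mem hxF hx)
  have hb : ∀ z ∈ ball (0 : Fin (n + 1) → ℝ) 1, φ z ∈ RelCWComplex.openCell (n + 1) t :=
    fun z hz => h1.image_ball ▸ mem_image_of_mem φ hz
  have hf : ∀ y ∈ ball (0 : Fin n → ℝ) 1, φ (faceIncl n y) ∈ RelCWComplex.openCell n s :=
    fun y hy => h2.image_ball ▸ mem_image_of_mem (φ ∘ faceIncl n) hy
  have hst : ∀ x ∈ RelCWComplex.openCell n s, x ∉ RelCWComplex.openCell (n + 1) t :=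
    fun x hx hx' => by
      have := congrArg Sigma.fst (cell_eq_of_mem hx hx')
      simp at this
  have hφE : ∀ z : closedBall (0 : Fin (n + 1) → ℝ) 1, φ z ∈ (E : Set X) := fun z => by
    rw [hE]
    by_cases hz : (z : Fin (n + 1) → ℝ) ∈ openBox n
    · exact Or.inl (Or.inl (h3 hz).1)
    · rcases norm_eq_one_cases (mem_closedBall_zero_iff.1 z.2) hz with h | ⟨y, hy, hyz⟩
      · exact Or.inr (hb _ h)
      · rw [← hyz]
        exact Or.inl (Or.inr (hf y hy))
  have hφc : Continuous fun z : closedBall (0 : Fin (n + 1) → ℝ) 1 => φ z :=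
    continuousOn_iff_continuous_domRestrict.1 h1.continuousOn
  let f : C((Subtype.val ⁻¹' openBox n : Set (closedBall (0 : Fin (n + 1) → ℝ) 1)), (F : Set X)) :=
    ⟨fun z => ⟨φ z, (h3 z.2).1⟩, (hφc.comp continuous_subtype_val).subtype_mk _⟩
  refine IsAttach.isSDR (S := Subtype.val ⁻¹' openBox n) (f := f)
    (Φ := ⟨fun z => ⟨φ z, hφE z⟩, hφc.subtype_mk _⟩) ?_ (isSDRSet_openBox n)
  refine IsAttach.of_isClosedEmbedding (isClosedEmbedding_incl h.subset F.closed) (fun _ => rfl)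
    ?_ ?_ ?_
  · intro z hz z' hz' hzz
    have hzz : φ z = φ z' := congrArg Subtype.val hzz
    rcases norm_eq_one_cases (mem_closedBall_zero_iff.1 z.2) hz with h | ⟨y, hy, hyz⟩ <;>
    rcases norm_eq_one_cases (mem_closedBall_zero_iff.1 z'.2) hz' with h' | ⟨y', hy', hyz'⟩
    · exact Subtype.ext (h1.injOn_ball h h' hzz)
    · rw [← hyz'] at hzz
      exact absurd (hzz ▸ hb _ h) (hst _ (hf _ hy'))
    · rw [← hyz] at hzz
      exact absurd (hzz ▸ hb _ h') (hst _ (hf _ hy))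
    · rw [← hyz, ← hyz'] at hzz
      exact Subtype.ext (hyz.symm.trans ((congrArg _ (h2.injOn_ball hy hy' hzz)).trans hyz'))
  · intro z hz hzr
    have hzr : φ z ∈ F := mem_range_incl.1 hzr
    rcases norm_eq_one_cases (mem_closedBall_zero_iff.1 z.2) hz with h | ⟨y, hy, hyz⟩
    · exact htd _ (hb _ h) hzr
    · rw [← hyz] at hzr
      exact hsd _ (hf y hy) hzr
  · rintro ⟨x, hx⟩
    have hx' := hx
    rw [hE] at hx'
    rcases hx' with (hx' | hx') | hx'
    · exact Or.inl ⟨⟨x, hx'⟩, rfl⟩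
    · right
      rw [← h2.image_ball] at hx'
      obtain ⟨y, hy, hyx⟩ := hx'
      refine ⟨⟨faceIncl n y, ?_⟩, Subtype.ext hyx⟩
      rw [mem_closedBall_zero_iff, norm_faceIncl]
      exact max_le (mem_ball_zero_iff.1 hy).le le_rfl
    · right
      rw [← h1.image_ball] at hx'
      obtain ⟨y, hy, hyx⟩ := hx'
      exact ⟨⟨y, ball_subset_closedBall hy⟩, Subtype.ext hyx⟩

theorem Collapses.subset (h : Collapses E F) : (F : Set X) ⊆ E := by
  induction h with
  | refl => exact subset_rfl
  | tail _ h ih => exact h.subset.trans ih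

theorem Collapses.deformEquiv (h : Collapses E F) :
    DeformEquiv (TopCat.of (F : Set X)) (TopCat.of (E : Set X)) := by
  induction h with
  | refl => exact Relation.EqvGen.refl _
  | tail _ h ih => exact h.isSDR.deformEquiv.trans _ _ _ ih

end Collapse

/-! ### Attaching cells to a subcomplex -/

section AttachCells

variable {E F : RelCWComplex.Subcomplex C} {n : ℕ}

theorem closedCell_subset_of_mem {i : RelCWComplex.cell C n} (hi : i ∈ E.I n) :
    RelCWComplex.closedCell n i ⊆ E :=
  RelCWComplex.Subcomplex.closedCell_subset_of_mem E hi

/-- The union of `F` and the cells in `T` is obtained by attaching these cells. -/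
theorem isAttach_cells {T : Set (RelCWComplex.cell C n)} [TopologicalSpace T] [DiscreteTopology T]
    [Finite T] (hT : ∀ t ∈ T, t ∉ F.I n) (hFr : ∀ t ∈ T, RelCWComplex.cellFrontier n t ⊆ F)
    (hE : (E : Set X) = (F : Set X) ∪ ⋃ t ∈ T, RelCWComplex.openCell n t) (h : (F : Set X) ⊆ E) :
    ∃ (f : C({p : T × closedBall (0 : Fin n → ℝ) 1 | ‖(p.2 : Fin n → ℝ)‖ = 1}, (F : Set X)))
      (Φ : C(T × closedBall (0 : Fin n → ℝ) 1, (E : Set X))),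
      IsAttach _ f (incl h) Φ ∧ ∀ p, (Φ p : X) = RelCWComplex.map n p.1.1 p.2 := by
  have hb : ∀ (t : RelCWComplex.cell C n) (y : Fin n → ℝ), ‖y‖ < 1 →
      RelCWComplex.map n t y ∈ RelCWComplex.openCell n t :=
    fun t y hy => mem_image_of_mem _ (mem_ball_zero_iff.2 hy)
  have hs : ∀ (t : T) (y : Fin n → ℝ), ‖y‖ = 1 → RelCWComplex.map n t.1 y ∈ (F : Set X) :=
    fun t y hy => hFr t t.2 (mem_image_of_mem _ (mem_sphere_zero_iff_norm.2 hy))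
  have hc : Continuous fun p : T × closedBall (0 : Fin n → ℝ) 1 => RelCWComplex.map n p.1.1 p.2 := by
    rw [continuous_prod_of_discrete_left]
    exact fun t => continuousOn_iff_continuous_domRestrict.1 (RelCWComplex.continuousOn n t.1)
  have hlt : ∀ {y : closedBall (0 : Fin n → ℝ) 1}, ¬ ‖(y : Fin n → ℝ)‖ = 1 →
      ‖(y : Fin n → ℝ)‖ < 1 := fun {y} hy => lt_of_le_of_ne (mem_closedBall_zero_iff.1 y.2) hy
  have hΦE : ∀ p : T × closedBall (0 : Fin n → ℝ) 1, RelCWComplex.map n p.1.1 p.2 ∈ (E : Set X) :=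
    fun p => by
      by_cases hp : ‖(p.2 : Fin n → ℝ)‖ = 1
      · exact h (hs _ _ hp)
      · rw [hE]
        exact Or.inr (mem_biUnion p.1.2 (hb _ _ (hlt hp)))
  refine ⟨⟨fun p => ⟨RelCWComplex.map n p.1.1.1 p.1.2, hs _ _ p.2⟩,
    (hc.comp continuous_subtype_val).subtype_mk _⟩, ⟨fun p => ⟨_, hΦE p⟩, hc.subtype_mk _⟩, ?_,
    fun _ => rfl⟩
  refine IsAttach.of_isClosedEmbedding (isClosedEmbedding_incl h F.closed) (fun _ => rfl) ?_ ?_ ?_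
  · rintro ⟨t, y⟩ hy ⟨t', y'⟩ hy' hyy
    have hyy : RelCWComplex.map n t.1 y = RelCWComplex.map n t'.1 y' := congrArg Subtype.val hyy
    have h1 := hb t _ (hlt hy)
    have h2 := hb t' _ (hlt hy')
    rw [hyy] at h1
    have h3 := cell_eq_of_mem h1 h2
    obtain rfl : t = t' := Subtype.ext (by simpa using h3)
    have := (RelCWComplex.map n t.1).injOn (by
      rw [RelCWComplex.source_eq]; exact mem_ball_zero_iff.2 (hlt hy)) (by
      rw [RelCWComplex.source_eq]; exact mem_ball_zero_iff.2 (hlt hy')) hyy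
    rw [Subtype.ext this]
  · rintro ⟨t, y⟩ hy hyr
    have hyr : RelCWComplex.map n t.1 y ∈ F := mem_range_incl.1 hyr
    exact hT t t.2 (mem_I_of_mem hyr (hb _ _ (hlt hy)))
  · rintro ⟨x, hx⟩
    have hx' := hx
    rw [hE] at hx'
    rcases hx' with hx' | hx'
    · exact Or.inl ⟨⟨x, hx'⟩, rfl⟩
    · obtain ⟨t, ht, y, hy, hyx⟩ := mem_iUnion₂.1 hx'
      exact Or.inr ⟨(⟨t, ht⟩, ⟨y, ball_subset_closedBall hy⟩), Subtype.ext hyx⟩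

variable (V : VectorField C)

/-- The cells by which the two stages differ are the critical `n`-cells, and their frontiers lie in
lower dimensions, where `X''_n` contains everything. -/
theorem VectorField.isAttach_X' [CWComplex.Finite C]
    [TopologicalSpace {c : RelCWComplex.cell C n | V.IsCritical n c}]
    [DiscreteTopology {c : RelCWComplex.cell C n | V.IsCritical n c}] :
    ∃ (f : C({p : {c : RelCWComplex.cell C n | V.IsCritical n c} × closedBall (0 : Fin n → ℝ) 1 |
        ‖(p.2 : Fin n → ℝ)‖ = 1}, (V.X'' n : Set X)))
      (Φ : C({c : RelCWComplex.cell C n | V.IsCritical n c} × closedBall (0 : Fin n → ℝ) 1,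
        (V.X' n : Set X))),
      IsAttach _ f (incl (V.X''_le_X' n)) Φ ∧
        ∀ p, (Φ p : X) = RelCWComplex.map n p.1.1 p.2 := by
  have : Finite (RelCWComplex.cell C n) := CWComplex.FiniteType.finite_cell n
  refine isAttach_cells (fun t ht h => ?_) (fun t ht x hx => ?_) ?_ _
  · exact ht.2 ((VectorField.mem_X''_I.1 h).2 rfl)
  · obtain ⟨l, hl, j, hj⟩ := exists_openCell_of_mem_frontier hx
    exact mem_subcomplex_iff.2 ⟨l, j, VectorField.mem_X''_I.2 ⟨hl.le, fun h => by omega⟩, hj⟩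
  · ext x
    simp only [SetLike.mem_coe, mem_union, mem_iUnion, mem_subcomplex_iff, mem_ofPred_eq, exists_prop]
    constructor
    · rintro ⟨m, i, hi, hx⟩
      rw [VectorField.mem_X'_I] at hi
      by_cases hm : m = n
      · subst hm
        by_cases hcr : V.IsCritical m i
        · exact Or.inr ⟨i, hcr, hx⟩
        · exact Or.inl ⟨m, i, VectorField.mem_X''_I.2 ⟨le_rfl, fun _ =>
            VectorField.not_isRedundant_and_not_isCritical.1 ⟨hi.2 rfl, hcr⟩⟩, hx⟩
      · exact Or.inl ⟨m, i, VectorField.mem_X''_I.2 ⟨hi.1, fun h => absurd h hm⟩, hx⟩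
    · rintro (⟨m, i, hi, hx⟩ | ⟨i, hi, hx⟩)
      · exact ⟨m, i, ⟨hi.1, fun h => (hi.2 h).1⟩, hx⟩
      · exact ⟨n, i, ⟨le_rfl, fun _ => hi.1⟩, hx⟩

end AttachCells

end

/-! ### The CW complex with one cell for each critical cell -/

section

/-! ### Construction of finite CW complexes -/

section CellStructure

/-- A closed map onto `Y` from a normal space makes `Y` a Hausdorff space. -/
theorem t2Space_of_isClosedMap {Z Y : Type*} [TopologicalSpace Z] [TopologicalSpace Y] [T1Space Z]
    [NormalSpace Z] {q : Z → Y} (hq : IsClosedMap q) (hc : Continuous q)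
    (hs : Function.Surjective q) : T2Space Y := by
  have h1 : ∀ y : Y, IsClosed ({y} : Set Y) := fun y => by
    obtain ⟨z, rfl⟩ := hs y
    simpa using hq _ (isClosed_singleton (x := z))
  refine ⟨fun x y hxy => ?_⟩
  obtain ⟨U, V, hU, hV, hxU, hyV, hUV⟩ := NormalSpace.normal (q ⁻¹' {x}) (q ⁻¹' {y})
    ((h1 x).preimage hc) ((h1 y).preimage hc)
    (Disjoint.preimage q (disjoint_singleton.2 hxy))
  refine ⟨(q '' Uᶜ)ᶜ, (q '' Vᶜ)ᶜ, (hq _ hU.isClosed_compl).isOpen_compl,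
    (hq _ hV.isClosed_compl).isOpen_compl, ?_, ?_, ?_⟩
  · rintro ⟨z, hz, hzx⟩
    exact hz (hxU hzx)
  · rintro ⟨z, hz, hzy⟩
    exact hz (hyV hzy)
  · rw [disjoint_left]
    intro w hw hw'
    obtain ⟨z, rfl⟩ := hs w
    have hzU : z ∈ U := by
      by_contra h
      exact hw ⟨z, h, rfl⟩
    have hzV : z ∈ V := by
      by_contra h
      exact hw' ⟨z, h, rfl⟩
    exact hUV.notMem_of_mem_left hzU hzV

/-- The saturation of a closed set adds only an image and a preimage under `f`, which are closed
because `S` is compact and `A` Hausdorff. Closedness of the quotient map is what yields that the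
glued space is Hausdorff. -/
theorem IsAttach.isClosedMap {A D E : Type*} [TopologicalSpace A] [TopologicalSpace D]
    [TopologicalSpace E] [CompactSpace D] [T2Space A] [T2Space D] {S : Set D} (hS : IsClosed S)
    {f : C(S, A)} {a : C(A, E)} {Φ : C(D, E)} (h : IsAttach S f a Φ) :
    IsClosedMap (Sum.elim a Φ) := by
  have ha : ∀ K : Set A, IsClosed K → IsClosed (a '' K) := fun K hK => by
    rw [← h.isQuotientMap.isClosed_preimage, isClosed_sum_iff]
    constructor
    · convert hK using 1
      ext x
      exact h.injective.mem_set_image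
    · convert (hS.isClosedEmbedding_subtypeVal.isClosedMap _ (hK.preimage f.continuous)) using 1
      ext d
      constructor
      · rintro ⟨x, hx, hxd⟩
        by_cases hd : d ∈ S
        · refine ⟨⟨d, hd⟩, ?_, rfl⟩
          have h1 := h.apply_of_mem hd
          change a x = Φ d at hxd
          rw [h1] at hxd
          rwa [mem_preimage, ← h.injective hxd]
        · exact absurd ⟨x, hxd⟩ (h.notMem_range d hd)
      · rintro ⟨s, hs, rfl⟩
        exact ⟨f s, hs, (h.apply_coe s).symm⟩
  have hΦ : ∀ K : Set D, IsClosed K → IsClosed (Φ '' K) := fun K hK => by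
    have hKS : IsClosed (f '' (Subtype.val ⁻¹' K)) := by
      have : CompactSpace S := isCompact_iff_compactSpace.1 hS.isCompact
      exact f.continuous.isClosedMap _ (hK.preimage continuous_subtype_val)
    have hu : Φ '' K = a '' (f '' (Subtype.val ⁻¹' K)) ∪ Φ '' (K \ S) := by
      ext x
      constructor
      · rintro ⟨d, hd, rfl⟩
        by_cases hdS : d ∈ S
        · exact Or.inl ⟨_, ⟨⟨d, hdS⟩, hd, rfl⟩, (h.apply_of_mem hdS).symm⟩
        · exact Or.inr ⟨d, ⟨hd, hdS⟩, rfl⟩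
      · rintro (⟨_, ⟨s, hs, rfl⟩, rfl⟩ | ⟨d, hd, rfl⟩)
        · exact ⟨s, hs, h.apply_coe s⟩
        · exact ⟨d, hd.1, rfl⟩
    rw [← h.isQuotientMap.isClosed_preimage, isClosed_sum_iff]
    constructor
    · convert hKS using 1
      ext x
      constructor
      · rintro ⟨d, hd, hdx⟩
        by_cases hdS : d ∈ S
        · rw [h.apply_of_mem hdS] at hdx
          exact ⟨⟨d, hdS⟩, hd, h.injective hdx⟩
        · exact absurd ⟨x, hdx.symm⟩ (h.notMem_range d hdS)
      · rintro ⟨s, hs, rfl⟩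
        exact ⟨s, hs, h.apply_coe s⟩
    · convert hK.union (hS.isClosedEmbedding_subtypeVal.isClosedMap _
        (hKS.preimage f.continuous)) using 1
      ext d
      constructor
      · intro hd
        change Φ d ∈ Φ '' K at hd
        by_cases hdS : d ∈ S
        · right
          refine ⟨⟨d, hdS⟩, ?_, rfl⟩
          rw [hu] at hd
          rcases hd with ⟨x, hx, hxd⟩ | ⟨d', hd', hdd⟩
          · rw [h.apply_of_mem hdS] at hxd
            rwa [mem_preimage, ← h.injective hxd]
          · rw [h.apply_of_mem hdS] at hdd
            exact absurd ⟨_, hdd.symm⟩ (h.notMem_range d' hd'.2)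
        · left
          obtain ⟨d', hd', hdd⟩ := hd
          by_cases hdS' : d' ∈ S
          · rw [h.apply_of_mem hdS'] at hdd
            exact absurd ⟨_, hdd⟩ (h.notMem_range d hdS)
          · rwa [← h.injOn hdS' hdS hdd]
      · rintro (hd | ⟨s, hs, rfl⟩)
        · exact ⟨d, hd, rfl⟩
        · change Φ s ∈ Φ '' K
          rw [hu]
          exact Or.inl ⟨f s, hs, (h.apply_coe s).symm⟩
  intro K hK
  rw [isClosed_sum_iff] at hK
  have : Sum.elim a Φ '' K = a '' (Sum.inl ⁻¹' K) ∪ Φ '' (Sum.inr ⁻¹' K) := by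
    ext x
    simp
  rw [this]
  exact (ha _ hK.1).union (hΦ _ hK.2)

variable {Y : Type u} [TopologicalSpace Y]

/-- The cells of a CW complex `Y` with finitely many cells and their characteristic maps. -/
structure IsCellStructure (cell : ℕ → Type u) (φ : ∀ m, cell m → (Fin m → ℝ) → Y) : Prop where
  continuousOn : ∀ m c, ContinuousOn (φ m c) (closedBall 0 1)
  injective : ∀ m c, ∀ x ∈ ball (0 : Fin m → ℝ) 1, ∀ l d, ∀ y ∈ ball (0 : Fin l → ℝ) 1,
    φ m c x = φ l d y → (⟨m, c, x⟩ : Σ m, cell m × (Fin m → ℝ)) = ⟨l, d, y⟩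
  frontier : ∀ m c, ∀ x ∈ sphere (0 : Fin m → ℝ) 1, ∃ l < m, ∃ d, ∃ y ∈ ball (0 : Fin l → ℝ) 1,
    φ l d y = φ m c x
  surjective : ∀ y, ∃ m c, ∃ x ∈ ball (0 : Fin m → ℝ) 1, φ m c x = y

/-- Continuity of the inverse comes from compactness of the closed cube, once the image of the
boundary is known to miss that of the interior. -/
theorem exists_partialEquiv [T2Space Y] {n : ℕ} {φ : (Fin n → ℝ) → Y}
    (hφ : ContinuousOn φ (closedBall 0 1)) (hi : InjOn φ (ball 0 1))
    (hd : ∀ x ∈ sphere (0 : Fin n → ℝ) 1, ∀ y ∈ ball (0 : Fin n → ℝ) 1, φ x ≠ φ y) :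
    ∃ e : PartialEquiv (Fin n → ℝ) Y, e.source = ball 0 1 ∧ (e : (Fin n → ℝ) → Y) = φ ∧
      ContinuousOn e.symm e.target := by
  classical
  refine ⟨hi.toPartialEquiv φ (ball 0 1), rfl, rfl, ?_⟩
  have hsymm : ∀ x ∈ ball (0 : Fin n → ℝ) 1, (hi.toPartialEquiv φ (ball 0 1)).symm (φ x) = x :=
    fun x hx => (hi.toPartialEquiv φ (ball 0 1)).left_inv hx
  rw [continuousOn_iff_isClosed]
  intro K hK
  refine ⟨φ '' (K ∩ closedBall 0 1), ?_, ?_⟩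
  · refine IsCompact.isClosed ?_
    exact ((isCompact_closedBall _ _).inter_left hK).image_of_continuousOn
      (hφ.mono inter_subset_right)
  · ext y
    constructor
    · rintro ⟨hy, x, hx, rfl⟩
      rw [mem_preimage, hsymm x hx] at hy
      exact ⟨⟨x, ⟨hy, ball_subset_closedBall hx⟩, rfl⟩, x, hx, rfl⟩
    · rintro ⟨⟨x', ⟨hx', hx'b⟩, hxx⟩, x, hx, rfl⟩
      refine ⟨?_, x, hx, rfl⟩
      rw [mem_preimage, hsymm x hx]
      rcases (mem_closedBall_zero_iff.1 hx'b).lt_or_eq with h | h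
      · rwa [← hi (mem_ball_zero_iff.2 h) hx hxx]
      · exact absurd hxx (hd x' (mem_sphere_zero_iff_norm.2 h) x hx)

theorem IsCellStructure.exists_cwComplex [T2Space Y] {cell : ℕ → Type u}
    {φ : ∀ m, cell m → (Fin m → ℝ) → Y} (h : IsCellStructure cell φ) (hf : ∀ m, Finite (cell m))
    (he : ∀ᶠ n in Filter.atTop, IsEmpty (cell n)) :
    ∃ _ : CWComplex (univ : Set Y), CWComplex.Finite (univ : Set Y) ∧
      ∀ n, Nat.card (RelCWComplex.cell (univ : Set Y) n) = Nat.card (cell n) := by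
  have hinj : ∀ m c, InjOn (φ m c) (ball 0 1) := fun m c x hx y hy hxy => by
    have := h.injective m c x hx m c y hy hxy
    simpa using this
  have hdisj : ∀ m c, ∀ x ∈ sphere (0 : Fin m → ℝ) 1, ∀ y ∈ ball (0 : Fin m → ℝ) 1,
      φ m c x ≠ φ m c y := fun m c x hx y hy hxy => by
    obtain ⟨l, hl, d, z, hz, hzx⟩ := h.frontier m c x hx
    have := congrArg Sigma.fst (h.injective l d z hz m c y hy (hzx.trans hxy))
    exact hl.ne this
  choose e he1 he2 he3 using fun m c => exists_partialEquiv (h.continuousOn m c) (hinj m c)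
    (hdisj m c)
  have h4 : (univ : Set (Σ n, cell n)).PairwiseDisjoint fun ni => e ni.1 ni.2 '' ball 0 1 := by
    rintro ⟨m, c⟩ - ⟨l, d⟩ - hne
    rw [Function.onFun, disjoint_left]
    rintro y ⟨x, hx, rfl⟩ ⟨z, hz, hzx⟩
    rw [he2, he2] at hzx
    have := h.injective l d z hz m c x hx hzx
    apply hne
    have := congrArg (fun p : Σ m, cell m × (Fin m → ℝ) => (⟨p.1, p.2.1⟩ : Σ m, cell m)) this
    exact this.symm
  have h5 : ∀ (n : ℕ) (i : cell n), MapsTo (e n i) (sphere 0 1)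
      (⋃ (m < n) (j : cell m), e m j '' closedBall 0 1) := fun n i x hx => by
    obtain ⟨l, hl, d, z, hz, hzx⟩ := h.frontier n i x hx
    refine mem_iUnion₂.2 ⟨l, hl, mem_iUnion.2 ⟨d, z, ball_subset_closedBall hz, ?_⟩⟩
    rw [he2, he2, hzx]
  have h6 : ⋃ (n : ℕ) (j : cell n), e n j '' closedBall 0 1 = univ := by
    refine eq_univ_of_forall fun y => ?_
    obtain ⟨m, c, x, hx, hxy⟩ := h.surjective y
    exact mem_iUnion₂.2 ⟨m, c, x, ball_subset_closedBall hx, by rw [he2, hxy]⟩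
  have h7 : ∀ n i, ContinuousOn (e n i) (closedBall 0 1) := fun n i => by
    rw [he2]
    exact h.continuousOn n i
  refine ⟨CWComplex.mkFinite univ cell e he hf he1 h7 he3 h4 h5 h6,
    CWComplex.finite_mkFinite univ cell e he hf he1 h7 he3 h4 h5 h6, fun n => rfl⟩

variable {ι : Type u} [TopologicalSpace ι] [DiscreteTopology ι] [Finite ι] {n : ℕ}
  {E : Type u} [TopologicalSpace E]

/-- The cells after attaching `n`-cells indexed by `ι`. -/
abbrev addCells (cell : ℕ → Type u) (ι : Type u) (n m : ℕ) : Type u :=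
  cell m ⊕ {_i : ι // m = n}

open Classical in
/-- The characteristic maps after attaching `n`-cells indexed by `ι`. -/
def addCellsMap {cell : ℕ → Type u} (φ : ∀ m, cell m → (Fin m → ℝ) → Y) (a : Y → E)
    (Φ : ι × closedBall (0 : Fin n → ℝ) 1 → E) (m : ℕ) :
    addCells cell ι n m → (Fin m → ℝ) → E
  | Sum.inl c => fun x => a (φ m c x)
  -- Outside the closed cube the centre serves as an arbitrary value.
  | Sum.inr i => fun x => Φ (i.1, if h : (fun k => x (Fin.cast i.2.symm k)) ∈
      closedBall (0 : Fin n → ℝ) 1 then ⟨_, h⟩ else ⟨0, mem_closedBall_self zero_le_one⟩)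

theorem addCellsMap_inr {cell : ℕ → Type u} (φ : ∀ m, cell m → (Fin m → ℝ) → Y) (a : Y → E)
    (Φ : ι × closedBall (0 : Fin n → ℝ) 1 → E) (i : ι) {x : Fin n → ℝ}
    (hx : x ∈ closedBall (0 : Fin n → ℝ) 1) :
    addCellsMap φ a Φ n (Sum.inr ⟨i, rfl⟩) x = Φ (i, ⟨x, hx⟩) := by
  unfold addCellsMap
  simp only [Fin.cast_eq_self]
  rw [dif_pos hx]

/-- All old cells have dimension below `n`, so any attaching map sends boundaries into
lower-dimensional cells and no cellular approximation is needed. -/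
theorem IsCellStructure.addCells {cell : ℕ → Type u} {φ : ∀ m, cell m → (Fin m → ℝ) → Y}
    (h : IsCellStructure cell φ) (hn : ∀ m, n ≤ m → IsEmpty (cell m))
    {f : C({p : ι × closedBall (0 : Fin n → ℝ) 1 | ‖(p.2 : Fin n → ℝ)‖ = 1}, Y)}
    {a : C(Y, E)} {Φ : C(ι × closedBall (0 : Fin n → ℝ) 1, E)} (hE : IsAttach _ f a Φ) :
    IsCellStructure (addCells cell ι n) (addCellsMap φ a Φ) where
  continuousOn := by
    rintro m (c | ⟨i, rfl⟩)
    · exact a.continuous.comp_continuousOn (h.continuousOn m c)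
    · rw [continuousOn_iff_continuous_domRestrict]
      have : Continuous fun x : closedBall (0 : Fin m → ℝ) 1 => Φ (i, x) := by fun_prop
      exact this.congr fun x => (addCellsMap_inr φ a Φ i x.2).symm
  injective := by
    have hnot : ∀ (i : ι) (x : Fin n → ℝ) (hx : x ∈ ball (0 : Fin n → ℝ) 1),
        ((i, ⟨x, ball_subset_closedBall hx⟩) : ι × closedBall (0 : Fin n → ℝ) 1) ∉
          {p : ι × closedBall (0 : Fin n → ℝ) 1 | ‖(p.2 : Fin n → ℝ)‖ = 1} :=
      fun i x hx => (mem_ball_zero_iff.1 hx).ne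
    rintro m (c | ⟨i, rfl⟩) x hx l (d | ⟨j, hl⟩) y hy hxy
    · have := h.injective m c x hx l d y hy (hE.injective hxy)
      rw [Sigma.mk.inj_iff] at this
      obtain ⟨rfl, h2⟩ := this
      rw [heq_eq_eq, Prod.mk.injEq] at h2
      rw [h2.1, h2.2]
    · subst hl
      rw [addCellsMap_inr φ a Φ j (ball_subset_closedBall hy)] at hxy
      exact absurd ⟨_, hxy⟩ (hE.notMem_range _ (hnot j y hy))
    · rw [addCellsMap_inr φ a Φ i (ball_subset_closedBall hx)] at hxy
      exact absurd ⟨_, hxy.symm⟩ (hE.notMem_range _ (hnot i x hx))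
    · subst hl
      rw [addCellsMap_inr φ a Φ i (ball_subset_closedBall hx),
        addCellsMap_inr φ a Φ j (ball_subset_closedBall hy)] at hxy
      have := hE.injOn (hnot i x hx) (hnot j y hy) hxy
      rw [Prod.mk.injEq, Subtype.mk.injEq] at this
      rw [this.1, this.2]
  frontier := by
    rintro m (c | ⟨i, rfl⟩) x hx
    · obtain ⟨l, hl, d, y, hy, hyx⟩ := h.frontier m c x hx
      exact ⟨l, hl, Sum.inl d, y, hy, congrArg a hyx⟩
    · rw [addCellsMap_inr φ a Φ i (sphere_subset_closedBall hx)]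
      have h1 := hE.apply_of_mem (d := (i, ⟨x, sphere_subset_closedBall hx⟩))
        (mem_sphere_zero_iff_norm.1 hx)
      obtain ⟨l, d, y, hy, hyx⟩ := h.surjective
        (f ⟨(i, ⟨x, sphere_subset_closedBall hx⟩), mem_sphere_zero_iff_norm.1 hx⟩)
      refine ⟨l, ?_, Sum.inl d, y, hy, (congrArg a hyx).trans h1.symm⟩
      by_contra! hl
      exact (hn l hl).false d
  surjective := by
    intro y
    rcases hE.exists_rep y with ⟨x, rfl⟩ | ⟨⟨i, x⟩, hx, rfl⟩
    · obtain ⟨m, c, z, hz, hzx⟩ := h.surjective x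
      exact ⟨m, Sum.inl c, z, hz, congrArg a hzx⟩
    · exact ⟨n, Sum.inr ⟨i, rfl⟩, x, mem_ball_zero_iff.2
        (lt_of_le_of_ne (mem_closedBall_zero_iff.1 x.2) hx), addCellsMap_inr φ a Φ i x.2⟩

end CellStructure

/-! ### The Morse complex -/

section MorseComplex

variable {X : Type u} [TopologicalSpace X] [T2Space X] {C : Set X} [CWComplex C]

/-- Induction on the stage: `X''_(n+1)` collapses to `X'_n`, which is `X''_n` with the critical
`n`-cells attached. Transporting their attaching map to the model of `X''_n` and gluing there gives
the next model. -/
theorem VectorField.IsGradient.exists_cellStructure [CWComplex.Finite C] {V : VectorField C}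
    (hV : V.IsGradient) (hC : FaceCondition C) (n : ℕ) :
    ∃ (Y : Type u) (_ : TopologicalSpace Y) (_ : T2Space Y) (_ : CompactSpace Y) (cell : ℕ → Type u)
      (φ : ∀ m, cell m → (Fin m → ℝ) → Y), IsCellStructure cell φ ∧ (∀ m, Finite (cell m)) ∧
      (∀ m < n, Nat.card (cell m) = V.numCritical m) ∧ (∀ m, n ≤ m → IsEmpty (cell m)) ∧
      DeformEquiv (TopCat.of (V.X'' n : Set X)) (TopCat.of Y) := by
  induction n with
  | zero =>
    have h0 : IsEmpty (V.X'' 0 : Set X) := by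
      rw [VectorField.X''_zero]
      infer_instance
    refine ⟨PEmpty, inferInstance, inferInstance, inferInstance, fun _ => PEmpty,
      fun m c => c.elim, ⟨fun _ c => c.elim, fun _ c => c.elim, fun _ c => c.elim,
        fun y => y.elim⟩, fun m => inferInstance, fun m hm => by omega, fun m _ => inferInstance,
      DeformEquiv.of_homeomorph (Homeomorph.empty)⟩
  | succ n ih =>
    obtain ⟨Y, _, _, _, cell, φ, hφ, hfin, hcard, hempty, hY⟩ := ih
    have : Finite (RelCWComplex.cell C n) := CWComplex.FiniteType.finite_cell n
    let ι : Type u := {c : RelCWComplex.cell C n | V.IsCritical n c}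
    let _ : TopologicalSpace ι := ⊥
    have : DiscreteTopology ι := ⟨rfl⟩
    have : Finite ι := inferInstanceAs (Finite {c : RelCWComplex.cell C n | V.IsCritical n c})
    obtain ⟨f, Φ, hf, -⟩ := V.isAttach_X' (n := n)
    obtain ⟨f', hf'⟩ := (hY.exists_attachEquiv (isCofibrantPair_ball (ι := ι))).1 f
    obtain ⟨E, _, a, Ψ, hE⟩ := IsAttach.exists_isAttach _ f'
    have hcl := hE.isClosedMap (isCofibrantPair_ball (ι := ι)).1
    have hT2 : T2Space E := t2Space_of_isClosedMap hcl (by fun_prop) hE.isQuotientMap.surjective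
    have hcomp : CompactSpace E := by
      have := isCompact_univ (X := Y ⊕ (ι × closedBall (0 : Fin n → ℝ) 1))
      refine ⟨?_⟩
      rw [← hE.isQuotientMap.surjective.range_eq]
      exact isCompact_range (by fun_prop)
    refine ⟨E, inferInstance, hT2, hcomp, addCells cell ι n, addCellsMap φ a Ψ,
      hφ.addCells hempty hE, fun m => ?_, fun m hm => ?_, fun m hm => ?_, ?_⟩
    · have := hfin m
      infer_instance
    · rcases Nat.lt_succ_iff_lt_or_eq.1 hm with h | rfl
      · have : IsEmpty {_i : ι // m = n} := ⟨fun i => h.ne i.2⟩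
        rw [Nat.card_congr (Equiv.sumEmpty _ _), hcard m h]
      · have := hempty m le_rfl
        rw [Nat.card_congr ((Equiv.emptySum _ _).trans (Equiv.subtypeUnivEquiv fun _ => rfl))]
        rfl
    · have h1 := hempty m (by omega)
      have h2 : IsEmpty {_i : ι // m = n} := ⟨fun i => by have := i.2; omega⟩
      infer_instance
    · exact (hV.collapses_X'' hC n).deformEquiv.symm.trans _ _ _
        (hf' (TopCat.of _) (TopCat.of E) _ _ _ _ hf hE)

theorem VectorField.IsGradient.exists_homotopyEquiv [CWComplex.Finite C] {V : VectorField C}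
    (hV : V.IsGradient) (hC : FaceCondition C) :
    ∃ (Y : Type u) (_ : TopologicalSpace Y) (_ : T2Space Y) (_ : CWComplex (univ : Set Y)),
      CWComplex.Finite (univ : Set Y) ∧
      (∀ n, Nat.card (RelCWComplex.cell (univ : Set Y) n) = V.numCritical n) ∧
      Nonempty (ContinuousMap.HomotopyEquiv C Y) := by
  obtain ⟨N, hN⟩ := VectorField.exists_X'_eq (V := V)
  have he : ∀ᶠ n in Filter.atTop, IsEmpty (RelCWComplex.cell C n) :=
    RelCWComplex.FiniteDimensional.eventually_isEmpty_cell
  obtain ⟨M, hM⟩ := Filter.eventually_atTop.1 he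
  obtain ⟨Y, _, hT2, _, cell, φ, hφ, hfin, hcard, hempty, hY⟩ :=
    -- Beyond `N` the filtration is the whole complex, and beyond `M` there are no cells, so the
    -- vanishing cell numbers also match in high dimensions.
    hV.exists_cellStructure hC (max N M + 1)
  obtain ⟨hcw, h1, h2⟩ := hφ.exists_cwComplex hfin
    (Filter.eventually_atTop.2 ⟨max N M + 1, hempty⟩)
  refine ⟨Y, _, hT2, hcw, h1, fun n => ?_, ?_⟩
  · rw [h2]
    by_cases hn : n < max N M + 1
    · exact hcard n hn
    · have h3 := hempty n (by omega)
      have h4 := hM n (by omega)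
      rw [VectorField.numCritical, Nat.card_of_isEmpty, Nat.card_of_isEmpty]
  · have h3 : (V.X'' (max N M + 1) : Set X) = C := by
      exact subset_antisymm (RelCWComplex.Subcomplex.subset_complex _)
        ((hN (max N M) (le_max_left _ _)).symm.subset.trans (V.X'_le_X'' _))
    obtain ⟨e⟩ := hY.homotopyEquiv
    exact ⟨(Homeomorph.setCongr h3).symm.toHomotopyEquiv.trans e⟩

end MorseComplex

end

/-! ### Attachments as pushouts of disk boundaries -/

section

/-! ### Attaching cells in the category of topological spaces -/

section AttachCells

open CategoryTheory Limits TopCat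

variable {n : ℕ} {A E ι : Type u} [TopologicalSpace A] [TopologicalSpace E] [TopologicalSpace ι]
  [DiscreteTopology ι]

/-- The ambient homeomorphism of the Euclidean ball and the cube, which also matches their
boundaries, translates the cells; `exists_desc` then provides the pushout property. -/
theorem IsAttach.nonempty_attachCells
    {f : C({p : ι × closedBall (0 : Fin n → ℝ) 1 | ‖(p.2 : Fin n → ℝ)‖ = 1}, A)}
    {a : C(A, E)} {Φ : C(ι × closedBall (0 : Fin n → ℝ) 1, E)} (h : IsAttach _ f a Φ) :
    ∃ c : HomotopicalAlgebra.AttachCells.{u} (TopCat.RelativeCWComplex.basicCell.{u} n)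
      (TopCat.ofHom a), c.ι = ι := by
  obtain ⟨e, -, he, he'⟩ := exists_homeo_euclidean_cube n
  have hd : ∀ p : 𝔻 n, e p.down ∈ closedBall (0 : Fin n → ℝ) 1 :=
    fun p => he ▸ mem_image_of_mem e p.down.2
  have hs : ∀ p : ∂𝔻 n, ‖e p.down‖ = 1 :=
    fun p => mem_sphere_zero_iff_norm.1 (he' ▸ mem_image_of_mem e p.down.2)
  have hd' : ∀ x : closedBall (0 : Fin n → ℝ) 1, e.symm x ∈
      closedBall (0 : EuclideanSpace ℝ (Fin n)) 1 := fun x => by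
    obtain ⟨y, hy, hyx⟩ := he.superset x.2
    rwa [← hyx, e.symm_apply_apply]
  have hs' : ∀ x : Fin n → ℝ, ‖x‖ = 1 → e.symm x ∈
      Metric.sphere (0 : EuclideanSpace ℝ (Fin n)) 1 := fun x hx => by
    obtain ⟨y, hy, hyx⟩ := he'.superset (mem_sphere_zero_iff_norm.2 hx)
    rwa [← hyx, e.symm_apply_apply]
  let g₁ : C(Σ _ : ι, ∂𝔻 n, A) :=
    ⟨fun p => f ⟨(p.1, ⟨e p.2.down, (mem_closedBall_zero_iff.2 (hs p.2).le)⟩), hs p.2⟩, by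
      refine continuous_sigma fun i => f.continuous.comp (Continuous.subtype_mk
        (continuous_const.prodMk (Continuous.subtype_mk ?_ _)) _)
      exact e.continuous.comp (continuous_subtype_val.comp continuous_uliftDown)⟩
  let g₂ : C(Σ _ : ι, 𝔻 n, E) :=
    ⟨fun p => Φ (p.1, ⟨e p.2.down, hd p.2⟩), by
      refine continuous_sigma fun i => Φ.continuous.comp
        (continuous_const.prodMk (Continuous.subtype_mk ?_ _))
      exact e.continuous.comp (continuous_subtype_val.comp continuous_uliftDown)⟩
  let m : C(Σ _ : ι, ∂𝔻 n, Σ _ : ι, 𝔻 n) :=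
    ⟨fun p => ⟨p.1, diskBoundaryInclusion n p.2⟩, continuous_sigma fun i =>
      continuous_sigmaMk.comp (diskBoundaryInclusion n).hom.continuous⟩
  have w : TopCat.ofHom g₁ ≫ TopCat.ofHom a = TopCat.ofHom m ≫ TopCat.ofHom g₂ := by
    ext p
    exact (h.apply_coe _).symm
  have hpo : IsPushout (TopCat.ofHom g₁) (TopCat.ofHom m) (TopCat.ofHom a) (TopCat.ofHom g₂) := by
    have key : ∀ s : PushoutCocone (TopCat.ofHom g₁) (TopCat.ofHom m),
        ∃ d : C(E, s.pt), (∀ x, d (a x) = s.inl x) ∧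
          ∀ p, d (Φ p) = s.inr ⟨p.1, ⟨e.symm p.2, hd' p.2⟩⟩ := fun s => by
      refine h.exists_desc s.inl.hom ⟨fun p => s.inr.hom ⟨p.1, ⟨e.symm p.2, hd' p.2⟩⟩, ?_⟩
        fun x => ?_
      · rw [continuous_prod_of_discrete_left]
        refine fun i => s.inr.hom.continuous.comp (continuous_sigmaMk.comp
          (continuous_uliftUp.comp (Continuous.subtype_mk ?_ _)))
        exact e.symm.continuous.comp continuous_subtype_val
      · have hx := ConcreteCategory.congr_hom s.condition
          (⟨x.1.1, ⟨e.symm x.1.2, hs' _ x.2⟩⟩ : Σ _ : ι, ∂𝔻 n)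
        refine Eq.trans hx.symm (congrArg (fun y => s.inl (f y)) (Subtype.ext ?_))
        exact Prod.ext rfl (Subtype.ext (e.apply_symm_apply _))
    choose d hd1 hd2 using key
    refine ⟨⟨w⟩, ⟨PushoutCocone.IsColimit.mk w (fun s => TopCat.ofHom (d s)) (fun s => ?_)
      (fun s => ?_) fun s k hk1 hk2 => ?_⟩⟩
    · ext x
      exact hd1 s x
    · ext p
      refine (hd2 s _).trans (congrArg s.inr (Sigma.ext rfl (heq_of_eq ?_)))
      exact ULift.ext _ _ (Subtype.ext (e.symm_apply_apply _))
    · ext y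
      rcases h.exists_rep y with ⟨x, rfl⟩ | ⟨p, -, rfl⟩
      · exact (ConcreteCategory.congr_hom hk1 x).trans (hd1 s x).symm
      · have hp := ConcreteCategory.congr_hom hk2
          (⟨p.1, ⟨e.symm p.2, hd' p.2⟩⟩ : Σ _ : ι, 𝔻 n)
        refine Eq.trans (congrArg k ?_) (hp.trans (hd2 s p).symm)
        exact congrArg Φ (Prod.ext rfl (Subtype.ext (e.apply_symm_apply _).symm))
  exact ⟨{
    ι := ι
    π := fun _ => ()
    cofan₁ := sigmaCofan fun _ : ι => ∂𝔻 n
    cofan₂ := sigmaCofan fun _ : ι => 𝔻 n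
    isColimit₁ := sigmaCofanIsColimit _
    isColimit₂ := sigmaCofanIsColimit _
    m := TopCat.ofHom m
    hm := fun i => rfl
    g₁ := TopCat.ofHom g₁
    g₂ := TopCat.ofHom g₂
    isPushout := hpo }, rfl⟩

end AttachCells

theorem VectorField.obtainedByAttaching {X : Type u} [TopologicalSpace X] [T2Space X] {C : Set X}
    [CWComplex C] [CWComplex.Finite C] (V : VectorField C) (n : ℕ) :
    ObtainedByAttaching (V.X'' n : Set X) (V.X' n) n (V.numCritical n) := by
  have hfin : Finite (RelCWComplex.cell C n) := CWComplex.FiniteType.finite_cell n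
  let ι : Type u := {c : RelCWComplex.cell C n | V.IsCritical n c}
  let _ : TopologicalSpace ι := ⊥
  have : DiscreteTopology ι := ⟨rfl⟩
  have : Finite ι := inferInstanceAs (Finite {c : RelCWComplex.cell C n | V.IsCritical n c})
  obtain ⟨f, Φ, hf, -⟩ := V.isAttach_X' (n := n)
  obtain ⟨c, hc⟩ := IsAttach.nonempty_attachCells (ι := ι) hf
  refine ⟨V.X''_le_X' n, c, hc ▸ this, ?_⟩
  rw [hc]
  rfl

end

/-! ### Compression of cubes and homotopy groups -/

section

/-! ### Compressing cubes -/

section PairConn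

variable {A B : Type u} [TopologicalSpace A] [TopologicalSpace B]

/-- Every cube of dimension at most `k` in `B` with boundary in `A` can be deformed into `A`
relative to its boundary. -/
def PairConn (k : ℕ) (i : C(A, B)) : Prop :=
  ∀ j ≤ k, ∀ F : C(Fin j → unitInterval, B), (∀ y ∈ Cube.boundary (Fin j), F y ∈ range i) →
    ∃ G : C(Fin j → unitInterval, A), F.HomotopicRel (i.comp G) (Cube.boundary (Fin j))

/-- After compression into `B` the boundary still lies in `A`, because the homotopy was relative to
it and `i'` is injective, so a second compression applies. -/
theorem PairConn.comp {D : Type u} [TopologicalSpace D] {k : ℕ} {i : C(A, B)} {i' : C(B, D)}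
    (h : PairConn k i) (h' : PairConn k i') (hi' : Function.Injective i') :
    PairConn k (i'.comp i) := by
  intro j hj F hF
  obtain ⟨G, hG⟩ := h' j hj F fun y hy => by
    obtain ⟨x, hx⟩ := hF y hy
    exact ⟨i x, hx⟩
  obtain ⟨G', hG'⟩ := h j hj G fun y hy => by
    obtain ⟨x, hx⟩ := hF y hy
    exact ⟨x, hi' (hx.trans (hG.fst_eq_snd hy))⟩
  exact ⟨G', hG.trans (hG'.comp_continuousMap i')⟩

theorem IsSDR.pairConn {i : C(A, B)} (h : IsSDR i) (k : ℕ) : PairConn k i := by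
  obtain ⟨r, H, h1, h2, h3, h4⟩ := h
  intro j _ F hF
  refine ⟨r.comp F, ⟨⟨⟨⟨fun p => H (F p.2, p.1), by fun_prop⟩, fun y => h2 _, fun y => h3 _⟩,
    fun t y hy => ?_⟩⟩⟩
  obtain ⟨x, hx⟩ := hF y hy
  change H (F y, t) = F y
  rw [← hx, h4]

theorem PairConn.mono {k l : ℕ} {i : C(A, B)} (h : PairConn l i) (hkl : k ≤ l) : PairConn k i :=
  fun j hj => h j (hj.trans hkl)

/-- A cube of dimension less than `m` in `ℝ^m` can be moved off the origin. -/
theorem exists_approx_ne_zero {j m : ℕ} (hjm : j < m) (h : C(Fin j → unitInterval, Fin m → ℝ))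
    {ε : ℝ} (hε : 0 < ε) :
    ∃ g : C(Fin j → unitInterval, Fin m → ℝ), ∀ y, ‖g y - h y‖ ≤ ε ∧ g y ≠ 0 := by
  -- Projection to the cube extends `h` uniformly continuously to `ℝ^j`. A smooth approximation into
  -- the larger dimension `m` misses points arbitrarily close to 0, and one of these is translated
  -- to 0.
  let P : (Fin j → ℝ) → (Fin j → unitInterval) := fun x i => projIcc 0 1 zero_le_one (x i)
  have hP : UniformContinuous P := uniformContinuous_pi.2 fun i =>
    (LipschitzWith.projIcc zero_le_one).uniformContinuous.comp (Pi.uniformContinuous_proj _ i)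
  obtain ⟨g, hg, hgd⟩ := UniformContinuous.exists_contDiff_dist_le
    ((CompactSpace.uniformContinuous_of_continuous h.continuous).comp hP) (half_pos hε)
  obtain ⟨q, hq, hqd⟩ := (ContDiff.dense_compl_range_of_finrank_lt_finrank (hg.of_le (by simp))
    (by simpa using hjm)).exists_dist_lt (0 : Fin m → ℝ) (half_pos hε)
  refine ⟨⟨fun y => g (fun i => y i) - q, ?_⟩, fun y => ⟨?_, ?_⟩⟩
  · have := hg.continuous
    fun_prop
  · have h1 := hgd fun i => y i
    have h2 : P (fun i => y i) = y := by
      ext i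
      simp [P]
    rw [Function.comp_apply, h2, dist_eq_norm] at h1
    rw [dist_zero_left] at hqd
    calc ‖g (fun i => y i) - q - h y‖ = ‖(g (fun i => y i) - h y) - q‖ := by congr 1; abel
      _ ≤ ‖g (fun i => y i) - h y‖ + ‖q‖ := norm_sub_le _ _
      _ ≤ ε := by linarith
  · exact fun h => hq ⟨_, sub_eq_zero.1 h⟩

variable {ι : Type u} [TopologicalSpace ι] [DiscreteTopology ι] [Finite ι] {m : ℕ}

/-- A cut-off coordinate of the attached cells. -/
theorem IsAttach.exists_coordinate
    {f : C({p : ι × closedBall (0 : Fin m → ℝ) 1 | ‖(p.2 : Fin m → ℝ)‖ = 1}, A)}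
    {a : C(A, B)} {Φ : C(ι × closedBall (0 : Fin m → ℝ) 1, B)} (h : IsAttach _ f a Φ) (i : ι) :
    ∃ w : C(B, Fin m → ℝ), ∀ x : closedBall (0 : Fin m → ℝ) 1, ‖(x : Fin m → ℝ)‖ ≤ 1 / 2 →
      (1 - ‖(x : Fin m → ℝ)‖) • w (Φ (i, x)) = x := by
  classical
  have hpos : ∀ r : ℝ, 0 < max ((1 - r) ^ 2) (1 / 4) := fun r => lt_max_of_lt_right (by norm_num)
  -- This is `x / (1 - ‖x‖)` up to norm one half and vanishes on the boundary, so it extends by zero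
  -- over `A` and the other cells.
  let z : closedBall (0 : Fin m → ℝ) 1 → Fin m → ℝ := fun x =>
    ((1 - ‖(x : Fin m → ℝ)‖) / max ((1 - ‖(x : Fin m → ℝ)‖) ^ 2) (1 / 4)) • (x : Fin m → ℝ)
  have hz : Continuous z := by
    refine Continuous.smul (Continuous.div (by fun_prop) (by fun_prop) fun x => (hpos _).ne')
      continuous_subtype_val
  obtain ⟨w, -, hw⟩ := h.exists_desc (0 : C(A, Fin m → ℝ))
    ⟨fun p => if p.1 = i then z p.2 else 0, by
      rw [continuous_prod_of_discrete_left]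
      intro i'
      by_cases hi : i' = i
      · simpa [hi] using hz
      · simpa [hi] using continuous_const⟩ fun s => by
        have hs : ‖(s.1.2 : Fin m → ℝ)‖ = 1 := s.2
        simp [z, hs]
  refine ⟨w, fun x hx => ?_⟩
  rw [hw]
  have h1 : (1 / 4 : ℝ) ≤ (1 - ‖(x : Fin m → ℝ)‖) ^ 2 := by nlinarith
  have h2 : (1 - ‖(x : Fin m → ℝ)‖) ≠ 0 := by linarith
  simp only [ContinuousMap.coe_mk, if_true, z]
  rw [max_eq_left h1, smul_smul]
  have h3 : (1 - ‖(x : Fin m → ℝ)‖) *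
      ((1 - ‖(x : Fin m → ℝ)‖) / (1 - ‖(x : Fin m → ℝ)‖) ^ 2) = 1 := by field_simp
  rw [h3, one_smul]

/-- A small perturbation in the coordinates of each cell moves the cube off all centres, since its
dimension is less than `m`. By compactness it stays at a positive distance from them, and radial
expansion then pushes it into `A`. Both homotopies are stationary on `A`, hence on the boundary of
the cube. -/
theorem IsAttach.pairConn {k : ℕ} (hkm : k < m)
    {f : C({p : ι × closedBall (0 : Fin m → ℝ) 1 | ‖(p.2 : Fin m → ℝ)‖ = 1}, A)}
    {a : C(A, B)} {Φ : C(ι × closedBall (0 : Fin m → ℝ) 1, B)} (h : IsAttach _ f a Φ)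
    (ha : IsEmbedding a) : PairConn k a := by
  intro j hj F hF
  choose w hw using h.exists_coordinate
  choose g hg using fun i => exists_approx_ne_zero (hj.trans_lt hkm) ((w i).comp F)
    (show (0 : ℝ) < 1 / 4 by norm_num)
  -- `N` measures the distance from the centres and is 1 on `A`.
  obtain ⟨N, hNA, hNΦ⟩ := h.exists_desc (1 : C(A, ℝ)) ⟨fun p => ‖(p.2 : Fin m → ℝ)‖, by fun_prop⟩
    fun s => s.2
  have hball : ∀ (x : closedBall (0 : Fin m → ℝ) 1) (t : unitInterval) (v : Fin m → ℝ),
      ‖v‖ ≤ 1 / 4 → (x + ((t : ℝ) * (1 - ‖(x : Fin m → ℝ)‖)) • v : Fin m → ℝ) ∈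
        closedBall (0 : Fin m → ℝ) 1 := fun x t v hv => by
    have hx : ‖(x : Fin m → ℝ)‖ ≤ 1 := mem_closedBall_zero_iff.1 x.2
    rw [mem_closedBall_zero_iff]
    refine (norm_add_le _ _).trans ?_
    rw [norm_smul, norm_mul, Real.norm_of_nonneg t.2.1, Real.norm_of_nonneg (sub_nonneg.2 hx)]
    have h1 : (t : ℝ) * (1 - ‖(x : Fin m → ℝ)‖) ≤ 1 - ‖(x : Fin m → ℝ)‖ :=
      mul_le_of_le_one_left (sub_nonneg.2 hx) t.2.2
    have h2 : 0 ≤ (t : ℝ) * (1 - ‖(x : Fin m → ℝ)‖) := mul_nonneg t.2.1 (sub_nonneg.2 hx)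
    nlinarith [norm_nonneg v]
  let v : ι → (Fin j → unitInterval) → Fin m → ℝ := fun i y => g i y - w i (F y)
  have hv : ∀ i, Continuous (v i) := fun i => by fun_prop
  -- The factor `1 - ‖x‖` stops the motion at the boundary of the cells and matches the denominator
  -- in the coordinate: for `‖x‖ ≤ 1 / 2` the final position is `(1 - ‖x‖) • g i y`, which is
  -- nonzero.
  obtain ⟨μ, hμA, hμΦ⟩ := h.exists_desc_prod (Z := B) (I := (Fin j → unitInterval) × unitInterval)
    ⟨fun p => a p.1, by fun_prop⟩
    ⟨fun p => Φ (p.1.1, ⟨p.1.2 + ((p.2.2 : ℝ) * (1 - ‖(p.1.2 : Fin m → ℝ)‖)) • v p.1.1 p.2.1,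
      hball _ _ _ (hg _ _).1⟩), by
      have hc : Continuous fun p : ι × (Fin j → unitInterval) => v p.1 p.2 :=
        continuous_prod_of_discrete_left.2 hv
      have hc' : Continuous fun p : (ι × closedBall (0 : Fin m → ℝ) 1) ×
          ((Fin j → unitInterval) × unitInterval) => v p.1.1 p.2.1 :=
        hc.comp (f := fun p : (ι × closedBall (0 : Fin m → ℝ) 1) ×
          ((Fin j → unitInterval) × unitInterval) => (p.1.1, p.2.1)) (by fun_prop)
      refine Φ.continuous.comp ((continuous_fst.comp continuous_fst).prodMk
        (Continuous.subtype_mk ?_ _))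
      have hd : Continuous fun p : (ι × closedBall (0 : Fin m → ℝ) 1) ×
          ((Fin j → unitInterval) × unitInterval) => (p.1.2 : Fin m → ℝ) := by fun_prop
      have hk : Continuous fun p : (ι × closedBall (0 : Fin m → ℝ) 1) ×
          ((Fin j → unitInterval) × unitInterval) =>
            (p.2.2 : ℝ) * (1 - ‖(p.1.2 : Fin m → ℝ)‖) := by fun_prop
      exact hd.add (hk.smul hc')⟩ fun s t => by
        refine Eq.trans ?_ (h.apply_coe s)
        have hs : ‖(s.1.2 : Fin m → ℝ)‖ = 1 := s.2
        refine congrArg Φ (Prod.ext rfl (Subtype.ext ?_))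
        simp [hs]
  have hμ0 : ∀ e y, μ (e, (y, 0)) = e := fun e y => by
    rcases h.exists_rep e with ⟨x, rfl⟩ | ⟨d, -, rfl⟩
    · exact hμA x _
    · rw [hμΦ]
      refine congrArg Φ (Prod.ext rfl (Subtype.ext ?_))
      simp
  let F₁ : C(Fin j → unitInterval, B) := ⟨fun y => μ (F y, (y, 1)), by fun_prop⟩
  have hF₁ : F.HomotopicRel F₁ (Cube.boundary (Fin j)) := by
    refine ⟨⟨⟨⟨fun p => μ (F p.2, (p.2, p.1)), by fun_prop⟩, fun y => hμ0 _ _, fun y => rfl⟩,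
      fun t y hy => ?_⟩⟩
    obtain ⟨x, hx⟩ := hF y hy
    change μ (F y, (y, t)) = F y
    rw [← hx]
    exact hμA x _
  have hN : ∀ y, 0 < N (F₁ y) := fun y => by
    change 0 < N (μ (F y, (y, 1)))
    rcases h.exists_rep (F y) with ⟨x, hx⟩ | ⟨⟨i, x⟩, -, hx⟩
    · rw [← hx, hμA]
      exact (hNA x).symm ▸ one_pos
    · have hvy : ‖v i y‖ ≤ 1 / 4 := (hg i y).1
      rw [← hx, hμΦ]
      refine lt_of_lt_of_eq ?_ (hNΦ _).symm
      change 0 < ‖(x : Fin m → ℝ) + (((1 : unitInterval) : ℝ) * (1 - ‖(x : Fin m → ℝ)‖)) • v i y‖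
      rw [Icc.coe_one, one_mul]
      rcases le_or_gt ‖(x : Fin m → ℝ)‖ (1 / 2) with hx' | hx'
      · have h1 := hw i x hx'
        have h2 : (x : Fin m → ℝ) + (1 - ‖(x : Fin m → ℝ)‖) • v i y =
            (1 - ‖(x : Fin m → ℝ)‖) • g i y := by
          simp only [v, smul_sub]
          rw [← hx, h1]
          abel
        rw [h2, norm_pos_iff]
        exact smul_ne_zero (by linarith) (hg i y).2
      -- Farther out the displacement is at most `(1 - ‖x‖) / 4`, too small to reach the centre.
      · have hx1 : ‖(x : Fin m → ℝ)‖ ≤ 1 := mem_closedBall_zero_iff.1 x.2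
        have h1 := norm_sub_norm_le (x : Fin m → ℝ) (-((1 - ‖(x : Fin m → ℝ)‖) • v i y))
        rw [norm_neg, sub_neg_eq_add, norm_smul, Real.norm_of_nonneg (sub_nonneg.2 hx1)] at h1
        nlinarith [norm_nonneg (v i y)]
  obtain ⟨y₀, -, hy₀⟩ := isCompact_univ.exists_isMinOn univ_nonempty
    (N.comp F₁).continuous.continuousOn
  have hε : 0 < N (F₁ y₀) := hN y₀
  set ε := N (F₁ y₀) with hεdef
  have hNε : ∀ y, ε ≤ N (F₁ y) := fun y => hy₀ (mem_univ y)
  have hκ : ∀ t : unitInterval, 1 ≤ 1 + (t : ℝ) / ε := fun t =>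
    le_add_of_nonneg_right (div_nonneg t.2.1 hε.le)
  have hpos : ∀ r : ℝ, 0 < max 1 r := fun r => lt_max_of_lt_left one_pos
  -- Points expand by the factor `1 + t / ε` until they reach the boundary sphere. At time 1 every
  -- point of norm at least `ε` has arrived.
  obtain ⟨ρ, hρA, hρΦ⟩ := h.exists_desc_prod (Z := B) (I := unitInterval)
    ⟨fun p => a p.1, by fun_prop⟩
    ⟨fun p => Φ (p.1.1, ⟨((1 + (p.2 : ℝ) / ε) /
      max 1 ((1 + (p.2 : ℝ) / ε) * ‖(p.1.2 : Fin m → ℝ)‖)) • (p.1.2 : Fin m → ℝ), by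
        have h1 : (0 : ℝ) ≤ 1 + (p.2 : ℝ) / ε := zero_le_one.trans (hκ p.2)
        rw [mem_closedBall_zero_iff, norm_smul, norm_div, Real.norm_of_nonneg h1,
          Real.norm_of_nonneg (hpos _).le, div_mul_eq_mul_div, div_le_one (hpos _)]
        exact le_max_right _ _⟩), by
      refine Φ.continuous.comp ((continuous_fst.comp continuous_fst).prodMk
        (Continuous.subtype_mk ?_ _))
      exact (Continuous.div (by fun_prop) (by fun_prop) fun p => (hpos _).ne').smul
        (by fun_prop)⟩ fun s t => by
        refine Eq.trans ?_ (h.apply_coe s)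
        have hs : ‖(s.1.2 : Fin m → ℝ)‖ = 1 := s.2
        refine congrArg Φ (Prod.ext rfl (Subtype.ext ?_))
        simp only [hs, mul_one, max_eq_right (hκ t)]
        rw [div_self (zero_lt_one.trans_le (hκ t)).ne', one_smul]
  have hρ0 : ∀ e, ρ (e, 0) = e := fun e => by
    rcases h.exists_rep e with ⟨x, rfl⟩ | ⟨d, -, rfl⟩
    · exact hρA x _
    · rw [hρΦ]
      refine congrArg Φ (Prod.ext rfl (Subtype.ext ?_))
      have hd : ‖(d.2 : Fin m → ℝ)‖ ≤ 1 := mem_closedBall_zero_iff.1 d.2.2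
      simp [max_eq_left hd]
  let F₂ : C(Fin j → unitInterval, B) := ⟨fun y => ρ (F₁ y, 1), by fun_prop⟩
  have hF₂ : F₁.HomotopicRel F₂ (Cube.boundary (Fin j)) := by
    refine ⟨⟨⟨⟨fun p => ρ (F₁ p.2, p.1), by fun_prop⟩, fun y => hρ0 _, fun y => rfl⟩,
      fun t y hy => ?_⟩⟩
    obtain ⟨x, hx⟩ := hF y hy
    change ρ (F₁ y, t) = F₁ y
    rw [← hF₁.fst_eq_snd hy, ← hx]
    exact hρA x _
  have hr : ∀ y, ∃ x, a x = F₂ y := fun y => by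
    change ∃ x, a x = ρ (F₁ y, 1)
    have hy := hNε y
    rcases h.exists_rep (F₁ y) with ⟨x, hx⟩ | ⟨⟨i, x⟩, -, hx⟩
    · exact ⟨x, by rw [← hx, hρA]; rfl⟩
    · rw [← hx, hρΦ]
      rw [← hx, hNΦ] at hy
      change ε ≤ ‖(x : Fin m → ℝ)‖ at hy
      refine ⟨_, (h.apply_of_mem ?_).symm⟩
      change ‖_ • (x : Fin m → ℝ)‖ = 1
      have h1 : (0 : ℝ) ≤ 1 + 1 / ε := by positivity
      have h2 : 1 ≤ (1 + 1 / ε) * ‖(x : Fin m → ℝ)‖ := by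
        have : 1 / ε * ε = 1 := by field_simp
        nlinarith [norm_nonneg (x : Fin m → ℝ), one_div_pos.2 hε]
      rw [Icc.coe_one, norm_smul, max_eq_right h2, norm_div, Real.norm_of_nonneg h1,
        Real.norm_of_nonneg (zero_le_one.trans h2), div_mul_eq_mul_div,
        div_self (zero_lt_one.trans_le h2).ne']
  choose G hG using hr
  have hGc : Continuous G := ha.continuous_iff.2 (by
    have : a ∘ G = F₂ := funext hG
    rw [this]
    exact F₂.continuous)
  refine ⟨⟨G, hGc⟩, ?_⟩
  have : a.comp ⟨G, hGc⟩ = F₂ := ContinuousMap.ext hG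
  rw [this]
  exact hF₁.trans hF₂

/-! ### Homotopy groups -/

theorem PairConn.surjective_piMap {n : ℕ} {i : C(A, B)} (h : PairConn n i)
    (hi : Function.Injective i) (x : A) : Function.Surjective (piMap n i x) := by
  intro q
  induction q using Quotient.inductionOn with
  | h p =>
    obtain ⟨G, hG⟩ := h n le_rfl p.1 fun y hy => ⟨x, (p.2 y hy).symm⟩
    have hGx : ∀ y ∈ Cube.boundary (Fin n), G y = x := fun y hy =>
      hi ((hG.fst_eq_snd hy).symm.trans (p.2 y hy))
    exact ⟨Quotient.mk _ ⟨G, hGx⟩, Quotient.sound hG.symm⟩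

/-- A homotopy in `B` between two loops of `A` is an `(n+1)`-cube with boundary in `A`, time being
coordinate 0. Its compression is a homotopy in `A`. -/
theorem PairConn.injective_piMap {n : ℕ} {i : C(A, B)} (h : PairConn (n + 1) i)
    (hi : Function.Injective i) (x : A) : Function.Injective (piMap n i x) := by
  intro q q' hq
  induction q using Quotient.inductionOn with
  | h p =>
  induction q' using Quotient.inductionOn with
  | h p' =>
    obtain ⟨H⟩ : (i.comp p.1).HomotopicRel (i.comp p'.1) (Cube.boundary (Fin n)) :=
      Quotient.exact hq
    have hpb : ∀ y ∈ Cube.boundary (Fin n), p.1 y = x := p.2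
    have hpb' : ∀ y ∈ Cube.boundary (Fin n), p'.1 y = x := p'.2
    have hF : ∀ y ∈ Cube.boundary (Fin (n + 1)), H (y 0, Fin.tail y) ∈ range i := by
      rintro y ⟨k, hk⟩
      induction k using Fin.cases with
      | zero =>
        rcases hk with hk | hk
        · rw [hk]
          exact ⟨p.1 (Fin.tail y), (H.apply_zero _).symm⟩
        · rw [hk]
          exact ⟨p'.1 (Fin.tail y), (H.apply_one _).symm⟩
      | succ k =>
        have : Fin.tail y ∈ Cube.boundary (Fin n) := ⟨k, hk⟩
        exact ⟨p.1 (Fin.tail y), (H.eq_fst _ this).symm⟩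
    have htail : Continuous fun y : Fin (n + 1) → unitInterval => (Fin.tail y : Fin n → unitInterval) :=
      continuous_pi fun k => continuous_apply _
    obtain ⟨G, hG⟩ := h (n + 1) le_rfl ⟨fun y => H (y 0, Fin.tail y),
      H.continuous.comp ((continuous_apply _).prodMk htail)⟩ hF
    have hG' : ∀ (t : unitInterval) (y : Fin n → unitInterval),
        (Fin.cons t y : Fin (n + 1) → unitInterval) ∈ Cube.boundary (Fin (n + 1)) →
          H (t, y) = i (G (Fin.cons t y)) := fun t y hy => hG.fst_eq_snd hy
    refine Quotient.sound ⟨⟨⟨⟨fun z => G (Fin.cons z.1 z.2), ?_⟩, fun y => ?_, fun y => ?_⟩,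
      fun t y hy => ?_⟩⟩
    · refine G.continuous.comp (continuous_pi fun k => ?_)
      induction k using Fin.cases with
      | zero => exact continuous_fst
      | succ k => exact (continuous_apply k).comp continuous_snd
    · exact hi ((hG' 0 y ⟨0, Or.inl rfl⟩).symm.trans (H.apply_zero y))
    · exact hi ((hG' 1 y ⟨0, Or.inr rfl⟩).symm.trans (H.apply_one y))
    · obtain ⟨k, hk⟩ := id hy
      exact hi ((hG' t y ⟨k.succ, hk⟩).symm.trans (H.eq_fst t hy))

theorem PairConn.bijective_piMap {n : ℕ} {i : C(A, B)} (h : PairConn (n + 1) i)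
    (hi : Function.Injective i) (x : A) : Function.Bijective (piMap n i x) :=
  ⟨h.injective_piMap hi x, (h.mono n.le_succ).surjective_piMap hi x⟩

theorem piMap_mul {n : ℕ} (i : C(A, B)) (x : A) (q q' : HomotopyGroup.Pi (n + 1) A x) :
    piMap (n + 1) i x (q * q') = piMap (n + 1) i x q * piMap (n + 1) i x q' := by
  induction q using Quotient.inductionOn with
  | h p =>
  induction q' using Quotient.inductionOn with
  | h p' =>
    have h1 := HomotopyGroup.mul_spec (i := (0 : Fin (n + 1))) (p := p) (q := p')
    let m : GenLoop (Fin (n + 1)) A x → GenLoop (Fin (n + 1)) B (i x) := fun p =>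
      ⟨i.comp p.1, fun y hy => congrArg i (p.2 y hy)⟩
    have h2 := HomotopyGroup.mul_spec (i := (0 : Fin (n + 1))) (p := m p) (q := m p')
    refine (congrArg (piMap (n + 1) i x) h1).trans (Eq.trans ?_ h2.symm)
    refine congrArg (Quotient.mk _) (Subtype.ext (ContinuousMap.ext fun y => ?_))
    change i (GenLoop.transAt 0 p' p y) = GenLoop.transAt 0 (m p') (m p) y
    simp only [GenLoop.transAt, GenLoop.coe_copy]
    split_ifs <;> rfl

end PairConn

/-! ### The stages of the filtration -/

section Filtration

variable {X : Type u} [TopologicalSpace X] [T2Space X] {C : Set X} [CWComplex C]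
  {E F : RelCWComplex.Subcomplex C}

theorem injective_incl {A B : Set X} (h : A ⊆ B) : Function.Injective (incl h) :=
  inclusion_injective h

theorem pairConn_incl_self (A : Set X) (k : ℕ) : PairConn k (incl (subset_refl A)) :=
  fun _ _ F _ => ⟨F, ContinuousMap.HomotopicRel.refl _⟩

theorem Collapses.pairConn (h : Collapses E F) (k : ℕ) : PairConn k (incl h.subset) := by
  induction h with
  | refl => exact pairConn_incl_self _ k
  | tail h h' ih => exact PairConn.comp (h'.isSDR.pairConn k) ih (injective_incl _)

/-- Each further stage is an inverse collapse followed by attaching cells of dimension `n + 1 > k`;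
both steps allow compression of `k`-cubes. -/
theorem VectorField.IsGradient.pairConn_X' [CWComplex.Finite C] {V : VectorField C}
    (hV : V.IsGradient) (hC : FaceCondition C) {k n : ℕ} (h : k ≤ n) :
    ∃ hkn : (V.X' k : Set X) ⊆ V.X' n, PairConn k (incl hkn) := by
  induction n, h using Nat.le_induction with
  | base => exact ⟨subset_refl _, pairConn_incl_self _ k⟩
  | succ n hkn ih =>
    obtain ⟨h1, h2⟩ := ih
    have hfin : Finite (RelCWComplex.cell C (n + 1)) := CWComplex.FiniteType.finite_cell _
    let ι : Type u := {c : RelCWComplex.cell C (n + 1) | V.IsCritical (n + 1) c}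
    let _ : TopologicalSpace ι := ⊥
    have : DiscreteTopology ι := ⟨rfl⟩
    have : Finite ι := inferInstanceAs
      (Finite {c : RelCWComplex.cell C (n + 1) | V.IsCritical (n + 1) c})
    obtain ⟨f, Φ, hf, -⟩ := V.isAttach_X' (n := n + 1)
    have h3 := IsAttach.pairConn (ι := ι) (Nat.lt_succ_of_le hkn) hf
      (isClosedEmbedding_incl _ (V.X'' (n + 1)).closed).isEmbedding
    have h4 := (hV.collapses_X'' hC n).pairConn k
    exact ⟨h1.trans ((hV.collapses_X'' hC n).subset.trans (V.X''_le_X' _)),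
      (h2.comp h4 (injective_incl _)).comp h3 (injective_incl _)⟩

theorem VectorField.IsGradient.pairConn [CWComplex.Finite C] {V : VectorField C}
    (hV : V.IsGradient) (hC : FaceCondition C) (k : ℕ) :
    ∃ h : (V.X' k : Set X) ⊆ C, PairConn k (incl h) := by
  obtain ⟨N, hN⟩ := VectorField.exists_X'_eq (V := V)
  obtain ⟨h1, h2⟩ := hV.pairConn_X' hC (le_max_left k N)
  have : ∀ (B : Set X) (_ : (V.X' (max k N) : Set X) = B),
      ∃ h : (V.X' k : Set X) ⊆ B, PairConn k (incl h) := by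
    rintro _ rfl
    exact ⟨h1, h2⟩
  exact this C (hN _ (le_max_right _ _))

end Filtration

end

/-! ### Connectedness, forests and trees -/

section

variable {X : Type u} [TopologicalSpace X] [T2Space X] {C : Set X} [CWComplex C]

/-! ### Connectedness -/

section Connected

theorem isPathConnected_closedCell (n : ℕ) (c : RelCWComplex.cell C n) :
    IsPathConnected (RelCWComplex.closedCell n c) :=
  ((convex_closedBall (0 : Fin n → ℝ) 1).isPathConnected
    (nonempty_closedBall.2 zero_le_one)).image' (RelCWComplex.continuousOn n c)

theorem exists_mem_closedCell {x : X} (hx : x ∈ C) :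
    ∃ p : Σ n, RelCWComplex.cell C n, x ∈ RelCWComplex.closedCell p.1 p.2 := by
  rw [← CWComplex.iUnion_openCell_eq_complex (C := C)] at hx
  simp only [mem_iUnion] at hx
  obtain ⟨m, i, hx⟩ := hx
  exact ⟨⟨m, i⟩, RelCWComplex.openCell_subset_closedCell _ _ hx⟩

/-- A connected finite complex is path connected. -/
theorem isPathConnected_of_isConnected [CWComplex.Finite C] (hC : IsConnected C) :
    IsPathConnected C := by
  have hfin : Finite (Σ n, RelCWComplex.cell C n) := CWComplex.finite_cells_of_finite
  obtain ⟨x, hx⟩ := hC.nonempty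
  refine ⟨x, hx, ?_⟩
  -- The closed cells that can be reached from `x` by a path and those that cannot form two closed
  -- sets covering `C`; a common point would contradict the definition of the second.
  let U : Set X := ⋃ p ∈ {p : Σ n, RelCWComplex.cell C n |
    ∃ y ∈ RelCWComplex.closedCell p.1 p.2, JoinedIn C x y}, RelCWComplex.closedCell p.1 p.2
  let U' : Set X := ⋃ p ∈ {p : Σ n, RelCWComplex.cell C n |
    ¬ ∃ y ∈ RelCWComplex.closedCell p.1 p.2, JoinedIn C x y}, RelCWComplex.closedCell p.1 p.2
  have hU : IsClosed U :=
    (Set.toFinite _).isClosed_biUnion fun p _ => RelCWComplex.isClosed_closedCell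
  have hU' : IsClosed U' :=
    (Set.toFinite _).isClosed_biUnion fun p _ => RelCWComplex.isClosed_closedCell
  have hUJ : ∀ y ∈ U, JoinedIn C x y := fun y hy => by
    obtain ⟨p, ⟨z, hz, hxz⟩, hyp⟩ := mem_iUnion₂.1 hy
    exact hxz.trans (((isPathConnected_closedCell p.1 p.2).joinedIn z hz y hyp).mono
      (RelCWComplex.closedCell_subset_complex _ _))
  have hcov : C ⊆ U ∪ U' := fun y hy => by
    obtain ⟨p, hp⟩ := exists_mem_closedCell hy
    by_cases h : ∃ y ∈ RelCWComplex.closedCell p.1 p.2, JoinedIn C x y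
    · exact Or.inl (mem_biUnion (x := p) h hp)
    · exact Or.inr (mem_biUnion (x := p) h hp)
  intro y hy
  rcases hcov hy with h | h
  · exact hUJ y h
  exfalso
  have hxU : x ∈ U := by
    obtain ⟨p, hp⟩ := exists_mem_closedCell hx
    exact mem_biUnion (x := p) ⟨x, hp, JoinedIn.refl hx⟩ hp
  obtain ⟨z, -, hz, hz'⟩ := isPreconnected_closed_iff.1 hC.isPreconnected U U' hU hU' hcov
    ⟨x, hx, hxU⟩ ⟨y, hy, h⟩
  obtain ⟨p, hp, hzp⟩ := mem_iUnion₂.1 hz'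
  exact hp ⟨z, hzp, hUJ z hz⟩

/-- Compressing a 1-cube turns a path of `B` with ends in `A` into a path of `A`. A 0-cube, whose
boundary is empty, shows that `A` is non-empty. -/
theorem PairConn.pathConnectedSpace {A B : Type u} [TopologicalSpace A] [TopologicalSpace B]
    [PathConnectedSpace B] {i : C(A, B)} (h : PairConn 1 i) (hi : Function.Injective i) :
    PathConnectedSpace A := by
  refine ⟨?_, fun x y => ?_⟩
  · obtain ⟨G, -⟩ := h 0 zero_le_one (ContinuousMap.const _ (Nonempty.some inferInstance))
      fun y hy => hy.choose.elim0
    exact ⟨G fun _ => 0⟩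
  · obtain ⟨p⟩ := PathConnectedSpace.joined (i x) (i y)
    have hb : ∀ z ∈ Cube.boundary (Fin 1), p (z 0) ∈ range i := by
      rintro z ⟨k, hk⟩
      rw [Subsingleton.elim k 0] at hk
      rcases hk with hk | hk
      · exact ⟨x, by rw [hk, p.source]⟩
      · exact ⟨y, by rw [hk, p.target]⟩
    obtain ⟨G, hG⟩ := h 1 le_rfl ⟨fun z => p (z 0), by fun_prop⟩ hb
    refine ⟨⟨⟨fun t => G fun _ => t, by fun_prop⟩, hi ?_, hi ?_⟩⟩
    · exact ((hG.fst_eq_snd ⟨0, Or.inl rfl⟩).symm.trans p.source)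
    · exact ((hG.fst_eq_snd ⟨0, Or.inr rfl⟩).symm.trans p.target)

theorem VectorField.IsGradient.isConnected_X'_one [CWComplex.Finite C] {V : VectorField C}
    (hV : V.IsGradient) (hC : FaceCondition C) (h : IsConnected C) :
    IsConnected (V.X' 1 : Set X) := by
  obtain ⟨h1, h2⟩ := hV.pairConn hC 1
  have : PathConnectedSpace C := isPathConnected_iff_pathConnectedSpace.1
    (isPathConnected_of_isConnected h)
  have := h2.pathConnectedSpace (injective_incl h1)
  exact isConnected_iff_connectedSpace.2 inferInstance

/-- A connected graph with at least one edge is the union of its closed edges. -/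
theorem IsGraph.eq_iUnion_closedCell [CWComplex.Finite C] {E : RelCWComplex.Subcomplex C}
    (hE : IsGraph E) (hc : IsPreconnected (E : Set X)) (hne : (E.I 1).Nonempty) :
    (E : Set X) = ⋃ e ∈ E.I 1, RelCWComplex.closedCell 1 e := by
  have h0 : Finite (RelCWComplex.cell C 0) := CWComplex.FiniteType.finite_cell 0
  have h1 : Finite (RelCWComplex.cell C 1) := CWComplex.FiniteType.finite_cell 1
  set M : Set X := ⋃ e ∈ E.I 1, RelCWComplex.closedCell 1 e with hM
  -- These are the vertices on no edge: a closed set disjoint from the edges, which connectedness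
  -- forbids once an edge exists.
  let Z : Set X := ⋃ v ∈ {v : RelCWComplex.cell C 0 | v ∈ E.I 0 ∧
    ¬ RelCWComplex.closedCell 0 v ⊆ M}, RelCWComplex.closedCell 0 v
  have hMc : IsClosed M := (Set.toFinite _).isClosed_biUnion fun p _ =>
    RelCWComplex.isClosed_closedCell
  have hZc : IsClosed Z := (Set.toFinite _).isClosed_biUnion fun p _ =>
    RelCWComplex.isClosed_closedCell
  have hME : M ⊆ E := iUnion₂_subset fun e he => closedCell_subset_of_mem he
  have hcov : (E : Set X) ⊆ M ∪ Z := fun x hx => by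
    obtain ⟨m, i, hi, hxi⟩ := mem_subcomplex_iff.1 hx
    have hxi' := RelCWComplex.openCell_subset_closedCell _ _ hxi
    match m, i, hi, hxi' with
    | 0, i, hi, hxi' =>
      by_cases h : RelCWComplex.closedCell 0 i ⊆ M
      · exact Or.inl (h hxi')
      · exact Or.inr (mem_biUnion (x := i) ⟨hi, h⟩ hxi')
    | 1, i, hi, hxi' => exact Or.inl (mem_biUnion hi hxi')
    | m + 2, i, hi, _ =>
      rw [hE (m + 2) (by omega)] at hi
      exact absurd hi (notMem_empty i)
  refine subset_antisymm (fun x hx => ?_) hME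
  rcases hcov hx with h | h
  · exact h
  exfalso
  obtain ⟨e, he⟩ := hne
  obtain ⟨y, hy⟩ := RelCWComplex.closedCell_nonempty 1 e
  have hyM : y ∈ M := mem_biUnion he hy
  obtain ⟨z, -, hz, hz'⟩ := isPreconnected_closed_iff.1 hc M Z hMc hZc hcov
    ⟨y, hME hyM, hyM⟩ ⟨x, hx, h⟩
  obtain ⟨v, hv, hzv⟩ := mem_iUnion₂.1 hz'
  apply hv.2
  rw [RelCWComplex.closedCell_zero_eq_singleton] at hzv ⊢
  rw [mem_singleton_iff] at hzv
  rw [singleton_subset_iff, ← hzv]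
  exact hz

end Connected

/-! ### Trees and forests -/

section Tree

/-- The components of a space homotopy equivalent to a discrete one are contractible. -/
theorem contractibleSpace_connectedComponentIn {Y : Type*} [TopologicalSpace Y]
    [DiscreteTopology Y] {E : Set X} (e : ContinuousMap.HomotopyEquiv E Y) {x : X} (hx : x ∈ E) :
    ContractibleSpace (connectedComponentIn E x) := by
  have hsub : connectedComponentIn E x ⊆ E := connectedComponentIn_subset E x
  have hpre : IsPreconnected (connectedComponentIn E x) := isPreconnected_connectedComponentIn
  have hps : PreconnectedSpace (connectedComponentIn E x) := Subtype.preconnectedSpace hpre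
  obtain ⟨H⟩ := e.left_inv
  have hxK : x ∈ connectedComponentIn E x := mem_connectedComponentIn hx
  have hconst : ∀ y : connectedComponentIn E x, e (inclusion hsub y) = e ⟨x, hx⟩ := fun y =>
    PreconnectedSpace.constant hps (f := fun y => e (inclusion hsub y))
      (e.toFun.continuous.comp (continuous_inclusion hsub)) (x := y) (y := ⟨x, hxK⟩)
  have hHc : Continuous fun p : unitInterval × connectedComponentIn E x =>
      (H (p.1, inclusion hsub p.2) : X) := by
    have := continuous_inclusion hsub
    fun_prop
  -- The homotopy restricted to the component has connected image containing `x` at time 1, so it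
  -- never leaves the component.
  have hHK : ∀ p : unitInterval × connectedComponentIn E x,
      (H (p.1, inclusion hsub p.2) : X) ∈ connectedComponentIn E x := fun p => by
    refine (isPreconnected_range hHc).subset_connectedComponentIn ?_ ?_ (mem_range_self p)
    · refine ⟨(1, ⟨x, hxK⟩), ?_⟩
      exact congrArg Subtype.val (H.apply_one _)
    · rintro _ ⟨q, rfl⟩
      exact Subtype.coe_prop _
  rw [contractible_iff_id_nullhomotopic]
  refine ⟨⟨(H (0, ⟨x, hx⟩) : X), hHK (0, ⟨x, hxK⟩)⟩, ContinuousMap.Homotopic.symm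
    ⟨⟨⟨fun p => ⟨_, hHK p⟩, hHc.subtype_mk _⟩, fun y => ?_, fun y => ?_⟩⟩⟩
  · refine Subtype.ext ?_
    change (H (0, inclusion hsub y) : X) = H (0, ⟨x, hx⟩)
    rw [H.apply_zero, H.apply_zero]
    exact congrArg (fun z => (e.invFun z : X)) (hconst y)
  · refine Subtype.ext ?_
    change (H (1, inclusion hsub y) : X) = y
    rw [H.apply_one]
    rfl

namespace VectorField

variable {V : VectorField C}

theorem coe_X''_one : (V.X'' 1 : Set X) = (RelCWComplex.skeleton C 0 : Set X) ∪
    ⋃ (e : RelCWComplex.cell C 1) (_ : V.IsCollapsible 1 e), RelCWComplex.closedCell 1 e := by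
  ext x
  constructor
  · intro hx
    obtain ⟨m, i, hi, hxi⟩ := mem_subcomplex_iff.1 hx
    rw [mem_X''_I] at hi
    obtain ⟨hm, hi⟩ := hi
    match m, i, hm, hi, hxi with
    | 0, i, _, _, hxi => exact Or.inl (CWComplex.mem_skeleton_iff.2 ⟨0, le_rfl, i, hxi⟩)
    | 1, i, _, hi, hxi =>
      exact Or.inr (mem_iUnion₂.2 ⟨i, hi rfl, RelCWComplex.openCell_subset_closedCell _ _ hxi⟩)
  · rintro (hx | hx)
    · obtain ⟨m, hm, i, hxi⟩ := CWComplex.mem_skeleton_iff.1 hx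
      have hm : m ≤ 0 := by exact_mod_cast hm
      exact mem_subcomplex_iff.2 ⟨m, i, mem_X''_I.2 ⟨by omega, fun h => by omega⟩, hxi⟩
    · obtain ⟨e, he, hx⟩ := mem_iUnion₂.1 hx
      exact closedCell_subset_of_mem (E := V.X'' 1) (mem_X''_I.2 ⟨le_rfl, fun _ => he⟩) hx

theorem isGraph_X'' : IsGraph (V.X'' 1) := fun n hn =>
  eq_empty_of_forall_notMem fun i hi => by
    have := (mem_X''_I.1 hi).1
    omega

theorem isGraph_X' : IsGraph (V.X' 1) := fun n hn =>
  eq_empty_of_forall_notMem fun i hi => by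
    have := (mem_X'_I.1 hi).1
    omega

theorem X''_one_I_zero : (V.X'' 1).I 0 = univ :=
  eq_univ_of_forall fun i => mem_X''_I.2 ⟨zero_le_one, fun h => by omega⟩

theorem mem_X'_zero {x : X} : x ∈ V.X' 0 ↔ ∃ v : RelCWComplex.cell C 0, V.IsCritical 0 v ∧
    x = RelCWComplex.map 0 v ![] := by
  rw [mem_subcomplex_iff]
  constructor
  · rintro ⟨m, v, hv, hx⟩
    obtain ⟨hm, hv⟩ := mem_X'_I.1 hv
    obtain rfl : m = 0 := by omega
    refine ⟨v, ⟨hv rfl, fun h => h⟩, ?_⟩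
    rwa [RelCWComplex.openCell_zero_eq_singleton] at hx
  · rintro ⟨v, hv, rfl⟩
    refine ⟨0, v, mem_X'_I.2 ⟨le_rfl, fun _ => hv.1⟩, ?_⟩
    rw [RelCWComplex.openCell_zero_eq_singleton]
    rfl

/-- `X''_1` collapses to `X'_0`, which is finite and Hausdorff, hence discrete; a space homotopy
equivalent to it has contractible components. -/
theorem IsGradient.isMaximalForest [CWComplex.Finite C] (hV : V.IsGradient)
    (hC : FaceCondition C) : IsMaximalForest (V.X'' 1) := by
  have hfin : Finite (RelCWComplex.cell C 0) := CWComplex.FiniteType.finite_cell 0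
  have : Finite (V.X' 0 : Set X) := by
    refine Set.Finite.to_subtype ((Set.finite_range
      fun v : RelCWComplex.cell C 0 => RelCWComplex.map 0 v ![]).subset fun x hx => ?_)
    obtain ⟨v, -, rfl⟩ := mem_X'_zero.1 hx
    exact mem_range_self v
  have : DiscreteTopology (V.X' 0 : Set X) := inferInstance
  obtain ⟨e⟩ := (hV.collapses_X'' hC 0).deformEquiv.homotopyEquiv
  exact ⟨⟨isGraph_X'', fun x hx => contractibleSpace_connectedComponentIn e.symm hx⟩,
    X''_one_I_zero⟩

theorem IsGradient.isMaximalTree [CWComplex.Finite C] (hV : V.IsGradient)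
    (hC : FaceCondition C) (h : ∃! v, V.IsCritical 0 v) : IsMaximalTree (V.X'' 1) := by
  obtain ⟨v, hv, huniq⟩ := h
  have : Unique (V.X' 0 : Set X) :=
    { default := ⟨RelCWComplex.map 0 v ![], mem_X'_zero.2 ⟨v, hv, rfl⟩⟩
      uniq := fun x => by
        obtain ⟨w, hw, hx⟩ := mem_X'_zero.1 x.2
        exact Subtype.ext (hx.trans (by rw [huniq w hw])) }
  obtain ⟨e⟩ := (hV.collapses_X'' hC 0).deformEquiv.homotopyEquiv
  exact ⟨⟨isGraph_X'', e.symm.contractibleSpace⟩, X''_one_I_zero⟩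

theorem X''_one_eq_of_isMaximalTree [CWComplex.Finite C] (h : IsMaximalTree (V.X'' 1))
    (hne : ∃ e, V.IsCollapsible 1 e) : (V.X'' 1 : Set X) =
      ⋃ (e : RelCWComplex.cell C 1) (_ : V.IsCollapsible 1 e), RelCWComplex.closedCell 1 e := by
  have := h.1.2
  have hI : ∀ e, e ∈ (V.X'' 1).I 1 ↔ V.IsCollapsible 1 e := fun e =>
    ⟨fun he => (mem_X''_I.1 he).2 rfl, fun he => mem_X''_I.2 ⟨le_rfl, fun _ => he⟩⟩
  have hc : IsPreconnected (V.X'' 1 : Set X) :=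
    (isConnected_iff_connectedSpace.2 inferInstance).isPreconnected
  rw [isGraph_X''.eq_iUnion_closedCell hc (hne.imp fun e => (hI e).2)]
  simp only [hI]

theorem IsGradient.isPreconnected_edges [CWComplex.Finite C] (hV : V.IsGradient)
    (hC : FaceCondition C) (h : IsConnected C) :
    IsPreconnected (⋃ (e : RelCWComplex.cell C 1)
      (_ : V.IsCollapsible 1 e ∨ V.IsCritical 1 e), RelCWComplex.closedCell 1 e) := by
  have hI : ∀ e, e ∈ (V.X' 1).I 1 ↔ V.IsCollapsible 1 e ∨ V.IsCritical 1 e := fun e => by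
    rw [mem_X'_I]
    constructor
    · intro he
      by_cases hcr : V.IsCritical 1 e
      · exact Or.inr hcr
      · exact Or.inl (not_isRedundant_and_not_isCritical.1 ⟨he.2 rfl, hcr⟩)
    · rintro (he | he)
      · exact ⟨le_rfl, fun _ => he.not_isRedundant⟩
      · exact ⟨le_rfl, fun _ => he.1⟩
  simp only [← hI]
  -- With no such edge the union is empty, so only preconnectedness can hold in general.
  rcases ((V.X' 1).I 1).eq_empty_or_nonempty with h0 | h0
  · simpa [h0] using isPreconnected_empty
  · have hc := (hV.isConnected_X'_one hC h).isPreconnected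
    rwa [isGraph_X'.eq_iUnion_closedCell hc h0] at hc

end VectorField

end Tree

end

end DiscreteMorse

end

/-! ### The theorem -/

open DiscreteMorse in
theorem proposition2p2 {X : Type u} [TopologicalSpace X] [T2Space X] (C : Set X) [CWComplex C]
    [CWComplex.Finite C] (hC : FaceCondition C) (V : VectorField C) (hV : V.IsGradient) :
    -- the filtration
    ((V.X'' 0 : Set X) = ∅ ∧ (∀ n, V.X'' n ≤ V.X' n) ∧ (∀ n, V.X' n ≤ V.X'' (n + 1)) ∧
      ∃ N, ∀ n, N ≤ n → (V.X' n : Set X) = C) ∧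
    (∀ n, ObtainedByAttaching (V.X'' n : Set X) (V.X' n) n (V.numCritical n)) ∧
    (∀ n, Collapses (V.X'' (n + 1)) (V.X' n)) ∧
    -- the inclusion of `X'_(n+1)` in `X` induces an isomorphism on `π_n`
    (∀ n, ∃ h : (V.X' (n + 1) : Set X) ⊆ C, ∀ x,
      Function.Bijective (piMap n (incl h) x)) ∧
    (∀ n, ∃ h : (V.X' (n + 2) : Set X) ⊆ C, ∀ x,
      ∃ e : HomotopyGroup.Pi (n + 1) (V.X' (n + 2) : Set X) x ≃*
        HomotopyGroup.Pi (n + 1) C (incl h x), ∀ a, e a = piMap (n + 1) (incl h) x a) ∧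
    (∀ k, (∀ n, k < n → ∀ c, ¬ V.IsCritical n c) →
      Collapses (RelCWComplex.skeleton C ⊤) (V.X' k)) ∧
    (∃ (Y : Type u) (_ : TopologicalSpace Y) (_ : T2Space Y) (_ : CWComplex (univ : Set Y)),
      CWComplex.Finite (univ : Set Y) ∧
      (∀ n, Nat.card (RelCWComplex.cell (univ : Set Y) n) = V.numCritical n) ∧
      Nonempty (ContinuousMap.HomotopyEquiv C Y)) ∧
    -- the collapsible and critical edges
    (IsConnected C → IsConnected (V.X' 1 : Set X) ∧
      IsPreconnected (⋃ (e : RelCWComplex.cell C 1)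
        (_ : V.IsCollapsible 1 e ∨ V.IsCritical 1 e), RelCWComplex.closedCell 1 e)) ∧
    -- the collapsible edges and the `0`-skeleton
    ((V.X'' 1 : Set X) = (RelCWComplex.skeleton C 0 : Set X) ∪
        ⋃ (e : RelCWComplex.cell C 1) (_ : V.IsCollapsible 1 e), RelCWComplex.closedCell 1 e) ∧
    IsMaximalForest (V.X'' 1) ∧
    ((∃! v, V.IsCritical 0 v) → IsMaximalTree (V.X'' 1) ∧
      ((∃ e, V.IsCollapsible 1 e) → (V.X'' 1 : Set X) =
        ⋃ (e : RelCWComplex.cell C 1) (_ : V.IsCollapsible 1 e),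
          RelCWComplex.closedCell 1 e)) := by
  refine ⟨⟨V.X''_zero, V.X''_le_X', V.X'_le_X'', V.exists_X'_eq⟩, V.obtainedByAttaching,
    hV.collapses_X'' hC, fun n => ?_, fun n => ?_, fun k hk => hV.collapses_X' hC hk,
    hV.exists_homotopyEquiv hC,
    fun h => ⟨hV.isConnected_X'_one hC h, hV.isPreconnected_edges hC h⟩, V.coe_X''_one,
    hV.isMaximalForest hC, fun h => ⟨hV.isMaximalTree hC h,
      VectorField.X''_one_eq_of_isMaximalTree (hV.isMaximalTree hC h)⟩⟩
  -- Surjectivity on the `n`-th homotopy set needs only `n`-cubes; injectivity compresses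
  -- homotopies, which are `(n+1)`-cubes, whence the stage `n + 1`.
  · obtain ⟨h, hp⟩ := hV.pairConn hC (n + 1)
    exact ⟨h, hp.bijective_piMap (injective_incl h)⟩
  · obtain ⟨h, hp⟩ := hV.pairConn hC (n + 2)
    exact ⟨h, fun x => ⟨MulEquiv.ofBijective
      (MulHom.mk (piMap (n + 1) (incl h) x) (piMap_mul (incl h) x))
      (hp.bijective_piMap (injective_incl h) x), fun _ => rfl⟩⟩
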